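/- Let $\Bbbk$ be an algebraically closed field of characteristic zero and let $x\in\Bbbk$, $x\neq 0$. **Connections.** Let $\mathcal C_x$ be the category of pairs $(V,\nabla)$, where $V$ is a finite-dimensional vector space over $\Bbbk((z_x))$, $z_x=z-x$, and $\nabla:V\to V$ is $\Bbbk$-linear with $\nabla(fv)=f\nabla(v)+\frac{df}{dz_x}v$; morphisms are the $\Bbbk((z_x))$-linear maps commuting with $\nabla$. Let $\mathcal C_x^{\mathrm{nh}}\subset\mathcal C_x$ be the full subcategory of connections with no horizontal sections, i.e. $\ker\nabla=0$. **Difference operators.** Let $\mathcal N$ be the category of pairs $(V,\Phi)$, where $V$ is a finite-dimensional vector space over $K=\Bbbk((\theta))$ and $\Phi:V\to V$ is an invertible $\Bbbk$-linear map with $\Phi(fv)=\varphi(f)\Phi(v)$, where $\varphi(f)(\theta)=f\left(\frac{\theta}{1+\theta}\right)$; morphisms are the $K$-linear maps commuting with $\Phi$. For $q\ge 1$ extend $\varphi$ to $K_q=\Bbbk((\theta^{1/q}))$ by $\varphi(\theta^{1/q})=\theta^{1/q}\sum_{i\ge0}\binom{-1/q}{i}\theta^i$, and for $g\in K_q^*$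 put $D_{g,q}=(K_q,g\varphi)\in\mathcal N$. The irreducible components of an object of $\mathcal N$ are its irreducible subquotients. Let $\mathcal N^0$ (which depends on $x$) be the full subcategory of those $(V,\Phi)\in\mathcal N$ such that every irreducible component is isomorphic to some $D_{g,q}$ with $g$ of order zero and leading coefficient $x$, and such that $\Phi-x:V\to V$ is invertible. **Transform.** A finite-dimensional vector space over a field $\Bbbk((t))$ carries the $t$-adic topology, in which the cosets of the lattices $\bigoplus_i\Bbbk[[t]]e_i$ ($(e_i)$ a basis) form a basis of open sets. For $(V,\nabla)\in\mathcal C_x^{\mathrm{nh}}$ consider on $V$ the operators $\theta:=-(z\nabla)^{-1}$ and $\Phi:=z=x+z_x$. The local Mellin transform is $\mathcal M^{(x,\infty)}(V,\nabla)=(V_\theta,\Phi)$, where $V_\theta$ is $V$ with the action of $\theta$ extended to $\Bbbk((\theta))$ so that $V_\theta$ is finite-dimensional over $\Bbbk((\theta))$ and its $\theta$-adic topology coincides with the $z_x$-adic topology of $V$; on morphisms it is the identity on underlying maps. **Theorem.** $\mathcal M^{(x,\infty)}$ is a well-defined functor $\mathcal C_x^{\mathrm{nh}}\to\mathcal N$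 (it exists and is unique up to an isomorphism compatible with the identifications of the underlying $\Bbbk$-spaces with $V$), it takes values in $\mathcal N^0$, and it induces an equivalence of categories between $\mathcal C_x^{\mathrm{nh}}$ and $\mathcal N^0$. -/

import Mathlib

open CategoryTheory

universe u v

noncomputable section

namespace LocalMellin

open PowerSeries

/-! ### Laurent series: substitution, the shift and ramified extensions -/

/-- Substitution `f(t) ↦ f(a(t))` on `k((t))`, for a nonzero power series `a` without constant
term: the extension to `k((t))` of the substitution on `k[[t]]`. -/
def laurentSubst {k : Type u} [Field k] (a : PowerSeries k) (h0 : constantCoeff a = 0)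
    (ha : a ≠ 0) : LaurentSeries k →+* LaurentSeries k :=
  IsLocalization.lift (M := Submonoid.powers (PowerSeries.X : PowerSeries k))
    (g := (HahnSeries.ofPowerSeries ℤ k).comp
      (substAlgHom (R := k) (HasSubst.of_constantCoeff_zero' h0)).toRingHom)
    (by
      rintro ⟨_, n, rfl⟩
      have hX : (substAlgHom (R := k) (HasSubst.of_constantCoeff_zero' h0)) PowerSeries.X = a :=
        substAlgHom_X _
      have hne : HahnSeries.ofPowerSeries ℤ k a ≠ 0 := fun h =>
        ha (HahnSeries.ofPowerSeries_injective (h.trans (map_zero _).symm))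
      refine IsUnit.mk0 _ ?_
      simp only [map_pow]
      refine pow_ne_zero n ?_
      change HahnSeries.ofPowerSeries ℤ k
        ((substAlgHom (R := k) (HasSubst.of_constantCoeff_zero' h0)) PowerSeries.X) ≠ 0
      rw [hX]
      exact hne)

/-- The series `t (1 + t ^ q) ^ (-1/q) = t ∑ᵢ binom(-1/q, i) t ^ (q i)`. -/
def shiftSeries (k : Type u) [Field k] [CharZero k] (q : ℕ) [NeZero q] : PowerSeries k :=
  PowerSeries.X * PowerSeries.expand q (NeZero.ne q) (binomialSeries k (-1 / (q : ℚ)))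

lemma shiftSeries_constantCoeff (k : Type u) [Field k] [CharZero k] (q : ℕ) [NeZero q] :
    constantCoeff (shiftSeries k q) = 0 := by
  simp [shiftSeries]

lemma shiftSeries_ne_zero (k : Type u) [Field k] [CharZero k] (q : ℕ) [NeZero q] :
    shiftSeries k q ≠ 0 := by
  refine mul_ne_zero X_ne_zero fun h => ?_
  have h1 := congrArg constantCoeff h
  simp at h1

/-- The automorphism `φ` of `K_q = k((θ^{1/q}))`. We write `t = θ^{1/q}`, so that `K_q = k((t))`;
then `φ` sends `t` to `t (1 + θ) ^ (-1/q)`. For `q = 1` it is `f(θ) ↦ f(θ / (1 + θ))`. -/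
def shift (k : Type u) [Field k] [CharZero k] (q : ℕ) [NeZero q] :
    LaurentSeries k →+* LaurentSeries k :=
  laurentSubst (shiftSeries k q) (shiftSeries_constantCoeff k q) (shiftSeries_ne_zero k q)

/-- The inclusion of `K = k((θ))` into `K_q = k((t))`, `θ ↦ t ^ q`. -/
def ramify (k : Type u) [Field k] (q : ℕ) [NeZero q] : LaurentSeries k →+* LaurentSeries k :=
  laurentSubst (PowerSeries.X ^ q) (by simp [NeZero.ne q]) (pow_ne_zero q X_ne_zero)

/-- The local coordinate of `k((t))`. -/
def coord (k : Type u) [Field k] : LaurentSeries k := HahnSeries.single 1 1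

/-! ### The adic topology -/

/-- The lattice `⨁ᵢ k[[t]] bᵢ` spanned by a `k((t))`-basis `b` of `V`. -/
def lattice {k : Type u} [Field k] {V : Type v} [AddCommGroup V] [Module (LaurentSeries k) V]
    {ι : Type} (b : Module.Basis ι (LaurentSeries k) V) : Set V :=
  {w | ∀ i, b.repr w i ∈ Set.range (HahnSeries.ofPowerSeries ℤ k)}

/-- The adic topology on a finite-dimensional `k((t))`-vector space: the cosets `w + L` of
lattices `L` form a basis of open sets. -/
@[reducible]
def adicTopology (k : Type u) [Field k] (V : Type v) [AddCommGroup V]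
    [Module (LaurentSeries k) V] : TopologicalSpace V :=
  TopologicalSpace.generateFrom
    {U | ∃ (n : ℕ) (b : Module.Basis (Fin n) (LaurentSeries k) V) (w : V),
      U = (fun l => w + l) '' lattice b}

/-! ### Connections -/

/-- A finite-dimensional vector space with connection over `K = k((t))`. -/
structure Conn (k : Type u) [Field k] where
  /-- The underlying space. -/
  V : Type v
  [addCommGroup : AddCommGroup V]
  [moduleBase : Module k V]
  [module : Module (LaurentSeries k) V]
  [tower : IsScalarTower k (LaurentSeries k) V]
  [finite : FiniteDimensional (LaurentSeries k) V]
  /-- The connection. -/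
  nabla : V →ₗ[k] V
  leibniz : ∀ (f : LaurentSeries k) (w : V),
    nabla (f • w) = f • nabla w + LaurentSeries.derivative k f • w

attribute [instance] Conn.addCommGroup Conn.moduleBase Conn.module Conn.tower Conn.finite

/-- Horizontal `K`-linear maps. -/
@[ext]
structure Conn.Hom {k : Type u} [Field k] (E₁ E₂ : Conn.{u, v} k) where
  /-- The underlying `K`-linear map. -/
  map : E₁.V →ₗ[LaurentSeries k] E₂.V
  comm : ∀ w, map (E₁.nabla w) = E₂.nabla (map w)

instance Conn.category (k : Type u) [Field k] : Category (Conn.{u, v} k) where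
  Hom E₁ E₂ := Conn.Hom E₁ E₂
  id E := ⟨LinearMap.id, fun _ => rfl⟩
  comp f g := ⟨g.map.comp f.map, fun w => by simp [f.comm, g.comm]⟩

/-- The connection has no nonzero horizontal sections. -/
def noHorizontalSections (k : Type u) [Field k] : ObjectProperty (Conn.{u, v} k) :=
  fun E => ∀ w : E.V, E.nabla w = 0 → w = 0

/-! ### Difference operators -/

/-- A finite-dimensional vector space with invertible difference operator over `K = k((θ))`. -/
structure Diff (k : Type u) [Field k] [CharZero k] where
  /-- The underlying space. -/
  V : Type v
  [addCommGroup : AddCommGroup V]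
  [moduleBase : Module k V]
  [module : Module (LaurentSeries k) V]
  [tower : IsScalarTower k (LaurentSeries k) V]
  [finite : FiniteDimensional (LaurentSeries k) V]
  /-- The difference operator, an invertible `k`-linear map. -/
  Phi : V ≃ₗ[k] V
  semilinear : ∀ (f : LaurentSeries k) (w : V), Phi (f • w) = shift k 1 f • Phi w

attribute [instance] Diff.addCommGroup Diff.moduleBase Diff.module Diff.tower Diff.finite

/-- `K`-linear maps that commute with the difference operators. -/
@[ext]
structure Diff.Hom {k : Type u} [Field k] [CharZero k] (D₁ D₂ : Diff.{u, v} k) where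
  /-- The underlying `K`-linear map. -/
  map : D₁.V →ₗ[LaurentSeries k] D₂.V
  comm : ∀ w, map (D₁.Phi w) = D₂.Phi (map w)

instance Diff.category (k : Type u) [Field k] [CharZero k] : Category (Diff.{u, v} k) where
  Hom D₁ D₂ := Diff.Hom D₁ D₂
  id D := ⟨LinearMap.id, fun _ => rfl⟩
  comp f g := ⟨g.map.comp f.map, fun w => by simp [f.comm, g.comm]⟩

variable {k : Type u} [Field k] [CharZero k]

/-- `S` is an irreducible object: it is nonzero and has no proper nonzero subobject. -/
def Diff.IsIrreducible (S : Diff.{u, v} k) : Prop :=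
  Nontrivial S.V ∧ ∀ W : Submodule (LaurentSeries k) S.V,
    (∀ w ∈ W, S.Phi w ∈ W) → W = ⊥ ∨ W = ⊤

/-- `S` is an irreducible component of `D`: an irreducible object that is a quotient of a
subobject of `D`. -/
def Diff.IsIrreducibleComponent (S D : Diff.{u, v} k) : Prop :=
  S.IsIrreducible ∧ ∃ (P : Diff.{u, v} k) (i : P ⟶ D) (p : P ⟶ S),
    Function.Injective (Diff.Hom.map i) ∧ Function.Surjective (Diff.Hom.map p)

/-- `S` is isomorphic to `D_{g,q} = (K_q, g φ)`, where `K = k((θ))` acts on `K_q` through the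
inclusion `K ⊆ K_q`. -/
def Diff.IsIsoTo (S : Diff.{u, v} k) (q : ℕ) [NeZero q] (g : LaurentSeries k) : Prop :=
  ∃ e : S.V ≃+ LaurentSeries k,
    (∀ (f : LaurentSeries k) (w : S.V), e (f • w) = ramify k q f * e w) ∧
    ∀ w : S.V, e (S.Phi w) = g * shift k q (e w)

/-- All irreducible components of `D = (V, Φ)` have order zero with the same leading coefficient
`x` (that is, they are `D_{g,q}` with `g = x + (terms of positive order)`), and `Φ - x` is
invertible. -/
def orderZero (x : k) : ObjectProperty (Diff.{u, v} k) :=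
  fun D =>
    (∀ S : Diff.{u, v} k, S.IsIrreducibleComponent D →
      ∃ (q : ℕ) (_ : NeZero q) (g : LaurentSeries k),
        g.order = 0 ∧ g.leadingCoeff = x ∧ S.IsIsoTo q g) ∧
    Function.Bijective (fun w : D.V => D.Phi w - x • w)

/-! ### The local Mellin transform -/

/-- The function `z = x + z_x` in `k((z_x))`, where `z_x` is the local coordinate at `x`. -/
def zFun (x : k) : LaurentSeries k := HahnSeries.C x + coord k

/-- The `k`-linear bijection `e : V ≃ W` exhibits `(W, Φ)` as `V` with the operators
`θ = -(z∇)⁻¹` and `Φ = z`, where the action of `θ` is extended to `k((θ))` compatibly with the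
topology of `V`. -/
structure IsMellin (x : k) (E : Conn.{u, v} k) (D : Diff.{u, v} k) (e : E.V ≃ₗ[k] D.V) :
    Prop where
  /-- The operator `-(z∇)` is inverse to the action of `θ` (which is bijective). -/
  theta : ∀ w : E.V, coord k • e (-(zFun x • E.nabla w)) = e w
  phi : ∀ w : E.V, D.Phi (e w) = e (zFun x • w)
  /-- The `θ`-adic topology coincides with the `z_x`-adic topology. -/
  topology : adicTopology k E.V = (adicTopology k D.V).induced e

/-- A functor `(V, ∇) ↦ (V_θ, Φ)` realizing the local Mellin transform from `x` to infinity on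
connections without horizontal sections; on morphisms it is the identity on underlying maps. -/
structure Transform (x : k) where
  /-- The functor. -/
  functor : (noHorizontalSections.{u, v} k).FullSubcategory ⥤ Diff.{u, v} k
  /-- The identification of `V_θ` with `V` over `k`. -/
  ident : ∀ E, E.obj.V ≃ₗ[k] (functor.obj E).V
  isMellin : ∀ E, IsMellin x E.obj (functor.obj E) (ident E)
  map_ident : ∀ {E₁ E₂} (f : E₁ ⟶ E₂) (w : E₁.obj.V),
    Diff.Hom.map (functor.map f) (ident E₁ w) = ident E₂ (Conn.Hom.map f.hom w)

end LocalMellin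

end

/-! Put `θ = -(z∇)⁻¹` and `Φ = z`. The Leibniz rule `∇z = z∇ + 1` is equivalent to `(1 + θ)Φθ = θΦ`,
which says that `Φ` is semilinear for `θ ↦ θ/(1 + θ)`. Conversely `z_x = Φ - x` and `∇ = -Φ⁻¹θ⁻¹`.
Both categories thus describe one `k`-space carrying the same pair of operators, and the content of
the theorem is topological: the uniformizer of either side must be an automorphism that is
topologically nilpotent, with bounded inverse, for the lattices of the other side.
`exists_operator_module` turns such an automorphism into the uniformizer of a new finite-dimensional
`k((t))`-structure with the same topology. Since Laurent polynomials are dense,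
`semilinear_of_coord` and `leibniz_of_coord` reduce semilinearity and the Leibniz rule to the
uniformizer. Uniqueness and full faithfulness follow by the same continuity argument.

The bound on the inverse is `Twist.IsTwisted.exists_bounded_inverse`, which treats `t∇` and `Φ - x`
together as operators with `B(fw) = σ(f)Bw + ν(f)w`. On a cyclic module the equation `Bu = w`
eliminates to one scalar equation in `k((t))`, whose operator multiplies `t ^ j` by a polynomial in
`j` to leading order; injectivity excludes integral roots of this polynomial, so the equation is
solved degree by degree. General modules follow by extension. For `t∇` no power of `t` is lost on a
suitable lattice, so `θ` raises that lattice by one degree.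

Essential surjectivity requires `Φ - x` to be topologically nilpotent on objects of `𝒩⁰`. On
`D_{g,q}` with `g = x + …` it raises the `θ ^ (1/q)`-order by at least one, and lattices with this
property can be glued in extensions (`HasGoodLattice.extension`, `hasGoodLattice_of_components`).

For the image to lie in `𝒩⁰`, irreducible difference modules have to be classified. A Turrittin-type
reduction (`allHaveQuotient`) produces a nonzero map to a rank one module over some `K_q`: the
Newton polygon of a cyclic vector determines a slope, ramification makes it integral, distinct
leading eigenvalues split off a stable subspace, and a single eigenvalue is subtracted before
repeating until the operator is regular and has an eigenvector. For an irreducible module and the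
least possible ramification, Galois descent along `t ↦ ζt` makes this map an isomorphism
(`Diff.IsIrreducible.exists_isIsoTo`). As `Φ - x` acts as `z_x`, it is topologically nilpotent on
every subquotient, which forces `g = x + …` (`Diff.TopNilpotent.order_eq`). -/

noncomputable section

namespace LocalMellin

open PowerSeries

/-! ### The order filtration of `k((t))` -/

section OrderFiltration

variable {k : Type u} [Field k]

/-- The Laurent series of order at least `j`. -/
def ordGE (k : Type u) [Field k] (j : ℤ) : Submodule k (LaurentSeries k) where
  carrier := {f | ∀ i < j, f.coeff i = 0}
  add_mem' := fun {f g} hf hg i hi => by simp [hf i hi, hg i hi]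
  zero_mem' := fun i _ => by simp
  smul_mem' := fun c f hf i hi => by simp [hf i hi]

/-- The monomial `t ^ j`. -/
def tpow (k : Type u) [Field k] (j : ℤ) : LaurentSeries k := HahnSeries.single j 1

lemma mem_ordGE {j : ℤ} {f : LaurentSeries k} : f ∈ ordGE k j ↔ ∀ i < j, f.coeff i = 0 := Iff.rfl

lemma ordGE_anti {i j : ℤ} (h : i ≤ j) : ordGE k j ≤ ordGE k i := fun _ hf l hl => hf l (by omega)

lemma coord_eq_tpow : coord k = tpow k 1 := rfl

lemma tpow_add (i j : ℤ) : tpow k (i + j) = tpow k i * tpow k j := by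
  simp [tpow, HahnSeries.single_mul_single]

@[simp] lemma tpow_zero : tpow k 0 = 1 := rfl

lemma tpow_ne_zero (j : ℤ) : tpow k j ≠ 0 := by simp [tpow]

lemma tpow_neg_mul (j : ℤ) : tpow k (-j) * tpow k j = 1 := by rw [← tpow_add]; simp

lemma tpow_mul_neg (j : ℤ) : tpow k j * tpow k (-j) = 1 := by rw [← tpow_add]; simp

lemma tpow_natCast (n : ℕ) : tpow k n = tpow k 1 ^ n := by
  induction n with
  | zero => simp
  | succ n ih => rw [pow_succ, ← ih, ← tpow_add]; simp

lemma tpow_inv (j : ℤ) : (tpow k j)⁻¹ = tpow k (-j) :=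
  inv_eq_of_mul_eq_one_right (tpow_mul_neg j)

lemma tpow_eq_zpow (j : ℤ) : tpow k j = tpow k 1 ^ j := by
  obtain ⟨n, rfl | rfl⟩ := j.eq_nat_or_neg
  · rw [tpow_natCast, zpow_natCast]
  · rw [zpow_neg, zpow_natCast, ← tpow_natCast, tpow_inv]

lemma coeff_tpow (i j : ℤ) : (tpow k j).coeff i = if i = j then 1 else 0 := by
  simp [tpow, HahnSeries.coeff_single]

lemma coeff_tpow_mul (j i : ℤ) (f : LaurentSeries k) :
    (tpow k j * f).coeff i = f.coeff (i - j) := by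
  have := HahnSeries.coeff_single_mul_add (r := (1 : k)) (x := f) (a := i - j) (b := j)
  simpa [tpow] using this

lemma tpow_mem (j : ℤ) : tpow k j ∈ ordGE k j := fun i hi => by simp [coeff_tpow, hi.ne]

lemma tpow_mem_of_le {i j : ℤ} (h : i ≤ j) : tpow k j ∈ ordGE k i := ordGE_anti h (tpow_mem j)

lemma one_mem_ordGE : (1 : LaurentSeries k) ∈ ordGE k 0 := tpow_mem 0

lemma tpow_mul_mem {j i : ℤ} {f : LaurentSeries k} :
    tpow k j * f ∈ ordGE k i ↔ f ∈ ordGE k (i - j) := by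
  simp only [mem_ordGE, coeff_tpow_mul]
  constructor
  · intro h l hl
    simpa using h (l + j) (by omega)
  · intro h l hl
    exact h _ (by omega)

lemma mem_ordGE_zero {f : LaurentSeries k} :
    f ∈ ordGE k 0 ↔ f ∈ Set.range (HahnSeries.ofPowerSeries ℤ k) := by
  constructor
  · intro h
    refine ⟨PowerSeries.mk fun n => f.coeff n, ?_⟩
    ext i
    obtain ⟨n, rfl | rfl⟩ := i.eq_nat_or_neg
    · rw [HahnSeries.ofPowerSeries_apply_coeff]; simp
    · rcases Nat.eq_zero_or_pos n with rfl | hn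
      · simpa using HahnSeries.ofPowerSeries_apply_coeff (Γ := ℤ)
          (PowerSeries.mk fun n => f.coeff n) 0
      · rw [h _ (by omega), PowerSeries.coeff_coe, if_pos (by omega)]
  · rintro ⟨p, rfl⟩ i hi
    rw [PowerSeries.coeff_coe, if_pos hi]

lemma ofPowerSeries_mem (p : PowerSeries k) : HahnSeries.ofPowerSeries ℤ k p ∈ ordGE k 0 :=
  mem_ordGE_zero.2 ⟨p, rfl⟩

lemma coeff_zero_ofPowerSeries (p : PowerSeries k) :
    (HahnSeries.ofPowerSeries ℤ k p).coeff 0 = constantCoeff p := by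
  have := HahnSeries.ofPowerSeries_apply_coeff (Γ := ℤ) p 0
  simpa using this

lemma exists_eq_tpow_mul {j : ℤ} {f : LaurentSeries k} (h : f ∈ ordGE k j) :
    ∃ p : PowerSeries k, f = tpow k j * HahnSeries.ofPowerSeries ℤ k p := by
  have : tpow k (-j) * f ∈ ordGE k 0 := by rw [tpow_mul_mem]; simpa using h
  obtain ⟨p, hp⟩ := mem_ordGE_zero.1 this
  exact ⟨p, by rw [hp, ← mul_assoc, tpow_mul_neg, one_mul]⟩

lemma mul_mem_ordGE {i j : ℤ} {f g : LaurentSeries k} (hf : f ∈ ordGE k i) (hg : g ∈ ordGE k j) :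
    f * g ∈ ordGE k (i + j) := by
  obtain ⟨p, rfl⟩ := exists_eq_tpow_mul hf
  obtain ⟨q, rfl⟩ := exists_eq_tpow_mul hg
  rw [mul_mul_mul_comm, ← tpow_add, ← map_mul, tpow_mul_mem]
  simpa using ofPowerSeries_mem (p * q)

lemma coeff_mul_ordGE {i j : ℤ} {f g : LaurentSeries k} (hf : f ∈ ordGE k i)
    (hg : g ∈ ordGE k j) : (f * g).coeff (i + j) = f.coeff i * g.coeff j := by
  obtain ⟨p, rfl⟩ := exists_eq_tpow_mul hf
  obtain ⟨q, rfl⟩ := exists_eq_tpow_mul hg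
  rw [mul_mul_mul_comm, ← tpow_add, ← map_mul]
  rw [coeff_tpow_mul, coeff_tpow_mul, coeff_tpow_mul, sub_self, sub_self, sub_self,
    coeff_zero_ofPowerSeries, coeff_zero_ofPowerSeries, coeff_zero_ofPowerSeries, map_mul]

lemma mul_mem_of_le {i j l : ℤ} {f g : LaurentSeries k} (hf : f ∈ ordGE k i)
    (hg : g ∈ ordGE k j) (h : l ≤ i + j) : f * g ∈ ordGE k l :=
  ordGE_anti h (mul_mem_ordGE hf hg)

lemma mem_ordGE_order (f : LaurentSeries k) : f ∈ ordGE k f.order := fun _ hi =>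
  HahnSeries.coeff_eq_zero_of_lt_order hi

lemma exists_mem_ordGE (f : LaurentSeries k) : ∃ j, f ∈ ordGE k j := ⟨_, mem_ordGE_order f⟩

lemma mem_ordGE_succ {j : ℤ} {f : LaurentSeries k} :
    f ∈ ordGE k (j + 1) ↔ f ∈ ordGE k j ∧ f.coeff j = 0 := by
  constructor
  · exact fun h => ⟨ordGE_anti (by omega) h, h _ (by omega)⟩
  · rintro ⟨h, h0⟩ i hi
    rcases (show i ≤ j by omega).lt_or_eq with h' | rfl
    exacts [h _ h', h0]

lemma eq_zero_of_forall_mem {f : LaurentSeries k} (h : ∀ N : ℕ, f ∈ ordGE k N) : f = 0 := by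
  ext i
  exact h (i.toNat + 1) i (by push_cast; omega)

lemma coeff_order_ne {f : LaurentSeries k} (h : f ≠ 0) : f.coeff f.order ≠ 0 :=
  HahnSeries.coeff_order_eq_zero.not.2 h

lemma C_mem (c : k) : (HahnSeries.C c : LaurentSeries k) ∈ ordGE k 0 := fun i hi => by
  simp [HahnSeries.C_apply, hi.ne]

lemma smul_eq_C_mul (c : k) (f : LaurentSeries k) : c • f = HahnSeries.C c * f := by
  simp

instance isScalarTower_self : IsScalarTower k (LaurentSeries k) (LaurentSeries k) :=
  ⟨fun c f g => by rw [smul_eq_mul, smul_eq_mul, smul_eq_C_mul, smul_eq_C_mul, mul_assoc]⟩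

lemma C_smul {V : Type v} [AddCommGroup V] [Module k V] [Module (LaurentSeries k) V]
    [IsScalarTower k (LaurentSeries k) V] (c : k) (w : V) :
    (HahnSeries.C c : LaurentSeries k) • w = c • w := by
  rw [← one_smul (LaurentSeries k) w, ← smul_assoc c, smul_eq_C_mul, mul_one, one_smul]

/-- A property of Laurent series stable under `k`-linear combinations which holds for all
monomials of degree at least `j` and for all series of large order holds on `ordGE k j`. -/
lemma ordGE_induction {p : LaurentSeries k → Prop} {j N : ℤ}
    (hadd : ∀ f g, p f → p g → p (f + g)) (hmon : ∀ i ≥ j, ∀ c : k, p (c • tpow k i))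
    (htail : ∀ f ∈ ordGE k N, p f) {f : LaurentSeries k} (hf : f ∈ ordGE k j) : p f := by
  obtain ⟨n, hn⟩ : ∃ n : ℕ, N ≤ j + n := ⟨(N - j).toNat, by omega⟩
  induction n generalizing j f with
  | zero => exact htail _ (ordGE_anti (by simpa using hn) hf)
  | succ n ih =>
    have h1 : f - f.coeff j • tpow k j ∈ ordGE k (j + 1) := by
      refine mem_ordGE_succ.2 ⟨sub_mem hf ((ordGE k j).smul_mem _ (tpow_mem j)), ?_⟩
      simp [coeff_tpow]
    have h2 := hadd _ _ (hmon j le_rfl (f.coeff j)) (ih (j := j + 1)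
      (fun i hi c => hmon i (by omega) c) h1 (by push_cast at hn; omega))
    simpa using h2

/-- Completeness of `k((t))`: only the terms with index at most `l - j` contribute in degree `l`, so
the infinite sum is defined coefficientwise by finite sums. -/
lemma exists_sum_ordGE (w : ℕ → LaurentSeries k) (j : ℤ) (hw : ∀ i : ℕ, w i ∈ ordGE k (j + i)) :
    ∃ f : LaurentSeries k, ∀ N : ℕ, f - ∑ i ∈ Finset.range N, w i ∈ ordGE k (j + N) := by
  have hb : BddBelow (Function.support fun l : ℤ =>
      ∑ i ∈ Finset.range (l - j + 1).toNat, (w i).coeff l) := by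
    refine ⟨j, fun l hl => ?_⟩
    by_contra h
    refine hl ?_
    simp [show (l - j + 1).toNat = 0 by omega]
  refine ⟨HahnSeries.ofSuppBddBelow _ hb, fun N l hl => ?_⟩
  rw [HahnSeries.coeff_sub, HahnSeries.coeff_sum]
  change (∑ i ∈ Finset.range (l - j + 1).toNat, (w i).coeff l) - _ = 0
  rw [sub_eq_zero]
  refine Finset.sum_subset (Finset.range_mono (by omega)) fun i _ hi => ?_
  exact hw i l (by simp at hi; omega)

end OrderFiltration

/-! ### The lattice filtration attached to a basis -/

section LatticeFiltration

variable {k : Type u} [Field k] {V : Type v} [AddCommGroup V] [Module k V]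
  [Module (LaurentSeries k) V] [IsScalarTower k (LaurentSeries k) V]
  {ι : Type*} (b : Module.Basis ι (LaurentSeries k) V)

/-- The lattice `t ^ j L`, where `L` is the lattice spanned by the basis `b`. -/
def Lat (j : ℤ) : Submodule k V where
  carrier := {w | ∀ i, b.repr w i ∈ ordGE k j}
  add_mem' := fun {f g} hf hg i => by simpa using add_mem (hf i) (hg i)
  zero_mem' := fun i => by simp
  smul_mem' := fun c f hf i => by
    rw [← C_smul, map_smul, Finsupp.smul_apply, smul_eq_mul, ← smul_eq_C_mul]
    exact Submodule.smul_mem _ _ (hf i)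

lemma mem_Lat {j : ℤ} {w : V} : w ∈ Lat b j ↔ ∀ i, b.repr w i ∈ ordGE k j := Iff.rfl

lemma Lat_anti {i j : ℤ} (h : i ≤ j) : Lat b j ≤ Lat b i := fun _ hw l => ordGE_anti h (hw l)

lemma smul_mem_Lat {i j : ℤ} {f : LaurentSeries k} {w : V} (hf : f ∈ ordGE k i)
    (hw : w ∈ Lat b j) : f • w ∈ Lat b (i + j) := fun l => by
  simpa using mul_mem_ordGE hf (hw l)

lemma smul_mem_Lat_of_le {i j l : ℤ} {f : LaurentSeries k} {w : V} (hf : f ∈ ordGE k i)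
    (hw : w ∈ Lat b j) (h : l ≤ i + j) : f • w ∈ Lat b l := Lat_anti b h (smul_mem_Lat b hf hw)

lemma tpow_smul_mem_Lat {i j : ℤ} {w : V} : tpow k i • w ∈ Lat b j ↔ w ∈ Lat b (j - i) := by
  simp only [mem_Lat, map_smul, Finsupp.smul_apply, smul_eq_mul, tpow_mul_mem]

lemma basis_mem_Lat (i : ι) : b i ∈ Lat b 0 := fun l => by
  classical
  rw [b.repr_self, Finsupp.single_apply]
  split_ifs
  exacts [one_mem_ordGE, zero_mem _]

lemma exists_mem_Lat [Finite ι] (w : V) : ∃ j, w ∈ Lat b j := by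
  cases nonempty_fintype ι
  have : ∀ i, ∃ j, b.repr w i ∈ ordGE k j := fun i => exists_mem_ordGE _
  choose J hJ using this
  obtain ⟨m, hm⟩ := (Set.finite_range J).bddBelow
  exact ⟨m, fun i => ordGE_anti (hm ⟨i, rfl⟩) (hJ i)⟩

lemma eq_zero_of_forall_mem_Lat {w : V} (h : ∀ N : ℕ, w ∈ Lat b N) : w = 0 := by
  refine b.ext_elem fun i => ?_
  rw [eq_zero_of_forall_mem fun N => h N i]
  simp

lemma exists_sum_Lat [Finite ι] (w : ℕ → V) (j : ℤ) (hw : ∀ i : ℕ, w i ∈ Lat b (j + i)) :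
    ∃ v : V, ∀ N : ℕ, v - ∑ i ∈ Finset.range N, w i ∈ Lat b (j + N) := by
  cases nonempty_fintype ι
  choose f hf using fun l => exists_sum_ordGE (fun i => b.repr (w i) l) j fun i => hw i l
  refine ⟨b.equivFun.symm f, fun N l => ?_⟩
  have := hf l N
  rw [map_sub, Finsupp.sub_apply]
  convert this using 2
  · rw [← b.equivFun_apply, LinearEquiv.apply_symm_apply]
  · rw [map_sum, Finsupp.finsetSum_apply]

/-- Successive approximation. -/
lemma exists_limit [Finite ι] (Q : ℕ → V → Prop) (j : ℤ) {v₀ : V} (h0 : Q 0 v₀)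
    (hs : ∀ i v, Q i v → ∃ w ∈ Lat b (j + i), Q (i + 1) (v + w)) :
    ∃ v, v - v₀ ∈ Lat b j ∧ ∀ i, ∃ v', Q i v' ∧ v - v' ∈ Lat b (j + i) := by
  choose! W hW hQ using hs
  let s : ℕ → V := fun n => Nat.rec v₀ (fun i v => v + W i v) n
  have hsQ : ∀ i, Q i (s i) := fun i => by
    induction i with
    | zero => exact h0
    | succ i ih => exact hQ i _ ih
  obtain ⟨y, hy⟩ := exists_sum_Lat b (fun i => W i (s i)) j fun i => hW i _ (hsQ i)
  have hsum : ∀ N, s N = v₀ + ∑ i ∈ Finset.range N, W i (s i) := fun N => by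
    induction N with
    | zero => simp [s]
    | succ N ih =>
      rw [Finset.sum_range_succ, ← add_assoc, ← ih]
  refine ⟨v₀ + y, by simpa using hy 0, fun i => ⟨s i, hsQ i, ?_⟩⟩
  rw [hsum i, add_sub_add_left_eq_sub]
  exact hy i

lemma map_mem_Lat_of_basis [Finite ι] {V' : Type*} [AddCommGroup V'] [Module k V']
    [Module (LaurentSeries k) V'] [IsScalarTower k (LaurentSeries k) V'] {ι' : Type*}
    (b' : Module.Basis ι' (LaurentSeries k) V') (g : V →ₗ[LaurentSeries k] V') {c j : ℤ}
    (hg : ∀ i, g (b i) ∈ Lat b' c) {w : V} (hw : w ∈ Lat b j) : g w ∈ Lat b' (j + c) := by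
  cases nonempty_fintype ι
  rw [← b.sum_repr w, map_sum]
  refine Submodule.sum_mem _ fun i _ => ?_
  rw [map_smul]
  exact smul_mem_Lat b' (hw i) (hg i)

/-- Linear maps are bounded. -/
lemma exists_bound_linearMap [Finite ι] {V' : Type*} [AddCommGroup V'] [Module k V']
    [Module (LaurentSeries k) V'] [IsScalarTower k (LaurentSeries k) V'] {ι' : Type*} [Finite ι']
    (b' : Module.Basis ι' (LaurentSeries k) V') (g : V →ₗ[LaurentSeries k] V') :
    ∃ c : ℕ, ∀ j, ∀ w ∈ Lat b j, g w ∈ Lat b' (j - c) := by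
  choose J hJ using fun i => exists_mem_Lat b' (g (b i))
  obtain ⟨m, hm⟩ := (Set.finite_range J).bddBelow
  refine ⟨(-m).toNat, fun j w hw => ?_⟩
  have := map_mem_Lat_of_basis b b' g (c := m) (fun i => Lat_anti b' (hm ⟨i, rfl⟩) (hJ i)) hw
  exact Lat_anti b' (by omega) this

lemma lattice_eq {ι : Type} (b : Module.Basis ι (LaurentSeries k) V) :
    lattice b = (Lat b 0 : Set V) := by
  ext w
  simp only [lattice, Set.mem_ofPred_eq, SetLike.mem_coe, mem_Lat, mem_ordGE_zero]

end LatticeFiltration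

/-- A `k`-linear map from `k((t))` which is continuous and vanishes on monomials is zero. -/
lemma eq_zero_of_tpow {k : Type u} [Field k] {V : Type v} [AddCommGroup V] [Module k V]
    [Module (LaurentSeries k) V] [IsScalarTower k (LaurentSeries k) V] {ι : Type*}
    (b : Module.Basis ι (LaurentSeries k) V) (G : LaurentSeries k →ₗ[k] V)
    (h0 : ∀ j, G (tpow k j) = 0) (hc : ∀ N : ℕ, ∃ i, ∀ f ∈ ordGE k i, G f ∈ Lat b N)
    (f : LaurentSeries k) : G f = 0 := by
  refine eq_zero_of_forall_mem_Lat b fun N => ?_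
  obtain ⟨i, hi⟩ := hc N
  obtain ⟨j, hj⟩ := exists_mem_ordGE f
  refine ordGE_induction (p := fun f => G f ∈ Lat b N) (N := i) ?_ ?_ hi hj
  · intro f g hf hg
    rw [map_add]; exact add_mem hf hg
  · intro i _ c
    simp [h0]

/-! ### Properties of the shift and of ramified extensions -/

section Subst

variable {k : Type u} [Field k]

lemma laurentSubst_coe {a : PowerSeries k} (h0 : constantCoeff a = 0) (ha : a ≠ 0)
    (p : PowerSeries k) : laurentSubst a h0 ha (HahnSeries.ofPowerSeries ℤ k p) =
      HahnSeries.ofPowerSeries ℤ k (p.subst a) := by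
  have h := IsLocalization.lift_eq (M := Submonoid.powers (PowerSeries.X : PowerSeries k))
    (S := LaurentSeries k) (g := (HahnSeries.ofPowerSeries ℤ k).comp
      (substAlgHom (R := k) (HasSubst.of_constantCoeff_zero' h0)).toRingHom) (by
      rintro ⟨_, n, rfl⟩
      have hX : (substAlgHom (R := k) (HasSubst.of_constantCoeff_zero' h0)) PowerSeries.X = a :=
        substAlgHom_X _
      have hne : HahnSeries.ofPowerSeries ℤ k a ≠ 0 := fun h =>
        ha (HahnSeries.ofPowerSeries_injective (h.trans (map_zero _).symm))
      refine IsUnit.mk0 _ ?_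
      simp only [map_pow]
      refine pow_ne_zero n ?_
      change HahnSeries.ofPowerSeries ℤ k
        ((substAlgHom (R := k) (HasSubst.of_constantCoeff_zero' h0)) PowerSeries.X) ≠ 0
      rw [hX]
      exact hne) p
  refine h.trans ?_
  change HahnSeries.ofPowerSeries ℤ k
    ((substAlgHom (R := k) (HasSubst.of_constantCoeff_zero' h0)) p) = _
  rw [coe_substAlgHom]

lemma laurentSubst_C {a : PowerSeries k} (h0 : constantCoeff a = 0) (ha : a ≠ 0) (c : k) :
    laurentSubst a h0 ha (HahnSeries.C c) = HahnSeries.C c := by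
  rw [← HahnSeries.ofPowerSeries_C, laurentSubst_coe, subst_C]
  rfl

lemma laurentSubst_smul {a : PowerSeries k} (h0 : constantCoeff a = 0) (ha : a ≠ 0) (c : k)
    (f : LaurentSeries k) : laurentSubst a h0 ha (c • f) = c • laurentSubst a h0 ha f := by
  rw [smul_eq_C_mul, map_mul, laurentSubst_C, ← smul_eq_C_mul]

lemma laurentSubst_tpow_one {a : PowerSeries k} (h0 : constantCoeff a = 0) (ha : a ≠ 0) :
    laurentSubst a h0 ha (tpow k 1) = HahnSeries.ofPowerSeries ℤ k a := by
  have : tpow k 1 = HahnSeries.ofPowerSeries ℤ k X := by rw [HahnSeries.ofPowerSeries_X]; rfl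
  rw [this, laurentSubst_coe, subst_X (HasSubst.of_constantCoeff_zero' h0)]

lemma laurentSubst_tpow {a : PowerSeries k} (h0 : constantCoeff a = 0) (ha : a ≠ 0) (j : ℤ) :
    laurentSubst a h0 ha (tpow k j) = HahnSeries.ofPowerSeries ℤ k a ^ j := by
  rw [tpow_eq_zpow, map_zpow₀, laurentSubst_tpow_one]

end Subst

section Ramify

variable {k : Type u} [Field k] (m : ℕ) [NeZero m]

lemma ramify_C (c : k) : ramify k m (HahnSeries.C c) = HahnSeries.C c := laurentSubst_C _ _ c

lemma ramify_smul (c : k) (f : LaurentSeries k) : ramify k m (c • f) = c • ramify k m f :=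
  laurentSubst_smul _ _ c f

lemma ramify_tpow (j : ℤ) : ramify k m (tpow k j) = tpow k (m * j) := by
  rw [ramify, laurentSubst_tpow, HahnSeries.ofPowerSeries_X_pow, tpow_eq_zpow (_ * j),
    zpow_mul, zpow_natCast, ← tpow_natCast]
  rfl

lemma ramify_mem {j : ℤ} {f : LaurentSeries k} (hf : f ∈ ordGE k j) :
    ramify k m f ∈ ordGE k (m * j) := by
  obtain ⟨p, rfl⟩ := exists_eq_tpow_mul hf
  rw [map_mul, ramify_tpow, ramify, laurentSubst_coe, tpow_mul_mem, sub_self]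
  exact ofPowerSeries_mem _

/-- The ramified inclusion as a `k`-linear map. -/
def ramifyLin (k : Type u) [Field k] (m : ℕ) [NeZero m] : LaurentSeries k →ₗ[k] LaurentSeries k where
  toFun := ramify k m
  map_add' := map_add _
  map_smul' := ramify_smul m

lemma coeff_ramify_mul (f : LaurentSeries k) (j : ℤ) :
    (ramify k m f).coeff (m * j) = f.coeff j := by
  obtain ⟨a, ha⟩ := exists_mem_ordGE f
  refine ordGE_induction (p := fun f => (ramify k m f).coeff (m * j) = f.coeff j) (N := j + 1)
    ?_ ?_ ?_ ha
  · intro f g hf hg; simp [hf, hg]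
  · intro i _ c
    simp [ramify_smul, ramify_tpow, coeff_tpow, NeZero.ne m]
  · intro f hf
    rw [hf j (by omega), ramify_mem m hf _ ?_]
    have : 0 < (m : ℤ) := by have := NeZero.pos m; exact_mod_cast this
    nlinarith

lemma coeff_ramify_of_not_dvd (f : LaurentSeries k) {i : ℤ} (hi : ¬ (m : ℤ) ∣ i) :
    (ramify k m f).coeff i = 0 := by
  have hm : 0 < (m : ℤ) := by have := NeZero.pos m; exact_mod_cast this
  obtain ⟨a, ha⟩ := exists_mem_ordGE f
  refine ordGE_induction (p := fun f => (ramify k m f).coeff i = 0) (N := |i| + 1)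
    ?_ ?_ ?_ ha
  · intro f g hf hg; simp [hf, hg]
  · intro l _ c
    simp only [ramify_smul, ramify_tpow, HahnSeries.coeff_smul, coeff_tpow]
    rw [if_neg]
    · simp
    · rintro rfl; exact hi ⟨_, rfl⟩
  · intro f hf
    refine ramify_mem m hf _ ?_
    nlinarith [le_abs_self i, abs_nonneg i]

/-- The `i`-th component in the decomposition `k((s)) = ⨁ᵢ sⁱ k((s ^ m))`. -/
def dec (k : Type u) [Field k] (m : ℕ) [NeZero m] (i : ℕ) :
    LaurentSeries k →ₗ[k] LaurentSeries k where
  toFun f := HahnSeries.ofSuppBddBelow (fun j : ℤ => f.coeff (m * j + i)) (by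
    have hm : 1 ≤ (m : ℤ) := by have := NeZero.pos m; exact_mod_cast this
    refine ⟨-|f.order - i|, fun j hj => ?_⟩
    by_contra h
    refine hj (HahnSeries.coeff_eq_zero_of_lt_order ?_)
    have := neg_abs_le (f.order - i)
    nlinarith [abs_nonneg (f.order - i)])
  map_add' f g := by ext; simp [HahnSeries.ofSuppBddBelow]
  map_smul' c f := by ext; simp [HahnSeries.ofSuppBddBelow]

lemma coeff_dec (i : ℕ) (f : LaurentSeries k) (j : ℤ) :
    (dec k m i f).coeff j = f.coeff (m * j + i) := rfl

lemma coeff_tpow_mul_ramify (i : ℕ) (hi : i < m) (g : LaurentSeries k) (j : ℤ) (l : ℕ)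
    (hl : l < m) : (tpow k i * ramify k m g).coeff (m * j + l) = if i = l then g.coeff j else 0 := by
  rw [coeff_tpow_mul]
  split_ifs with h
  · subst h; rw [add_sub_cancel_right, coeff_ramify_mul]
  · refine coeff_ramify_of_not_dvd m _ fun hd => h ?_
    have h2 : (m : ℤ) ∣ (l : ℤ) - i := by
      obtain ⟨r, hr⟩ := hd
      exact ⟨r - j, by linear_combination hr⟩
    have := Int.eq_zero_of_abs_lt_dvd h2 (by rw [abs_lt]; omega)
    omega

lemma sum_dec (f : LaurentSeries k) :
    ∑ i ∈ Finset.range m, tpow k i * ramify k m (dec k m i f) = f := by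
  ext a
  have hm : 0 < (m : ℤ) := by have := NeZero.pos m; exact_mod_cast this
  obtain ⟨l, hl⟩ := Int.eq_ofNat_of_zero_le (Int.emod_nonneg a hm.ne')
  have hlm : l < m := by have := Int.emod_lt_of_pos a hm; omega
  have ha : a = m * (a / m) + l := by rw [← hl]; exact (Int.mul_ediv_add_emod a m).symm
  rw [HahnSeries.coeff_sum, ha]
  rw [Finset.sum_congr rfl fun i hi =>
    coeff_tpow_mul_ramify m i (Finset.mem_range.1 hi) _ (a / m) l hlm]
  rw [Finset.sum_ite_eq', if_pos (Finset.mem_range.2 hlm), coeff_dec]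

lemma dec_tpow_mul_ramify {i l : ℕ} (hi : i < m) (hl : l < m) (g : LaurentSeries k) :
    dec k m l (tpow k i * ramify k m g) = if i = l then g else 0 := by
  ext j
  rw [coeff_dec, coeff_tpow_mul_ramify m i hi g j l hl]
  split_ifs <;> simp

lemma dec_ramify_mul (i : ℕ) (hi : i < m) (f g : LaurentSeries k) :
    dec k m i (ramify k m f * g) = f * dec k m i g := by
  conv_lhs => rw [← sum_dec m g, Finset.mul_sum, map_sum]
  rw [Finset.sum_congr rfl fun l hl => by
    rw [mul_left_comm, ← map_mul, dec_tpow_mul_ramify m (Finset.mem_range.1 hl) hi]]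
  rw [Finset.sum_ite_eq', if_pos (Finset.mem_range.2 hi)]

lemma mem_of_dec_mem {N : ℤ} {f : LaurentSeries k}
    (h : ∀ i < m, dec k m i f ∈ ordGE k N) : f ∈ ordGE k (m * N) := by
  rw [← sum_dec m f]
  refine Submodule.sum_mem _ fun i hi => ?_
  exact mul_mem_of_le (tpow_mem i) (ramify_mem m (h i (Finset.mem_range.1 hi))) (by omega)

lemma ramify_ramify (m' : ℕ) [NeZero m'] [NeZero (m * m')] (f : LaurentSeries k) :
    ramify k m' (ramify k m f) = ramify k (m * m') f := by
  have hm : 1 ≤ (m : ℤ) := by have := NeZero.pos m; exact_mod_cast this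
  have hm' : 1 ≤ (m' : ℤ) := by have := NeZero.pos m'; exact_mod_cast this
  have := eq_zero_of_tpow (Module.Basis.singleton Unit (LaurentSeries k))
    ((ramifyLin k m').comp (ramifyLin k m) - ramifyLin k (m * m')) ?_ ?_ f
  · exact sub_eq_zero.1 this
  · intro j
    change ramify k m' (ramify k m _) - ramify k (m * m') _ = 0
    rw [ramify_tpow, ramify_tpow, ramify_tpow, sub_eq_zero]
    congr 1; push_cast; ring
  · refine fun N => ⟨N, fun f hf _ => ?_⟩
    simp only [Module.Basis.singleton_repr]
    refine sub_mem (ordGE_anti ?_ (ramify_mem m' (ramify_mem m hf)))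
      (ordGE_anti ?_ (ramify_mem _ hf))
    · nlinarith [mul_le_mul hm' hm (by omega) (by omega)]
    · push_cast; nlinarith [mul_le_mul hm' hm (by omega) (by omega)]

lemma ramify_one (f : LaurentSeries k) : ramify k 1 f = f := by
  ext i
  simpa using coeff_ramify_mul 1 f i

end Ramify

section Shift

variable {k : Type u} [Field k] [CharZero k] (q : ℕ) [NeZero q]

/-- The series `(1 + t ^ q) ^ y`. -/
def onePow (k : Type u) [Field k] [CharZero k] (q : ℕ) [NeZero q] (y : ℚ) : LaurentSeries k :=
  HahnSeries.ofPowerSeries ℤ k (PowerSeries.expand q (NeZero.ne q) (binomialSeries k y))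

lemma onePow_add (y y' : ℚ) : onePow k q (y + y') = onePow k q y * onePow k q y' := by
  simp [onePow, binomialSeries_add]

lemma onePow_zero : onePow k q 0 = 1 := by
  simp [onePow]

lemma onePow_ne_zero (y : ℚ) : onePow k q y ≠ 0 := by
  refine left_ne_zero_of_mul_eq_one (b := onePow k q (-y)) ?_
  rw [← onePow_add, add_neg_cancel, onePow_zero]

lemma onePow_neg (y : ℚ) : onePow k q (-y) = (onePow k q y)⁻¹ := by
  rw [eq_comm, inv_eq_iff_eq_inv, eq_comm]
  refine inv_eq_of_mul_eq_one_right ?_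
  rw [← onePow_add, neg_add_cancel, onePow_zero]

lemma onePow_zpow (y : ℚ) (j : ℤ) : onePow k q y ^ j = onePow k q (j * y) := by
  have hn : ∀ n : ℕ, onePow k q y ^ n = onePow k q (n * y) := fun n => by
    induction n with
    | zero => simp [onePow_zero]
    | succ n ih => rw [pow_succ, ih, ← onePow_add]; congr 1; push_cast; ring
  obtain ⟨n, rfl | rfl⟩ := j.eq_nat_or_neg
  · rw [zpow_natCast, hn]; simp
  · rw [zpow_neg, zpow_natCast, hn, ← onePow_neg]; simp

lemma onePow_mem (y : ℚ) : onePow k q y ∈ ordGE k 0 := ofPowerSeries_mem _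

lemma coeff_onePow_zero (y : ℚ) : (onePow k q y).coeff 0 = 1 := by
  rw [onePow, coeff_zero_ofPowerSeries, constantCoeff_expand]; simp

lemma onePow_sub_one_mem (y : ℚ) : onePow k q y - 1 ∈ ordGE k q := by
  intro i hi
  obtain hneg | hpos := lt_or_ge i 0
  · exact sub_mem (onePow_mem q y) one_mem_ordGE i hneg
  obtain ⟨n, rfl⟩ := Int.eq_ofNat_of_zero_le hpos
  rcases Nat.eq_zero_or_pos n with rfl | hn
  · simpa [sub_eq_zero] using coeff_onePow_zero (k := k) q y
  · rw [HahnSeries.coeff_sub, onePow, HahnSeries.ofPowerSeries_apply_coeff,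
      coeff_expand_of_not_dvd]
    · simp [HahnSeries.coeff_one, hn.ne']
    · exact fun h => absurd (Nat.le_of_dvd hn h) (by omega)

lemma coeff_onePow_self (y : ℚ) : (onePow k q y).coeff q = (y : k) := by
  rw [onePow, HahnSeries.ofPowerSeries_apply_coeff]
  have := coeff_expand_mul q (NeZero.ne q) (binomialSeries k y) 1
  rw [mul_one] at this
  rw [this]
  simp [binomialSeries_coeff, Algebra.smul_def]

lemma onePow_one : onePow k q 1 = 1 + tpow k q := by
  have h := binomialSeries_nat (R := ℚ) (A := k) 1
  rw [Nat.cast_one, pow_one] at h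
  rw [onePow, h, map_add, map_one, expand_X, map_add, map_one, HahnSeries.ofPowerSeries_X_pow]
  rfl

lemma ramify_onePow (m : ℕ) [NeZero m] [NeZero (q * m)] (y : ℚ) :
    ramify k m (onePow k q y) = onePow k (q * m) y := by
  rw [onePow, ramify, laurentSubst_coe, onePow]
  have hc := expand_mul (R := k) m (NeZero.ne m) q (NeZero.ne q) (binomialSeries k y)
  rw [← expand_apply m (NeZero.ne m), ← hc]
  congr 2
  simp only [mul_comm]

/-- All estimates on `φ` come from this formula: since `φ(t) = t (1 + t ^ q) ^ (-1/q)`, powers of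
`t` only change the exponent of the binomial series. -/
lemma shift_tpow (j : ℤ) :
    shift k q (tpow k j) = tpow k j * onePow k q (-j / q) := by
  have h1 : HahnSeries.ofPowerSeries ℤ k (shiftSeries k q) = tpow k 1 * onePow k q (-1 / q) := by
    rw [shiftSeries, map_mul, HahnSeries.ofPowerSeries_X]
    rfl
  rw [shift, laurentSubst_tpow, h1, mul_zpow, ← tpow_eq_zpow, onePow_zpow]
  congr 2
  ring

lemma shift_smul (c : k) (f : LaurentSeries k) : shift k q (c • f) = c • shift k q f :=
  laurentSubst_smul _ _ c f

lemma shift_C (c : k) : shift k q (HahnSeries.C c) = HahnSeries.C c := laurentSubst_C _ _ c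

/-- The shift as a `k`-linear map. -/
def shiftLin (k : Type u) [Field k] [CharZero k] (q : ℕ) [NeZero q] :
    LaurentSeries k →ₗ[k] LaurentSeries k where
  toFun := shift k q
  map_add' := map_add _
  map_smul' := shift_smul q

lemma shift_mem {j : ℤ} {f : LaurentSeries k} (hf : f ∈ ordGE k j) :
    shift k q f ∈ ordGE k j := by
  obtain ⟨p, rfl⟩ := exists_eq_tpow_mul hf
  rw [map_mul, shift_tpow, mul_assoc, tpow_mul_mem, sub_self, shift, laurentSubst_coe]
  simpa using mul_mem_ordGE (onePow_mem (k := k) q (-j / q)) (ofPowerSeries_mem _)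

/-- On a monomial, `(1 + t ^ q) ^ (-i/q) - 1 = -(i/q) t ^ q + …`. To leading order `φ - 1` is
therefore the derivation `-(1/q) t ^ q · t d/dt`, which is what allows difference operators and
connections to be treated alike. -/
lemma shift_sub_spec {j : ℤ} {f : LaurentSeries k} (hf : f ∈ ordGE k j) :
    shift k q f - f ∈ ordGE k (j + q) ∧
      (shift k q f - f).coeff (j + q) = -(j / q) * f.coeff j := by
  have hq : 0 < (q : ℤ) := by have := NeZero.pos q; exact_mod_cast this
  refine ordGE_induction (p := fun f => shift k q f - f ∈ ordGE k (j + q) ∧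
      (shift k q f - f).coeff (j + q) = -(j / q) * f.coeff j) (N := j + q + 1) ?_ ?_ ?_ hf
  · rintro f g ⟨hf, hf'⟩ ⟨hg, hg'⟩
    have e : shift k q (f + g) - (f + g) = (shift k q f - f) + (shift k q g - g) := by
      rw [map_add]; ring
    rw [e]
    exact ⟨add_mem hf hg, by rw [HahnSeries.coeff_add, hf', hg', HahnSeries.coeff_add, mul_add]⟩
  · intro i hi c
    have e : shift k q (c • tpow k i) - c • tpow k i =
        c • (tpow k i * (onePow k q (-i / q) - 1)) := by
      rw [shift_smul, shift_tpow, mul_sub, mul_one, smul_sub]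
    have hmem := onePow_sub_one_mem (k := k) q (-i / q)
    rw [e]
    refine ⟨Submodule.smul_mem _ _ (tpow_mul_mem.2 (ordGE_anti (by omega) hmem)), ?_⟩
    rw [HahnSeries.coeff_smul, coeff_tpow_mul, HahnSeries.coeff_smul, coeff_tpow]
    rcases hi.lt_or_eq with h | rfl
    · rw [hmem _ (by omega), if_neg (by omega)]; simp
    · rw [if_pos rfl, add_sub_cancel_left, HahnSeries.coeff_sub, coeff_onePow_self]
      simp [HahnSeries.coeff_one, NeZero.ne q, neg_div]
      ring
  · intro f hf
    have : shift k q f - f ∈ ordGE k (j + q + 1) := sub_mem (shift_mem q hf) hf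
    refine ⟨ordGE_anti (by omega) this, ?_⟩
    rw [this _ (by omega), hf _ (by omega), mul_zero]

lemma shift_sub_mem {j : ℤ} {f : LaurentSeries k} (hf : f ∈ ordGE k j) :
    shift k q f - f ∈ ordGE k (j + q) := (shift_sub_spec q hf).1

/-- The field of constants of the shift is `k`. -/
lemma eq_C_of_shift_eq {f : LaurentSeries k} (hf : shift k q f = f) :
    f = HahnSeries.C (f.coeff 0) := by
  have hq : (q : k) ≠ 0 := by exact_mod_cast NeZero.ne q
  have key : ∀ g : LaurentSeries k, shift k q g = g → g.coeff 0 = 0 → g = 0 := by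
    intro g hg h0
    -- A nonzero fixed series of order `i` satisfies `i/q = 0` by the leading coefficient of `φ -
    -- 1`; hence `i = 0`, against the vanishing of its constant term.
    by_contra hne
    have h1 := (shift_sub_spec q (mem_ordGE_order g)).2
    rw [hg, sub_self, HahnSeries.coeff_zero, eq_comm, mul_eq_zero, neg_eq_zero, div_eq_zero_iff]
      at h1
    have h2 := coeff_order_ne hne
    rcases h1 with (h1 | h1) | h1
    · rw [Int.cast_eq_zero.1 h1] at h2
      exact h2 h0
    · exact hq h1
    · exact h2 h1
  rw [← sub_eq_zero]
  refine key _ ?_ ?_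
  · rw [map_sub, hf, shift_C]
  · simp [HahnSeries.C_apply]

lemma shift_ramify (m : ℕ) [NeZero m] [NeZero (q * m)] (f : LaurentSeries k) :
    shift k (q * m) (ramify k m f) = ramify k m (shift k q f) := by
  have hm : 1 ≤ (m : ℤ) := by have := NeZero.pos m; exact_mod_cast this
  have := eq_zero_of_tpow (Module.Basis.singleton Unit (LaurentSeries k))
    ((shiftLin k (q * m)).comp (ramifyLin k m) - (ramifyLin k m).comp (shiftLin k q)) ?_ ?_ f
  · exact sub_eq_zero.1 this
  · intro j
    change shift k (q * m) (ramify k m _) - ramify k m (shift k q _) = 0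
    rw [ramify_tpow, shift_tpow, shift_tpow, map_mul, ramify_tpow, ramify_onePow, sub_eq_zero]
    congr 2
    have : (m : ℚ) ≠ 0 := by exact_mod_cast NeZero.ne m
    push_cast
    field_simp
  · refine fun N => ⟨N, fun f hf _ => ?_⟩
    simp only [Module.Basis.singleton_repr]
    refine sub_mem (ordGE_anti ?_ (shift_mem _ (ramify_mem m hf)))
      (ordGE_anti ?_ (ramify_mem _ (shift_mem q hf))) <;> nlinarith

end Shift

/-! ### Operators on `k((t))` with a polynomial symbol -/

section Symbol

variable {k : Type u} [Field k]

/-- `G (t ^ j) = p(j) t ^ (j + d) + …` for all `j`, in a way compatible with infinite sums. -/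
def HasSymbol (G : LaurentSeries k →ₗ[k] LaurentSeries k) (d : ℤ) (p : Polynomial k) : Prop :=
  ∀ (j : ℤ), ∀ f ∈ ordGE k j,
    G f ∈ ordGE k (j + d) ∧ (G f).coeff (j + d) = p.eval (j : k) * f.coeff j

lemma HasSymbol.comp {G₁ G₂ : LaurentSeries k →ₗ[k] LaurentSeries k} {d₁ d₂ : ℤ}
    {p₁ p₂ : Polynomial k} (h₁ : HasSymbol G₁ d₁ p₁) (h₂ : HasSymbol G₂ d₂ p₂) :
    HasSymbol (G₁ ∘ₗ G₂) (d₁ + d₂)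
      (p₁.comp (Polynomial.X + Polynomial.C (d₂ : k)) * p₂) := by
  intro j f hf
  obtain ⟨h, h'⟩ := h₂ j f hf
  obtain ⟨h3, h4⟩ := h₁ _ _ h
  rw [show j + (d₁ + d₂) = j + d₂ + d₁ by ring]
  refine ⟨h3, ?_⟩
  rw [LinearMap.comp_apply, h4, h']
  simp [mul_assoc]

lemma HasSymbol.sum {α : Type*} (s : Finset α) {G : α → LaurentSeries k →ₗ[k] LaurentSeries k}
    {d : ℤ} {p : α → Polynomial k} (h : ∀ i ∈ s, HasSymbol (G i) d (p i)) :
    HasSymbol (∑ i ∈ s, G i) d (∑ i ∈ s, p i) := by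
  intro j f hf
  rw [LinearMap.sum_apply]
  refine ⟨Submodule.sum_mem _ fun i hi => (h i hi j f hf).1, ?_⟩
  rw [HahnSeries.coeff_sum, Polynomial.eval_finsetSum, Finset.sum_mul]
  exact Finset.sum_congr rfl fun i hi => (h i hi j f hf).2

lemma HasSymbol.neg {G : LaurentSeries k →ₗ[k] LaurentSeries k} {d : ℤ} {p : Polynomial k}
    (h : HasSymbol G d p) : HasSymbol (-G) d (-p) := by
  intro j f hf
  obtain ⟨h, h'⟩ := h j f hf
  exact ⟨neg_mem h, by simp [h']⟩

/-- Multiplication by a Laurent series as a `k`-linear map. -/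
def mulLin (a : LaurentSeries k) : LaurentSeries k →ₗ[k] LaurentSeries k where
  toFun f := a * f
  map_add' := mul_add a
  map_smul' c f := by
    rw [smul_eq_C_mul, mul_left_comm, RingHom.id_apply, smul_eq_C_mul]

lemma hasSymbol_mulLin {a : LaurentSeries k} {d : ℤ} (ha : a ∈ ordGE k d) :
    HasSymbol (mulLin a) d (Polynomial.C (a.coeff d)) := by
  intro j f hf
  rw [add_comm j d]
  exact ⟨mul_mem_ordGE ha hf, by rw [Polynomial.eval_C]; exact coeff_mul_ordGE ha hf⟩

/-- The equation is solved degree by degree: in degree `j + i` the error is removed by dividing its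
leading coefficient by `p(j + i)`, and completeness gives the limit. -/
lemma HasSymbol.exists_preimage {G : LaurentSeries k →ₗ[k] LaurentSeries k} {d : ℤ}
    {p : Polynomial k} (h : HasSymbol G d p) {j₀ : ℤ} (hp : ∀ j ≥ j₀, p.eval (j : k) ≠ 0)
    {j : ℤ} (hj : j₀ ≤ j) {g : LaurentSeries k} (hg : g ∈ ordGE k (j + d)) :
    ∃ f ∈ ordGE k j, G f = g := by
  let b := Module.Basis.singleton Unit (LaurentSeries k)
  have hLat : ∀ {i : ℤ} {f : LaurentSeries k}, f ∈ Lat b i ↔ f ∈ ordGE k i := by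
    intro i f
    simp [mem_Lat, b]
  obtain ⟨f, hf0, hf⟩ := exists_limit b
    (fun i f => f ∈ ordGE k j ∧ g - G f ∈ ordGE k (j + d + i)) j
    (v₀ := 0) (by simpa using hg) (by
      rintro i f ⟨hf, hf'⟩
      set c := (g - G f).coeff (j + d + i) with hc
      have hne := hp (j + i) (by omega)
      have hmem : (c / p.eval ((j + i : ℤ) : k)) • tpow k (j + i) ∈ ordGE k (j + i) :=
        Submodule.smul_mem _ _ (tpow_mem _)
      refine ⟨_, hLat.2 hmem, add_mem hf (ordGE_anti (by omega) hmem), ?_⟩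
      obtain ⟨h1, h2⟩ := h _ _ hmem
      have e : j + i + d = j + d + i := by ring
      rw [e] at h1 h2
      rw [Nat.cast_succ, ← add_assoc, mem_ordGE_succ, map_add, ← sub_sub]
      refine ⟨sub_mem hf' h1, ?_⟩
      rw [HahnSeries.coeff_sub, h2, ← hc, HahnSeries.coeff_smul, coeff_tpow, if_pos rfl,
        smul_eq_mul, mul_one, mul_div_cancel₀ _ hne, sub_self])
  refine ⟨f, by simpa [hLat] using hf0, (sub_eq_zero.1 (eq_zero_of_forall_mem fun N => ?_)).symm⟩
  obtain ⟨n, hn⟩ : ∃ n : ℕ, (N : ℤ) ≤ j + d + n := ⟨(N - j - d).toNat, by omega⟩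
  obtain ⟨f', ⟨_, h1⟩, h2⟩ := hf n
  have h3 := (h _ _ (hLat.1 h2)).1
  have e : g - G f = (g - G f') - G (f - f') := by rw [map_sub]; ring
  rw [e]
  exact ordGE_anti hn (sub_mem h1 (ordGE_anti (by omega) h3))

/-- An injective operator with nonzero symbol is bijective, and shifts the order filtration
exactly. -/
lemma HasSymbol.exists_preimage_of_injective [CharZero k]
    {G : LaurentSeries k →ₗ[k] LaurentSeries k} {d : ℤ} {p : Polynomial k} (h : HasSymbol G d p)
    (hp : p ≠ 0) (hG : ∀ f, G f = 0 → f = 0) (j : ℤ) {g : LaurentSeries k}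
    (hg : g ∈ ordGE k (j + d)) : ∃ f ∈ ordGE k j, G f = g := by
  classical
  obtain ⟨j₀, hj₀⟩ : ∃ j₀ : ℤ, ∀ j ≥ j₀, p.eval (j : k) ≠ 0 := by
    have hfin : {j : ℤ | p.eval (j : k) = 0}.Finite := by
      have := (p.roots.toFinset.finite_toSet).preimage (f := fun j : ℤ => (j : k))
        Int.cast_injective.injOn
      refine this.subset fun j hj => ?_
      simpa [hp] using hj
    obtain ⟨m, hm⟩ := hfin.bddAbove
    exact ⟨m + 1, fun j hj h0 => by have := hm h0; omega⟩
  -- Downward induction from a range free of roots. If `p(j) = 0` while all larger integers are not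
  -- roots, then `G (t ^ j)` has excess order and equals `G f` with `f` of order at least `j + 1`,
  -- so that `t ^ j - f` is a nonzero element of the kernel.
  have key : ∀ n : ℕ, ∀ j ≥ j₀ - n, p.eval (j : k) ≠ 0 := by
    intro n
    induction n with
    | zero => simpa using hj₀
    | succ n ih =>
      intro j hj hj0
      rcases (show j ≥ j₀ - n ∨ j = j₀ - n - 1 by push_cast at hj; omega) with h1 | h1
      · exact ih j h1 hj0
      obtain ⟨h2, h3⟩ := h j _ (tpow_mem j)
      rw [hj0, zero_mul] at h3
      have h4 : G (tpow k j) ∈ ordGE k ((j + 1) + d) := by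
        rw [add_right_comm]; exact mem_ordGE_succ.2 ⟨h2, h3⟩
      obtain ⟨f, hf, hf'⟩ := h.exists_preimage ih (j := j + 1) (by omega) h4
      have h5 := hG (tpow k j - f) (by rw [map_sub, hf', sub_self])
      have h6 := congrArg (fun y => HahnSeries.coeff y j) h5
      simp [coeff_tpow, hf j (by omega)] at h6
  exact h.exists_preimage (key (j₀ - j).toNat) (by omega) hg

end Symbol

/-! ### Twisted operators -/

/-- The data of a ring endomorphism `σ` of `k((t))`, close to the identity, and of a `k`-linear
map `ν` of degree `e`. -/
structure Twist (k : Type u) [Field k] where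
  /-- The endomorphism. -/
  sigma : LaurentSeries k →+* LaurentSeries k
  sigma_smul : ∀ (c : k) (f : LaurentSeries k), sigma (c • f) = c • sigma f
  sigma_sub_mem : ∀ {j : ℤ} {f : LaurentSeries k}, f ∈ ordGE k j → sigma f - f ∈ ordGE k (j + 1)
  /-- The twisted derivation. -/
  nu : LaurentSeries k →ₗ[k] LaurentSeries k
  /-- The degree of `ν`. -/
  e : ℤ
  nu_mem : ∀ {j : ℤ} {f : LaurentSeries k}, f ∈ ordGE k j → nu f ∈ ordGE k (j + e)

namespace Twist

variable {k : Type u} [Field k] (τ : Twist k)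

/-- The endomorphism `σ` as a `k`-linear map. -/
def sigmaLin : LaurentSeries k →ₗ[k] LaurentSeries k where
  toFun := τ.sigma
  map_add' := map_add _
  map_smul' := τ.sigma_smul

lemma hasSymbol_sigma : HasSymbol τ.sigmaLin 0 1 := by
  intro j f hf
  have h1 := τ.sigma_sub_mem hf
  have h2 : τ.sigma f = f + (τ.sigma f - f) := by ring
  change τ.sigma f ∈ _ ∧ (τ.sigma f).coeff _ = _
  rw [h2, add_zero]
  refine ⟨add_mem hf (ordGE_anti (by omega) h1), ?_⟩
  rw [HahnSeries.coeff_add, h1 j (by omega)]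
  simp

lemma sigma_mem {j : ℤ} {f : LaurentSeries k} (hf : f ∈ ordGE k j) : τ.sigma f ∈ ordGE k j := by
  have := (τ.hasSymbol_sigma j f hf).1
  rwa [add_zero] at this

lemma exists_sigma_eq {j : ℤ} {g : LaurentSeries k} (hg : g ∈ ordGE k j) :
    ∃ f ∈ ordGE k j, τ.sigma f = g :=
  τ.hasSymbol_sigma.exists_preimage (j₀ := j) (by simp) le_rfl (by simpa using hg)

/-- The automorphism `σ`. -/
def sigmaEquiv : LaurentSeries k ≃ₗ[k] LaurentSeries k :=
  LinearEquiv.ofBijective τ.sigmaLin ⟨τ.sigma.injective, fun g => by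
    obtain ⟨j, hj⟩ := exists_mem_ordGE g
    obtain ⟨f, _, hf⟩ := τ.exists_sigma_eq hj
    exact ⟨f, hf⟩⟩

lemma sigma_symm (f : LaurentSeries k) : τ.sigma (τ.sigmaEquiv.symm f) = f :=
  τ.sigmaEquiv.apply_symm_apply f

lemma hasSymbol_sigma_symm : HasSymbol τ.sigmaEquiv.symm.toLinearMap 0 1 := by
  intro j g hg
  obtain ⟨f, hf, rfl⟩ := τ.exists_sigma_eq hg
  have h1 : τ.sigmaEquiv.symm (τ.sigma f) = f := τ.sigmaEquiv.symm_apply_apply f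
  have h2 := (τ.hasSymbol_sigma j f hf).2
  simp only [add_zero, Polynomial.eval_one, one_mul, LinearEquiv.coe_coe, h1] at h2 ⊢
  exact ⟨hf, h2.symm⟩

lemma sigma_symm_mem {j : ℤ} {f : LaurentSeries k} (hf : f ∈ ordGE k j) :
    τ.sigmaEquiv.symm f ∈ ordGE k j := by
  simpa using (τ.hasSymbol_sigma_symm j f hf).1

/-- The operator `-ν σ⁻¹`. -/
def adj : LaurentSeries k →ₗ[k] LaurentSeries k := -(τ.nu ∘ₗ τ.sigmaEquiv.symm.toLinearMap)

lemma adj_pow_mem (i : ℕ) {j : ℤ} {f : LaurentSeries k} (hf : f ∈ ordGE k j) :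
    (τ.adj ^ i) f ∈ ordGE k (j + i * τ.e) := by
  induction i with
  | zero => simpa using hf
  | succ i ih =>
    rw [pow_succ', Module.End.mul_apply]
    have := neg_mem (τ.nu_mem (τ.sigma_symm_mem ih))
    rwa [add_assoc, ← add_one_mul, ← Nat.cast_succ] at this

/-- The operator `B` satisfies `B (f w) = σ(f) B w + ν(f) w`. -/
def IsTwisted {V : Type v} [AddCommGroup V] [Module k V] [Module (LaurentSeries k) V]
    (B : V →ₗ[k] V) : Prop :=
  ∀ (f : LaurentSeries k) (w : V), B (f • w) = τ.sigma f • B w + τ.nu f • w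

/-- The twisted derivation `ν` is a multiple of the Euler derivation to leading order. -/
def HasEuler (γ : k) : Prop := HasSymbol τ.nu τ.e (Polynomial.C γ * Polynomial.X)

/-- Each factor `D = -νσ⁻¹` contributes a symbol of degree exactly one because `γ ≠ 0`. The exact
degree `i` is what prevents cancellation between different powers of `D` in `cyclicOp`. -/
lemma hasSymbol_adj_pow {γ : k} (hγ : γ ≠ 0) (hν : τ.HasEuler γ) (i : ℕ) :
    ∃ r : Polynomial k, r ≠ 0 ∧ r.natDegree = i ∧ HasSymbol (τ.adj ^ i) (i * τ.e) r := by
  have hadj : HasSymbol τ.adj τ.e (Polynomial.C (-γ) * Polynomial.X) := by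
    have := (HasSymbol.comp hν τ.hasSymbol_sigma_symm).neg
    simpa [adj] using this
  induction i with
  | zero => exact ⟨1, one_ne_zero, by simp, fun j f hf => by simpa using hf⟩
  | succ i ih =>
    obtain ⟨r, hr0, hr, hs⟩ := ih
    have := hadj.comp hs
    have hX : ((Polynomial.C (-γ) * Polynomial.X).comp (Polynomial.X +
        Polynomial.C ((i * τ.e : ℤ) : k))).natDegree = 1 := by
      rw [Polynomial.natDegree_comp, Polynomial.natDegree_X_add_C, mul_one,
        Polynomial.natDegree_C_mul_X _ (neg_ne_zero.2 hγ)]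
    have hX0 := Polynomial.ne_zero_of_natDegree_gt (n := 0) (by rw [hX]; exact one_pos)
    refine ⟨_, mul_ne_zero hX0 hr0, ?_, ?_⟩
    · rw [Polynomial.natDegree_mul hX0 hr0, hX, hr, add_comm]
    · rw [pow_succ', show ((i + 1 : ℕ) : ℤ) * τ.e = τ.e + i * τ.e by push_cast; ring]
      exact this

/-- The operator `f ↦ ∑ᵢ Dⁱ (aᵢ σ(f))` with `D = -ν σ⁻¹`. -/
def cyclicOp (a : ℕ → LaurentSeries k) (n : ℕ) : LaurentSeries k →ₗ[k] LaurentSeries k :=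
  ∑ i ∈ Finset.range (n + 1), (τ.adj ^ i) ∘ₗ (mulLin (a i) ∘ₗ τ.sigmaLin)

/-- The integer `μ` is the minimum of `ord(aᵢ) + i e`. The terms attaining it have symbols of
pairwise distinct degrees, so their sum is nonzero. The term `a n = -1` gives the bound `μ ≤ n e`.
-/
lemma hasSymbol_cyclicOp {γ : k} (hγ : γ ≠ 0) (hν : τ.HasEuler γ)
    (a : ℕ → LaurentSeries k) (n : ℕ) (hn : a n = -1) :
    ∃ (μ : ℤ) (p : Polynomial k), p ≠ 0 ∧ HasSymbol (τ.cyclicOp a n) μ p ∧ μ ≤ n * τ.e ∧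
      ∀ i ≤ n, a i ∈ ordGE k (μ - i * τ.e) := by
  classical
  let s := (Finset.range (n + 1)).filter fun i => a i ≠ 0
  have hns : n ∈ s := by simp [s, hn]
  obtain ⟨i₀, hi₀, hmin⟩ := s.exists_min_image (fun i => (a i).order + i * τ.e) ⟨n, hns⟩
  set μ := (a i₀).order + i₀ * τ.e with hμ
  have hmem : ∀ i ≤ n, a i ∈ ordGE k (μ - i * τ.e) := by
    intro i hi
    by_cases h0 : a i = 0
    · rw [h0]; exact zero_mem _
    · have := hmin i (by simp [s, h0]; omega)
      exact ordGE_anti (by omega) (mem_ordGE_order (a i))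
  choose r hr0 hrd hrs using τ.hasSymbol_adj_pow hγ hν
  let c : ℕ → k := fun i => (a i).coeff (μ - i * τ.e)
  let p : ℕ → Polynomial k := fun i =>
    (r i).comp (Polynomial.X + Polynomial.C ((μ - i * τ.e : ℤ) : k)) * Polynomial.C (c i)
  have hps : ∀ i ∈ Finset.range (n + 1),
      HasSymbol ((τ.adj ^ i) ∘ₗ (mulLin (a i) ∘ₗ τ.sigmaLin)) μ (p i) := by
    intro i hi
    have h1 := (hrs i).comp ((hasSymbol_mulLin (hmem i (by simp at hi; omega))).comp
      τ.hasSymbol_sigma)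
    simpa [p, c] using h1
  have hpd : ∀ i, c i ≠ 0 → p i ≠ 0 ∧ (p i).natDegree = i := by
    intro i hi
    have h1 : ((r i).comp (Polynomial.X + Polynomial.C ((μ - i * τ.e : ℤ) : k))) ≠ 0 := by
      intro h0
      rw [Polynomial.comp_eq_zero_iff] at h0
      rcases h0 with h0 | ⟨_, h0⟩
      · exact hr0 i h0
      · have := congrArg Polynomial.natDegree h0
        rw [Polynomial.natDegree_X_add_C, Polynomial.natDegree_C] at this
        exact one_ne_zero this
    refine ⟨mul_ne_zero h1 (by simpa using hi), ?_⟩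
    rw [Polynomial.natDegree_mul_C hi, Polynomial.natDegree_comp, Polynomial.natDegree_X_add_C,
      mul_one, hrd]
  refine ⟨μ, ∑ i ∈ Finset.range (n + 1), p i, ?_, HasSymbol.sum _ hps, ?_, hmem⟩
  · let s' := (Finset.range (n + 1)).filter fun i => c i ≠ 0
    have hi₀' : i₀ ∈ s' := by
      simp only [s', Finset.mem_filter, c]
      simp only [s, Finset.mem_filter] at hi₀
      refine ⟨hi₀.1, ?_⟩
      rw [hμ, add_sub_cancel_right]
      exact coeff_order_ne hi₀.2
    obtain ⟨m, hm, hmax⟩ := s'.exists_max_image id ⟨i₀, hi₀'⟩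
    simp only [s', Finset.mem_filter] at hm
    intro h0
    have h1 := congrArg (fun y => Polynomial.coeff y m) h0
    simp only [Polynomial.finsetSum_coeff, Polynomial.coeff_zero] at h1
    rw [Finset.sum_eq_single m] at h1
    · obtain ⟨h2, h3⟩ := hpd m hm.2
      refine h2 (Polynomial.leadingCoeff_eq_zero.1 ?_)
      rw [Polynomial.leadingCoeff, h3, h1]
    · intro i hi him
      by_cases hc : c i = 0
      · simp [p, hc]
      · have h4 : i ≤ m := hmax i (by simp [s', hc]; simpa using hi)
        exact Polynomial.coeff_eq_zero_of_natDegree_lt (by rw [(hpd i hc).2]; omega)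
    · exact fun h => absurd hm.1 h
  · have := hmin n hns
    have h1 : (a n).order = 0 := by rw [hn, HahnSeries.order_neg, HahnSeries.order_one]
    omega

variable {V : Type v} [AddCommGroup V] [Module k V] [Module (LaurentSeries k) V]

/-- The formal solution of `B u = w` on a cyclic module. -/
lemma IsTwisted.solve {τ : Twist k} {B : V →ₗ[k] V} (hB : τ.IsTwisted B) {v : V} {n : ℕ}
    {a : ℕ → LaurentSeries k} (hn : a n = -1)
    (ha : (B ^ n) v = ∑ i ∈ Finset.range n, a i • (B ^ i) v) (w : ℕ → LaurentSeries k)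
    (hw : w n = 0) (f : LaurentSeries k)
    (hf : τ.cyclicOp a n f = ∑ i ∈ Finset.range (n + 1), (τ.adj ^ i) (w i)) :
    B (∑ l ∈ Finset.range n, (-τ.sigmaEquiv.symm (∑ i ∈ Finset.range (n - l),
      (τ.adj ^ i) (a (i + (l + 1)) * τ.sigma f - w (i + (l + 1))))) • (B ^ l) v) =
      ∑ i ∈ Finset.range n, w i • (B ^ i) v := by
  -- For `u = ∑ uₗ Bˡv`, put `σ(uₗ) = -Y (l + 1)`. Comparison of coefficients in `Bu = w` becomes
  -- the recursion `Y l = x l + D (Y (l + 1))` with `Y n = -σ(f)`, where `f` is the last coordinate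
  -- of `u`. The remaining condition `Y 0 = 0` is the scalar equation `hf`.
  set x : ℕ → LaurentSeries k := fun i => a i * τ.sigma f - w i with hx
  set Y : ℕ → LaurentSeries k := fun l =>
    ∑ i ∈ Finset.range (n + 1 - l), (τ.adj ^ i) (x (i + l)) with hY
  have hY0 : Y 0 = 0 := by
    simp only [hY, hx, Nat.sub_zero, add_zero, map_sub, Finset.sum_sub_distrib]
    rw [← hf, cyclicOp, LinearMap.sum_apply]
    simp [mulLin, sigmaLin]
  have hYn : Y n = -τ.sigma f := by
    simp [hY, hx, hn, hw]
  have hYs : ∀ l < n, Y l = x l + τ.adj (Y (l + 1)) := by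
    intro l hl
    simp only [hY]
    rw [show n + 1 - l = (n + 1 - (l + 1)) + 1 by omega, Finset.sum_range_succ', map_sum, add_comm]
    congr 1
    · simp
    · refine Finset.sum_congr rfl fun i _ => ?_
      rw [pow_succ', Module.End.mul_apply, show i + 1 + l = i + (l + 1) by ring]
  have hterm : ∀ l < n, B ((-τ.sigmaEquiv.symm (Y (l + 1))) • (B ^ l) v) =
      (Y l • (B ^ l) v - Y (l + 1) • (B ^ (l + 1)) v) - x l • (B ^ l) v := by
    intro l hl
    rw [hB, map_neg, τ.sigma_symm, map_neg]
    have h1 : -τ.nu (τ.sigmaEquiv.symm (Y (l + 1))) = Y l - x l := by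
      rw [hYs l hl, add_sub_cancel_left]; rfl
    rw [h1, pow_succ', Module.End.mul_apply, sub_smul, neg_smul]
    abel
  have hu : (∑ l ∈ Finset.range n, (-τ.sigmaEquiv.symm (∑ i ∈ Finset.range (n - l),
      (τ.adj ^ i) (a (i + (l + 1)) * τ.sigma f - w (i + (l + 1))))) • (B ^ l) v) =
      ∑ l ∈ Finset.range n, (-τ.sigmaEquiv.symm (Y (l + 1))) • (B ^ l) v := by
    refine Finset.sum_congr rfl fun l _ => ?_
    simp only [hY, hx, Nat.add_sub_add_right]
  rw [hu, map_sum, Finset.sum_congr rfl fun l hl => hterm l (Finset.mem_range.1 hl),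
    Finset.sum_sub_distrib, Finset.sum_range_sub', hY0, hYn, ha]
  simp only [hx, sub_smul, Finset.sum_sub_distrib, mul_smul, zero_smul, neg_smul,
    Finset.smul_sum]
  simp only [smul_comm (τ.sigma f), Finset.sum_neg_distrib]
  abel

end Twist

/-! ### Inverses of twisted operators -/

/-- Applied to `x i = Bⁱv`, this yields the cyclic submodule generated by `v`, with its basis of
iterates. -/
lemma exists_linearIndependent_initial {K V : Type*} [Field K] [AddCommGroup V] [Module K V]
    [FiniteDimensional K V] (x : ℕ → V) :
    ∃ n : ℕ, LinearIndependent K (fun i : Fin n => x i) ∧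
      x n ∈ Submodule.span K (Set.range fun i : Fin n => x i) := by
  classical
  have hstep : ∀ n, (∀ m < n, x m ∉ Submodule.span K (Set.range fun i : Fin m => x i)) →
      LinearIndependent K (fun i : Fin n => x i) := by
    intro n
    induction n with
    | zero => intro _; exact linearIndependent_empty_type
    | succ n ih =>
      intro h
      rw [linearIndependent_finSucc']
      exact ⟨ih fun m hm => h m (by omega), h n (by omega)⟩
  have hex : ∃ n, x n ∈ Submodule.span K (Set.range fun i : Fin n => x i) := by
    by_contra! h
    have h1 := (hstep (Module.finrank K V + 1) fun m _ => h m).fintype_card_le_finrank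
    simp at h1
  exact ⟨Nat.find hex, hstep _ fun m hm => Nat.find_min hex hm, Nat.find_spec hex⟩

/-- A splitting of `W ⊆ V`, as a retraction and a section. -/
lemma exists_splitting {K V : Type*} [Field K] [AddCommGroup V] [Module K V]
    (W : Submodule K V) : ∃ (p : V →ₗ[K] W) (s : (V ⧸ W) →ₗ[K] V), (∀ w : W, p w = w) ∧
      (∀ y, p (s y) = 0) ∧ (∀ y, W.mkQ (s y) = y) ∧ ∀ v, (p v : V) + s (W.mkQ v) = v := by
  obtain ⟨p, hp⟩ := W.subtype.exists_leftInverse_of_injective W.ker_subtype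
  have hp' : ∀ w : W, p w = w := fun w => LinearMap.congr_fun hp w
  let s : (V ⧸ W) →ₗ[K] V := W.liftQ (LinearMap.id - W.subtype ∘ₗ p) (by
    intro w hw
    simp [hp' ⟨w, hw⟩])
  have hs : ∀ v, s (W.mkQ v) = v - p v := fun v => by simp [s]
  refine ⟨p, s, hp', fun y => ?_, fun y => ?_, fun v => by rw [hs, add_sub_cancel]⟩
  · obtain ⟨v, rfl⟩ := W.mkQ_surjective y
    rw [hs, map_sub, hp', sub_self]
  · obtain ⟨v, rfl⟩ := W.mkQ_surjective y
    rw [hs, map_sub, sub_eq_self]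
    simp

/-! ### Lattices in an extension -/

section Extension

variable {k : Type u} [Field k] {V : Type v} [AddCommGroup V] [Module k V]
  [Module (LaurentSeries k) V] [IsScalarTower k (LaurentSeries k) V]

lemma Lat_map_smul {ι : Type*} (b : Module.Basis ι (LaurentSeries k) V) (c : ℤ) :
    ∃ b' : Module.Basis ι (LaurentSeries k) V, ∀ j, Lat b' j = Lat b (j - c) := by
  refine ⟨b.map (LinearEquiv.smulOfNeZero _ _ (tpow k (-c)) (tpow_ne_zero _)), fun j => ?_⟩
  ext w
  have hw : (LinearEquiv.smulOfNeZero _ V (tpow k (-c)) (tpow_ne_zero _)).symm w =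
      tpow k c • w := by
    rw [LinearEquiv.symm_apply_eq]
    change w = tpow k (-c) • tpow k c • w
    rw [smul_smul, tpow_neg_mul, one_smul]
  rw [mem_Lat]
  simp only [Module.Basis.map_repr, LinearEquiv.trans_apply, hw]
  rw [← mem_Lat, tpow_smul_mem_Lat]

/-- The basis of an extension, with the lattice in the subspace enlarged by `t ^ (-c)`. -/
lemma exists_basis_extension {W : Submodule (LaurentSeries k) V} {ι κ : Type*}
    (p : V →ₗ[LaurentSeries k] W) (s : (V ⧸ W) →ₗ[LaurentSeries k] V) (hp : ∀ w : W, p w = w)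
    (hps : ∀ y, p (s y) = 0) (hs : ∀ y, W.mkQ (s y) = y)
    (hv : ∀ v, (p v : V) + s (W.mkQ v) = v)
    (bW : Module.Basis ι (LaurentSeries k) W) (bU : Module.Basis κ (LaurentSeries k) (V ⧸ W))
    (c : ℤ) : ∃ b : Module.Basis (ι ⊕ κ) (LaurentSeries k) V, ∀ j v,
      v ∈ Lat b j ↔ p v ∈ Lat bW (j - c) ∧ W.mkQ v ∈ Lat bU j := by
  obtain ⟨bW', hbW'⟩ := Lat_map_smul bW c
  let e : V ≃ₗ[LaurentSeries k] W × (V ⧸ W) := LinearEquiv.ofBijective (p.prod W.mkQ) (by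
    constructor
    · intro x y hxy
      have h1 : p x = p y := congrArg Prod.fst hxy
      have h2 : W.mkQ x = W.mkQ y := congrArg Prod.snd hxy
      rw [← hv x, ← hv y, h1, h2]
    · rintro ⟨w, y⟩
      refine ⟨w + s y, Prod.ext ?_ ?_⟩
      · change p (w + s y) = w
        rw [map_add, hp, hps, add_zero]
      · change W.mkQ (w + s y) = y
        rw [map_add, hs, add_eq_right]
        simp)
  refine ⟨(bW'.prod bU).map e.symm, fun j v => ?_⟩
  rw [← hbW', mem_Lat, mem_Lat, mem_Lat]
  have h1 : ∀ i, ((bW'.prod bU).map e.symm).repr v (Sum.inl i) = bW'.repr (p v) i := fun i =>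
    Module.Basis.prod_repr_inl bW' bU (e v) i
  have h2 : ∀ i, ((bW'.prod bU).map e.symm).repr v (Sum.inr i) = bU.repr (W.mkQ v) i := fun i =>
    Module.Basis.prod_repr_inr bW' bU (e v) i
  rw [Sum.forall]
  simp only [h1, h2]

end Extension

namespace Twist

variable {k : Type u} [Field k] (τ : Twist k)
  {V : Type v} [AddCommGroup V] [Module k V] [Module (LaurentSeries k) V]

variable {τ}

lemma IsTwisted.mem_span {B : V →ₗ[k] V} (hB : τ.IsTwisted B) {v : V} {n : ℕ}
    (hn : (B ^ n) v ∈ Submodule.span (LaurentSeries k) (Set.range fun i : Fin n => (B ^ (i : ℕ)) v))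
    {w : V} (hw : w ∈ Submodule.span (LaurentSeries k) (Set.range fun i : Fin n => (B ^ (i : ℕ)) v)) :
    B w ∈ Submodule.span (LaurentSeries k) (Set.range fun i : Fin n => (B ^ (i : ℕ)) v) := by
  induction hw using Submodule.span_induction with
  | mem x hx =>
    obtain ⟨i, rfl⟩ := hx
    change B ((B ^ (i : ℕ)) v) ∈ _
    rw [← Module.End.mul_apply, ← pow_succ']
    rcases (show (i : ℕ) + 1 < n ∨ (i : ℕ) + 1 = n by omega) with h | h
    · exact Submodule.subset_span ⟨⟨_, h⟩, rfl⟩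
    · rwa [h]
  | zero => simp
  | add x y _ _ hx hy => rw [map_add]; exact add_mem hx hy
  | smul f x hx hx' =>
    rw [hB]
    exact add_mem (Submodule.smul_mem _ _ hx') (Submodule.smul_mem _ _ hx)

/-- An injective twisted operator is surjective on cyclic submodules, with a bounded inverse. -/
lemma IsTwisted.exists_preimage_cyclic [CharZero k] [IsScalarTower k (LaurentSeries k) V]
    {γ : k} (hγ : γ ≠ 0) (hν : τ.HasEuler γ) (he : 0 ≤ τ.e) {B : V →ₗ[k] V}
    (hB : τ.IsTwisted B) (hinj : ∀ w, B w = 0 → w = 0) {v : V} {n : ℕ}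
    (hli : LinearIndependent (LaurentSeries k) (fun i : Fin n => (B ^ (i : ℕ)) v))
    (hn : (B ^ n) v ∈ Submodule.span (LaurentSeries k) (Set.range fun i : Fin n => (B ^ (i : ℕ)) v))
    {j : ℤ} {x : Submodule.span (LaurentSeries k) (Set.range fun i : Fin n => (B ^ (i : ℕ)) v)}
    (hx : x ∈ Lat (Module.Basis.span hli) j) :
    ∃ y ∈ Lat (Module.Basis.span hli) (j - n * τ.e), B y = x := by
  set b := Module.Basis.span hli with hb
  have hbi : ∀ i : Fin n, (b i : V) = (B ^ (i : ℕ)) v := fun i => by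
    rw [hb, Module.Basis.span_apply]
  have hrepr : ∀ z : Submodule.span (LaurentSeries k) (Set.range fun i : Fin n => (B ^ (i : ℕ)) v),
      (z : V) = ∑ i : Fin n, b.repr z i • (B ^ (i : ℕ)) v := fun z => by
    conv_lhs => rw [← b.sum_repr z]
    push_cast
    simp only [hbi]
  -- The value `-1` in degree `n` moves `Bⁿv` to the other side of the relation, so that the
  -- vanishing sum `∑ aᵢ Bⁱv` runs over `i ≤ n`.
  let a : ℕ → LaurentSeries k := fun i => if h : i < n then b.repr ⟨_, hn⟩ ⟨i, h⟩ else -1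
  have han : a n = -1 := by simp [a]
  have ha : (B ^ n) v = ∑ i ∈ Finset.range n, a i • (B ^ i) v := by
    rw [← Fin.sum_univ_eq_sum_range fun i => a i • (B ^ i) v]
    refine (hrepr ⟨_, hn⟩).trans (Finset.sum_congr rfl fun i _ => ?_)
    simp [a]
  let w : ℕ → LaurentSeries k := fun i => if h : i < n then b.repr x ⟨i, h⟩ else 0
  have hwn : w n = 0 := by simp [w]
  have hwx : (x : V) = ∑ i ∈ Finset.range n, w i • (B ^ i) v := by
    rw [← Fin.sum_univ_eq_sum_range fun i => w i • (B ^ i) v]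
    refine (hrepr x).trans (Finset.sum_congr rfl fun i _ => ?_)
    simp [w]
  have hwj : ∀ i, w i ∈ ordGE k j := fun i => by
    simp only [w]
    split_ifs
    exacts [hx _, zero_mem _]
  obtain ⟨μ, p, hp0, hps, hμ, haμ⟩ := τ.hasSymbol_cyclicOp hγ hν a n han
  have hsol : ∀ (w : ℕ → LaurentSeries k) (f : LaurentSeries k) (F : Fin n → LaurentSeries k),
      (∀ l, F l = -τ.sigmaEquiv.symm (∑ i ∈ Finset.range (n - l),
        (τ.adj ^ i) (a (i + (l + 1)) * τ.sigma f - w (i + (l + 1))))) →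
      w n = 0 → τ.cyclicOp a n f = ∑ i ∈ Finset.range (n + 1), (τ.adj ^ i) (w i) →
      B (∑ l : Fin n, F l • (B ^ (l : ℕ)) v) = ∑ i ∈ Finset.range n, w i • (B ^ i) v := by
    intro w f F hF hw hf
    rw [← hB.solve han ha w hw f hf, ← Fin.sum_univ_eq_sum_range]
    simp only [hF]
  -- A solution `f` of the homogeneous scalar equation is the last coordinate of a vector killed by
  -- `B`; injectivity of `B` gives `f = 0`. The case `n = 0` has no last coordinate and is separate.
  have hPinj : ∀ f, τ.cyclicOp a n f = 0 → f = 0 := by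
    intro f hf
    rcases Nat.eq_zero_or_pos n with rfl | hpos
    · have h1 : τ.cyclicOp a 0 f = -τ.sigma f := by
        simp [cyclicOp, han, mulLin, sigmaLin]
      rw [h1, neg_eq_zero] at hf
      exact (_root_.map_eq_zero _).1 hf
    have h1 := hsol (fun _ => 0) f _ (fun l => rfl) rfl (by simpa using hf)
    have h2 := hinj _ (h1.trans (by simp))
    have h3 := Fintype.linearIndependent_iff.1 hli _ h2 ⟨n - 1, by omega⟩
    rw [show n - (n - 1) = 1 by omega] at h3
    simp only [Finset.range_one, Finset.sum_singleton, pow_zero, Module.End.one_apply, zero_add,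
      Nat.sub_add_cancel hpos, han, sub_zero, neg_one_mul, map_neg, neg_neg] at h3
    rwa [show τ.sigmaEquiv.symm (τ.sigma f) = f from τ.sigmaEquiv.symm_apply_apply f] at h3
  have hQ : ∑ i ∈ Finset.range (n + 1), (τ.adj ^ i) (w i) ∈ ordGE k (j - μ + μ) := by
    rw [sub_add_cancel]
    refine Submodule.sum_mem _ fun i _ => ordGE_anti ?_ (τ.adj_pow_mem i (hwj i))
    have : 0 ≤ (i : ℤ) * τ.e := by positivity
    omega
  obtain ⟨f, hf, hf'⟩ := hps.exists_preimage_of_injective hp0 hPinj (j - μ) hQ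
  let F : Fin n → LaurentSeries k := fun l => -τ.sigmaEquiv.symm (∑ i ∈ Finset.range (n - l),
        (τ.adj ^ i) (a (i + (l + 1)) * τ.sigma f - w (i + (l + 1))))
  refine ⟨b.equivFun.symm F, fun l => ?_, ?_⟩
  · have h1 : b.repr (b.equivFun.symm F) l = F l := by
      rw [← b.equivFun_apply, LinearEquiv.apply_symm_apply]
    rw [h1]
    refine neg_mem (τ.sigma_symm_mem (Submodule.sum_mem _ fun i hi => ?_))
    have hi' : i + (l + 1) ≤ n := by simp at hi; omega
    have hin : ((i + (l + 1) : ℕ) : ℤ) * τ.e ≤ n * τ.e :=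
      mul_le_mul_of_nonneg_right (by exact_mod_cast hi') he
    have h0 : 0 ≤ (i : ℤ) * τ.e := by positivity
    refine ordGE_anti ?_ (τ.adj_pow_mem i (j := j - n * τ.e) (sub_mem ?_ ?_))
    · omega
    · exact mul_mem_of_le (haμ _ hi') (τ.sigma_mem hf) (by omega)
    · refine ordGE_anti ?_ (hwj _)
      have : 0 ≤ (n : ℤ) * τ.e := by positivity
      omega
  · rw [hwx, ← hsol w f F (fun l => rfl) hwn hf', b.equivFun_symm_apply]
    push_cast
    simp only [hbi]

/-- A semilinear map is bounded by its values on a basis, as `σ` preserves orders. It is applied to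
the off-diagonal part of an operator on an extension, where the `ν`-term has disappeared. -/
lemma IsTwisted.section_mem {V' : Type*} [AddCommGroup V'] [Module k V']
    [Module (LaurentSeries k) V'] [IsScalarTower k (LaurentSeries k) V']
    [IsScalarTower k (LaurentSeries k) V] {ι κ : Type*} [Finite ι] [Finite κ]
    (b : Module.Basis ι (LaurentSeries k) V) (b' : Module.Basis κ (LaurentSeries k) V')
    (g : V →ₗ[k] V') (hg : ∀ (f : LaurentSeries k) w, g (f • w) = τ.sigma f • g w) :
    ∃ c : ℕ, ∀ j, ∀ w ∈ Lat b j, g w ∈ Lat b' (j - c) := by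
  cases nonempty_fintype ι
  choose J hJ using fun i => exists_mem_Lat b' (g (b i))
  obtain ⟨m, hm⟩ := (Set.finite_range J).bddBelow
  refine ⟨(-m).toNat, fun j w hw => ?_⟩
  rw [← b.sum_repr w, map_sum]
  refine Submodule.sum_mem _ fun i _ => ?_
  rw [hg]
  exact smul_mem_Lat_of_le b' (τ.sigma_mem (hw i)) (Lat_anti b' (hm ⟨i, rfl⟩) (hJ i)) (by omega)

end Twist

/-- The operator induced on a quotient, computed with a section. -/
def quotOp {k : Type u} [Field k] {V : Type v} [AddCommGroup V] [Module k V]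
    [Module (LaurentSeries k) V] [IsScalarTower k (LaurentSeries k) V]
    {W : Submodule (LaurentSeries k) V} (s : (V ⧸ W) →ₗ[LaurentSeries k] V) (B : V →ₗ[k] V) :
    (V ⧸ W) →ₗ[k] (V ⧸ W) where
  toFun y := W.mkQ (B (s y))
  map_add' y y' := by simp
  map_smul' c y := by
    rw [← C_smul, map_smul, C_smul, map_smul, RingHom.id_apply, ← C_smul, map_smul, C_smul]

lemma quotOp_mkQ {k : Type u} [Field k] {V : Type v} [AddCommGroup V] [Module k V]
    [Module (LaurentSeries k) V] [IsScalarTower k (LaurentSeries k) V]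
    {W : Submodule (LaurentSeries k) V} {s : (V ⧸ W) →ₗ[LaurentSeries k] V}
    (hs : ∀ y, W.mkQ (s y) = y) {B : V →ₗ[k] V} (hB : ∀ w ∈ W, B w ∈ W) (v : V) :
    quotOp s B (W.mkQ v) = W.mkQ (B v) := by
  change W.mkQ (B (s (W.mkQ v))) = _
  rw [← sub_eq_zero, ← map_sub, ← map_sub, Submodule.mkQ_apply, Submodule.Quotient.mk_eq_zero]
  refine hB _ ?_
  rw [← Submodule.Quotient.mk_eq_zero, ← Submodule.mkQ_apply, map_sub, hs, sub_self]

/-- An injective twisted operator is bijective, and its inverse is bounded. -/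
theorem Twist.IsTwisted.exists_bounded_inverse {k : Type u} [Field k] [CharZero k] {τ : Twist k}
    {γ : k} (hγ : γ ≠ 0) (hν : τ.HasEuler γ) (he : 0 ≤ τ.e) (n : ℕ)
    {V : Type v} [AddCommGroup V] [Module k V] [Module (LaurentSeries k) V]
    [IsScalarTower k (LaurentSeries k) V] [FiniteDimensional (LaurentSeries k) V]
    (hdim : Module.finrank (LaurentSeries k) V = n)
    {B : V →ₗ[k] V} (hB : τ.IsTwisted B) (hinj : ∀ w, B w = 0 → w = 0) :
    ∃ (ι : Type) (_ : Finite ι) (b : Module.Basis ι (LaurentSeries k) V),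
      ∀ j, ∀ w ∈ Lat b j, ∃ u ∈ Lat b (j - n * τ.e), B u = w := by
  induction n using Nat.strong_induction_on generalizing V with
  | _ n ih =>
  rcases Nat.eq_zero_or_pos n with rfl | hpos
  · have : Subsingleton V := Module.finrank_zero_iff.1 hdim
    refine ⟨Fin 0, inferInstance, Module.finBasisOfFinrankEq _ _ hdim, fun j w _ => ?_⟩
    exact ⟨0, zero_mem _, Subsingleton.elim _ _⟩
  have : Nontrivial V := Module.nontrivial_of_finrank_pos (R := LaurentSeries k) (by omega)
  obtain ⟨v, hv0⟩ := exists_ne (0 : V)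
  obtain ⟨m, hli, hmem⟩ := exists_linearIndependent_initial (K := LaurentSeries k)
    fun i => (B ^ i) v
  have hm : 0 < m := by
    rcases Nat.eq_zero_or_pos m with rfl | h
    · simp at hmem; exact absurd hmem hv0
    · exact h
  set W := Submodule.span (LaurentSeries k) (Set.range fun i : Fin m => (B ^ (i : ℕ)) v) with hW
  let bW : Module.Basis (Fin m) (LaurentSeries k) W := Module.Basis.span hli
  have hBW : ∀ w ∈ W, B w ∈ W := fun w hw => hB.mem_span hmem hw
  have hcyc : ∀ (j : ℤ) (x : W), x ∈ Lat bW j → ∃ y ∈ Lat bW (j - m * τ.e), B y = x :=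
    fun j x hx => hB.exists_preimage_cyclic hγ hν he hinj hli hmem hx
  have hfW : Module.finrank (LaurentSeries k) W = m := by
    simpa using Module.finrank_eq_card_basis bW
  have hfU := W.finrank_quotient_add_finrank
  obtain ⟨p, s, hp, hps, hs, hv⟩ := exists_splitting W
  have hUtw : τ.IsTwisted (quotOp s B) := by
    intro f y
    change W.mkQ (B (s (f • y))) = τ.sigma f • W.mkQ (B (s y)) + _
    rw [map_smul, hB, map_add, map_smul, map_smul, hs]
  -- Surjectivity on `W` passes injectivity to the quotient: if `B (s y)` lies in `W`, it equals `B
  -- z` with `z ∈ W`, so `s y = z` and `y = 0`.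
  have hUinj : ∀ y, quotOp s B y = 0 → y = 0 := by
    intro y hy
    have h1 : B (s y) ∈ W := (Submodule.Quotient.mk_eq_zero W).1 hy
    obtain ⟨j, hj⟩ := exists_mem_Lat bW ⟨_, h1⟩
    obtain ⟨z, _, hz⟩ := hcyc j _ hj
    have h2 := hinj (s y - z) (by rw [map_sub, hz, sub_self])
    rw [← hs y, sub_eq_zero.1 h2]
    simp
  obtain ⟨κ, _, bU, hbU⟩ := ih (n - m) (by omega) (V := V ⧸ W) (by omega) hUtw hUinj
  let g : (V ⧸ W) →ₗ[k] W :=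
    { toFun := fun y => p (B (s y))
      map_add' := fun y y' => by simp
      map_smul' := fun c y => by
        rw [← C_smul, map_smul, C_smul, map_smul, RingHom.id_apply, ← C_smul, map_smul]
        exact C_smul (V := W) c (p (B (s y))) }
  obtain ⟨c, hc⟩ := Twist.IsTwisted.section_mem (τ := τ) bU bW g (by
    intro f y
    change p (B (s (f • y))) = τ.sigma f • p (B (s y))
    rw [map_smul, hB, map_add, map_smul, map_smul, hps, smul_zero, add_zero])
  -- Enlarging the lattice of `W` by `t ^ (-c)` absorbs the bound `c` of the off-diagonal map. The
  -- total loss is then exactly `(n - m) e + m e = n e`, in particular zero if `e = 0`.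
  obtain ⟨b, hb⟩ := exists_basis_extension p s hp hps hs hv bW bU c
  refine ⟨Fin m ⊕ κ, inferInstance, b, fun j w hw => ?_⟩
  obtain ⟨hw1, hw2⟩ := (hb j w).1 hw
  obtain ⟨y, hy, hy'⟩ := hbU j _ hw2
  have hnm : ((n - m : ℕ) : ℤ) * τ.e + m * τ.e = n * τ.e := by
    rw [← add_mul, ← Nat.cast_add, Nat.sub_add_cancel (by omega)]
  have hm0 : 0 ≤ (m : ℤ) * τ.e := by positivity
  have hnm0 : 0 ≤ ((n - m : ℕ) : ℤ) * τ.e := by positivity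
  have hr : p w - g y ∈ Lat bW (j - (n - m : ℕ) * τ.e - c) :=
    sub_mem (Lat_anti bW (by omega) hw1) (hc _ y hy)
  obtain ⟨x, hx, hx'⟩ := hcyc _ _ hr
  refine ⟨s y + x, (hb _ _).2 ⟨?_, ?_⟩, ?_⟩
  · rw [map_add, hps, hp, zero_add]
    exact Lat_anti bW (by omega) hx
  · rw [map_add, hs, show W.mkQ (x : V) = 0 by simp, add_zero]
    exact Lat_anti bU (by omega) hy
  · have h1 : W.mkQ (B (s y)) = W.mkQ w := hy'
    have h2 := hv (B (s y))
    rw [h1] at h2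
    rw [map_add, hx', ← h2]
    change ((g y : W) : V) + s (W.mkQ w) + ((p w - g y : W) : V) = w
    conv_rhs => rw [← hv w]
    push_cast
    abel

/-! ### The adic topology in terms of a fixed basis -/

section AdicTopology

open scoped Topology

variable {k : Type u} [Field k] {V : Type v} [AddCommGroup V] [Module k V]
  [Module (LaurentSeries k) V] [IsScalarTower k (LaurentSeries k) V]

lemma exists_Lat_le {ι κ : Type*} [Finite ι] [Finite κ] (b : Module.Basis ι (LaurentSeries k) V)
    (b' : Module.Basis κ (LaurentSeries k) V) : ∃ c : ℕ, ∀ j, Lat b j ≤ Lat b' (j - c) := by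
  obtain ⟨c, hc⟩ := exists_bound_linearMap b b' LinearMap.id
  exact ⟨c, fun j w hw => hc j w hw⟩

/-- Any two lattices are commensurable, so the multiples `t ^ N L` of one fixed lattice form a
neighbourhood basis of zero. -/
lemma isOpen_adicTopology_iff {ι : Type*} [Finite ι] (b : Module.Basis ι (LaurentSeries k) V)
    {U : Set V} : IsOpen[adicTopology k V] U ↔ ∀ w ∈ U, ∃ N : ℕ, ∀ l ∈ Lat b N, w + l ∈ U := by
  constructor
  · intro hU
    induction hU with
    | basic U hU =>
      obtain ⟨n, b', w₀, rfl⟩ := hU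
      rintro _ ⟨l₀, hl₀, rfl⟩
      obtain ⟨c, hc⟩ := exists_Lat_le b b'
      rw [lattice_eq] at hl₀
      refine ⟨c, fun l hl => ⟨l₀ + l, ?_, (add_assoc _ _ _).symm⟩⟩
      rw [lattice_eq]
      exact add_mem hl₀ (by simpa using hc c hl)
    | univ => exact fun w _ => ⟨0, fun l _ => trivial⟩
    | inter s t _ _ hs ht =>
      rintro w ⟨h1, h2⟩
      obtain ⟨N, hN⟩ := hs w h1
      obtain ⟨M, hM⟩ := ht w h2
      exact ⟨max N M, fun l hl => ⟨hN l (Lat_anti b (by simp) hl), hM l (Lat_anti b (by simp) hl)⟩⟩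
    | sUnion S _ ih =>
      rintro w ⟨s, hs, hw⟩
      obtain ⟨N, hN⟩ := ih s hs w hw
      exact ⟨N, fun l hl => ⟨s, hs, hN l hl⟩⟩
  · intro h
    choose! N hN using h
    obtain ⟨n, ⟨e⟩⟩ := Finite.exists_equiv_fin ι
    have hbasis : ∀ w, IsOpen[adicTopology k V] ((fun l => w + l) '' (Lat b (N w) : Set V)) := by
      intro w
      obtain ⟨b', hb'⟩ := Lat_map_smul (b.reindex e) (-(N w))
      refine TopologicalSpace.isOpen_generateFrom_of_mem ⟨n, b', w, ?_⟩
      rw [lattice_eq, hb']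
      congr 1
      ext l
      simp only [SetLike.mem_coe, mem_Lat]
      constructor
      · intro h i
        simpa using h (e.symm i)
      · intro h i
        simpa using h (e i)
    have hU : U = ⋃ w ∈ U, (fun l => w + l) '' (Lat b (N w) : Set V) := by
      ext w
      simp only [Set.mem_iUnion]
      constructor
      · exact fun hw => ⟨w, hw, 0, zero_mem _, add_zero w⟩
      · rintro ⟨w', hw', l, hl, rfl⟩
        exact hN w' hw' l hl
    rw [hU]
    let := adicTopology k V
    exact isOpen_biUnion fun w _ => hbasis w

variable {V' : Type*} [AddCommGroup V'] [Module k V']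
  [Module (LaurentSeries k) V'] [IsScalarTower k (LaurentSeries k) V']

/-- Equality of topologies is continuity of `e` and `e⁻¹` at zero, by translation invariance;
`bounds_of_adicTopology_eq` is the converse. -/
lemma adicTopology_eq_induced {ι κ : Type*} [Finite ι] [Finite κ]
    (b : Module.Basis ι (LaurentSeries k) V) (b' : Module.Basis κ (LaurentSeries k) V')
    (e : V ≃ₗ[k] V') (h1 : ∀ N : ℕ, ∃ M : ℕ, ∀ l ∈ Lat b M, e l ∈ Lat b' N)
    (h2 : ∀ N : ℕ, ∃ M : ℕ, ∀ l ∈ Lat b' M, e.symm l ∈ Lat b N) :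
    adicTopology k V = (adicTopology k V').induced e := by
  let := adicTopology k V'
  refine TopologicalSpace.ext_iff.2 fun U => ?_
  rw [isOpen_induced_iff, isOpen_adicTopology_iff b]
  constructor
  · intro hU
    refine ⟨e.symm ⁻¹' U, (isOpen_adicTopology_iff b').2 fun w hw => ?_, by ext; simp⟩
    obtain ⟨N, hN⟩ := hU _ hw
    obtain ⟨M, hM⟩ := h2 N
    refine ⟨M, fun l hl => ?_⟩
    rw [Set.mem_preimage, map_add]
    exact hN _ (hM l hl)
  · rintro ⟨U', hU', rfl⟩ w hw
    obtain ⟨N, hN⟩ := (isOpen_adicTopology_iff b').1 hU' _ hw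
    obtain ⟨M, hM⟩ := h1 N
    refine ⟨M, fun l hl => ?_⟩
    rw [Set.mem_preimage, map_add]
    exact hN _ (hM l hl)

lemma isOpen_Lat {ι : Type*} [Finite ι] (b : Module.Basis ι (LaurentSeries k) V) (j : ℤ) :
    IsOpen[adicTopology k V] (Lat b j : Set V) :=
  (isOpen_adicTopology_iff b).2 fun w hw => ⟨j.toNat, fun l hl =>
    add_mem hw (Lat_anti b (by omega) hl)⟩

lemma bounds_of_adicTopology_eq {ι κ : Type*} [Finite ι] [Finite κ]
    (b : Module.Basis ι (LaurentSeries k) V) (b' : Module.Basis κ (LaurentSeries k) V')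
    (e : V ≃ₗ[k] V') (h : adicTopology k V = (adicTopology k V').induced e) :
    (∀ N : ℤ, ∃ M : ℕ, ∀ l ∈ Lat b M, e l ∈ Lat b' N) ∧
      ∀ N : ℤ, ∃ M : ℕ, ∀ l ∈ Lat b' M, e.symm l ∈ Lat b N := by
  let := adicTopology k V'
  constructor
  · intro N
    have h1 : IsOpen[adicTopology k V] (e ⁻¹' (Lat b' N : Set V')) := by
      rw [h]
      exact isOpen_induced_iff.2 ⟨_, isOpen_Lat b' N, rfl⟩
    obtain ⟨M, hM⟩ := (isOpen_adicTopology_iff b).1 h1 0 (by simp)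
    exact ⟨M, fun l hl => by simpa using hM l hl⟩
  · intro N
    have h1 := isOpen_Lat b N
    rw [h, isOpen_induced_iff] at h1
    obtain ⟨U', hU', hU⟩ := h1
    have h0 : (0 : V') ∈ U' := by
      have : (0 : V) ∈ e ⁻¹' U' := by rw [hU]; exact zero_mem _
      simpa using this
    obtain ⟨M, hM⟩ := (isOpen_adicTopology_iff b').1 hU' 0 h0
    refine ⟨M, fun l hl => ?_⟩
    have : e.symm l ∈ e ⁻¹' U' := by simpa using hM l hl
    rwa [hU] at this

end AdicTopology

/-! ### Laurent series in an operator -/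

/-- A complete separated exhaustive filtration on which the operator `T` acts as a uniformizer. -/
structure TFilt {k : Type u} [Field k] {V : Type v} [AddCommGroup V] [Module k V]
    (T : V ≃ₗ[k] V) (G : ℤ → Submodule k V) {n : ℕ} (E : Fin n → V) : Prop where
  anti : ∀ {i j : ℤ}, i ≤ j → G j ≤ G i
  map_mem : ∀ {j : ℤ} {w : V}, w ∈ G j → T w ∈ G (j + 1)
  symm_mem : ∀ {j : ℤ} {w : V}, w ∈ G j → T.symm w ∈ G (j - 1)
  sep : ∀ {w : V}, (∀ N : ℕ, w ∈ G N) → w = 0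
  exh : ∀ w : V, ∃ j, w ∈ G j
  compl : ∀ (w : ℕ → V) (a : ℤ), (∀ i : ℕ, w i ∈ G (a + i)) →
    ∃ v : V, ∀ N : ℕ, v - ∑ i ∈ Finset.range N, w i ∈ G (a + N)
  gen_mem : ∀ l, E l ∈ G 0
  gen : ∀ w ∈ G 0, ∃ c : Fin n → k, w - ∑ l, c l • E l ∈ G 1

namespace TFilt

variable {k : Type u} [Field k] {V : Type v} [AddCommGroup V] [Module k V]
  {T : V ≃ₗ[k] V} {G : ℤ → Submodule k V} {n : ℕ} {E : Fin n → V}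

lemma zpow_mem (h : TFilt T G E) (i : ℤ) {j : ℤ} {w : V} (hw : w ∈ G j) :
    (T ^ i) w ∈ G (j + i) := by
  obtain ⟨m, rfl | rfl⟩ := i.eq_nat_or_neg
  · induction m with
    | zero => simpa using hw
    | succ m ih =>
      have := h.map_mem ih
      rw [add_assoc] at this
      push_cast
      rw [add_comm (m : ℤ) 1, zpow_add, zpow_one, LinearEquiv.mul_apply, add_comm 1 (m : ℤ)]
      exact this
  · induction m with
    | zero => simpa using hw
    | succ m ih =>
      have := h.symm_mem ih
      push_cast
      rw [neg_add_rev, zpow_add, zpow_neg_one, LinearEquiv.mul_apply]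
      rw [show j + (-1 + -(m : ℤ)) = j + -m - 1 by ring]
      exact this

/-- Evaluation of Laurent polynomials in `T` at the vector `w`. -/
def ev (T : V ≃ₗ[k] V) (w : V) : (ℤ →₀ k) →ₗ[k] V :=
  Finsupp.linearCombination k fun j : ℤ => (T ^ j) w

/-- The Laurent polynomial with given coefficients. -/
def toLaurent (k : Type u) [Field k] : (ℤ →₀ k) →ₗ[k] LaurentSeries k :=
  Finsupp.linearCombination k fun j : ℤ => tpow k j

lemma coeff_toLaurent (p : ℤ →₀ k) (i : ℤ) : (toLaurent k p).coeff i = p i := by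
  classical
  rw [toLaurent, Finsupp.linearCombination_apply, Finsupp.sum, HahnSeries.coeff_sum]
  simp only [HahnSeries.coeff_smul, coeff_tpow, smul_eq_mul, mul_ite, mul_one, mul_zero]
  rw [Finset.sum_ite_eq p.support i]
  split_ifs with hi
  · rfl
  · simpa using (Finsupp.notMem_support_iff.1 hi).symm

lemma ev_mem (h : TFilt T G E) {a N : ℤ} {w : V} (hw : w ∈ G a) {p : ℤ →₀ k}
    (hp : toLaurent k p ∈ ordGE k N) : ev T w p ∈ G (a + N) := by
  rw [ev, Finsupp.linearCombination_apply]
  refine Submodule.sum_mem _ fun j hj => Submodule.smul_mem _ _ (h.anti ?_ (h.zpow_mem j hw))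
  by_contra hlt
  refine (Finsupp.mem_support_iff.1 hj) ?_
  rw [← coeff_toLaurent]
  exact hp j (by omega)

/-- The vector `v` is the value of `f(T)` at `w`: the truncations of `f` act as Laurent polynomials
in `T` and converge by completeness of the filtration. -/
lemma exists_approx (h : TFilt T G E) (w : V) {a : ℤ} (hw : w ∈ G a) (f : LaurentSeries k) :
    ∃ v, ∀ N : ℤ, ∃ p : ℤ →₀ k, f - toLaurent k p ∈ ordGE k N ∧ v - ev T w p ∈ G (a + N) := by
  obtain ⟨j, hj⟩ := exists_mem_ordGE f
  obtain ⟨v, hv⟩ := h.compl (fun i => f.coeff (j + i) • (T ^ (j + i : ℤ)) w) (a + j) (fun i => by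
    refine Submodule.smul_mem _ _ ?_
    rw [add_assoc]
    exact h.zpow_mem _ hw)
  refine ⟨v, fun N => ?_⟩
  obtain ⟨m, hm⟩ : ∃ m : ℕ, N ≤ j + m := ⟨(N - j).toNat, by omega⟩
  refine ⟨∑ i ∈ Finset.range m, Finsupp.single (j + i : ℤ) (f.coeff (j + i)), ?_, ?_⟩
  · refine ordGE_anti hm fun l hl => ?_
    rw [HahnSeries.coeff_sub, coeff_toLaurent, Finsupp.finsetSum_apply]
    simp only [Finsupp.single_apply]
    by_cases hlj : l < j
    · rw [hj l hlj, zero_sub, neg_eq_zero]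
      exact Finset.sum_eq_zero fun i _ => if_neg (by omega)
    · obtain ⟨r, rfl⟩ : ∃ r : ℕ, l = j + r := ⟨(l - j).toNat, by omega⟩
      rw [Finset.sum_eq_single r]
      · simp
      · intro i _ hi
        exact if_neg (by omega)
      · intro hr
        exact absurd (Finset.mem_range.2 (by omega)) hr
  · refine h.anti (show a + N ≤ a + j + m by omega) ?_
    rw [map_sum]
    simpa [ev] using hv m

/-- A continuous `k`-linear map out of `k((t))` vanishing on monomials is zero. -/
lemma eq_zero_of_tpow (h : TFilt T G E) (g : LaurentSeries k →ₗ[k] V)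
    (h0 : ∀ j, g (tpow k j) = 0) {a : ℤ} (hc : ∀ N, ∀ f ∈ ordGE k N, g f ∈ G (a + N))
    (f : LaurentSeries k) : g f = 0 := by
  refine h.sep fun N => ?_
  obtain ⟨j, hj⟩ := exists_mem_ordGE f
  refine ordGE_induction (p := fun f => g f ∈ G N) (N := N - a) ?_ ?_ ?_ hj
  · intro f g hf hg
    rw [map_add]; exact add_mem hf hg
  · intro i _ c
    simp [h0]
  · intro f hf
    simpa using hc _ f hf

lemma exists_act (h : TFilt T G E) (w : V) : ∃ ψ : LaurentSeries k →ₗ[k] V,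
    (∀ j, ψ (tpow k j) = (T ^ j) w) ∧ ∀ {a : ℤ}, w ∈ G a → ∀ N, ∀ f ∈ ordGE k N,
      ψ f ∈ G (a + N) := by
  obtain ⟨a, ha⟩ := h.exh w
  choose ψ hψ using h.exists_approx w ha
  -- Two approximations of `f` differ by a Laurent polynomial of large order, which acts by a small
  -- amount. The value is thus determined by `f`, and linearity follows by approximating each
  -- argument.
  have huniq : ∀ f v, (∀ N : ℤ, ∃ p : ℤ →₀ k, f - toLaurent k p ∈ ordGE k N ∧
      v - ev T w p ∈ G (a + N)) → ψ f = v := by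
    intro f v hv
    refine sub_eq_zero.1 (h.sep fun N => ?_)
    obtain ⟨p, hp, hp'⟩ := hψ f (N - a)
    obtain ⟨r, hr, hr'⟩ := hv (N - a)
    have h1 : toLaurent k (p - r) ∈ ordGE k (N - a) := by
      have := sub_mem hr hp
      rw [map_sub]
      convert this using 1
      ring
    have h2 := h.ev_mem ha h1
    have h3 := add_mem (sub_mem hp' hr') h2
    rw [map_sub, add_sub_cancel] at h3
    convert h3 using 1
    abel
  refine ⟨{ toFun := ψ, map_add' := fun f g => ?_, map_smul' := fun c f => ?_ }, fun j => ?_, ?_⟩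
  · refine huniq _ _ fun N => ?_
    obtain ⟨p, hp, hp'⟩ := hψ f N
    obtain ⟨r, hr, hr'⟩ := hψ g N
    refine ⟨p + r, ?_, ?_⟩
    · rw [map_add, add_sub_add_comm]; exact add_mem hp hr
    · rw [map_add, add_sub_add_comm]; exact add_mem hp' hr'
  · refine huniq _ _ fun N => ?_
    obtain ⟨p, hp, hp'⟩ := hψ f N
    refine ⟨c • p, ?_, ?_⟩
    · rw [map_smul, ← smul_sub]; exact Submodule.smul_mem _ _ hp
    · rw [map_smul, RingHom.id_apply, ← smul_sub]; exact Submodule.smul_mem _ _ hp'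
  · refine huniq _ _ fun N => ⟨Finsupp.single j 1, ?_, ?_⟩
    · simp [toLaurent]
    · simp [ev]
  · intro a' ha' N f hf
    obtain ⟨p, hp, hp'⟩ := hψ f (max N (a' + N - a))
    have h1 : toLaurent k p ∈ ordGE k N := by
      have := sub_mem hf (ordGE_anti (le_max_left N (a' + N - a)) hp)
      simpa using this
    have h2 := add_mem (h.anti (show a' + N ≤ _ by
      have := le_max_right N (a' + N - a); omega) hp') (h.ev_mem ha' h1)
    simpa using h2

/-- The action of Laurent series in `T` on the vector `w`. -/
def act (h : TFilt T G E) (w : V) : LaurentSeries k →ₗ[k] V := (h.exists_act w).choose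

lemma act_tpow (h : TFilt T G E) (w : V) (j : ℤ) : h.act w (tpow k j) = (T ^ j) w :=
  (h.exists_act w).choose_spec.1 j

lemma act_mem (h : TFilt T G E) {w : V} {a N : ℤ} (hw : w ∈ G a) {f : LaurentSeries k}
    (hf : f ∈ ordGE k N) : h.act w f ∈ G (a + N) :=
  (h.exists_act w).choose_spec.2 hw N f hf

/-- Continuity and the values on monomials determine the action. The module axioms reduce to
identities between powers of `T` through this uniqueness. -/
lemma act_ext (h : TFilt T G E) {g : LaurentSeries k →ₗ[k] V} {w : V}
    (h0 : ∀ j, g (tpow k j) = (T ^ j) w) {a : ℤ} (hc : ∀ N, ∀ f ∈ ordGE k N, g f ∈ G (a + N)) :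
    g = h.act w := by
  obtain ⟨a', ha'⟩ := h.exh w
  ext1 f
  refine sub_eq_zero.1 (h.eq_zero_of_tpow (g - h.act w) (fun j => ?_) (a := min a a')
    (fun N f hf => ?_) f)
  · rw [LinearMap.sub_apply, h0, h.act_tpow, sub_self]
  · exact sub_mem (h.anti (by have := min_le_left a a'; omega) (hc N f hf))
      (h.anti (by have := min_le_right a a'; omega) (h.act_mem ha' hf))

lemma act_add (h : TFilt T G E) (w w' : V) : h.act (w + w') = h.act w + h.act w' := by
  obtain ⟨a, ha⟩ := h.exh w
  obtain ⟨a', ha'⟩ := h.exh w'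
  refine (h.act_ext (a := min a a') (fun j => ?_) fun N f hf => ?_).symm
  · simp [h.act_tpow]
  · exact add_mem (h.anti (by have := min_le_left a a'; omega) (h.act_mem ha hf))
      (h.anti (by have := min_le_right a a'; omega) (h.act_mem ha' hf))

lemma act_smul (h : TFilt T G E) (c : k) (w : V) : h.act (c • w) = c • h.act w := by
  obtain ⟨a, ha⟩ := h.exh w
  refine (h.act_ext (a := a) (fun j => ?_) fun N f hf => ?_).symm
  · simp [h.act_tpow]
  · exact Submodule.smul_mem _ _ (h.act_mem ha hf)

lemma act_tpow_mul (h : TFilt T G E) (w : V) (j : ℤ) (g : LaurentSeries k) :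
    h.act w (tpow k j * g) = (T ^ j) (h.act w g) := by
  obtain ⟨a, ha⟩ := h.exh w
  have h1 : h.act w ∘ₗ mulLin (tpow k j) = h.act ((T ^ j) w) := by
    refine h.act_ext (a := a + j) (fun i => ?_) fun N f hf => ?_
    · change h.act w (tpow k j * tpow k i) = _
      rw [← tpow_add, h.act_tpow, add_comm j i, zpow_add, LinearEquiv.mul_apply]
    · rw [add_assoc]
      exact h.act_mem ha (mul_mem_ordGE (tpow_mem j) hf)
  have h2 : ((T ^ j : V ≃ₗ[k] V) : V →ₗ[k] V) ∘ₗ h.act w = h.act ((T ^ j) w) := by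
    refine h.act_ext (a := a + j) (fun i => ?_) fun N f hf => ?_
    · change (T ^ j) (h.act w (tpow k i)) = _
      rw [h.act_tpow, ← LinearEquiv.mul_apply, ← LinearEquiv.mul_apply, ← zpow_add, ← zpow_add,
        add_comm]
    · rw [add_right_comm]
      exact h.zpow_mem j (h.act_mem ha hf)
  exact LinearMap.congr_fun (h1.trans h2.symm) g

lemma act_mul (h : TFilt T G E) (w : V) (f g : LaurentSeries k) :
    h.act w (f * g) = h.act (h.act w g) f := by
  obtain ⟨a, ha⟩ := h.exh w
  obtain ⟨b, hb⟩ := exists_mem_ordGE g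
  have h1 : h.act w ∘ₗ mulLin g = h.act (h.act w g) := by
    refine h.act_ext (a := a + b) (fun i => ?_) fun N f hf => ?_
    · change h.act w (g * tpow k i) = _
      rw [mul_comm, h.act_tpow_mul]
    · rw [add_assoc]
      exact h.act_mem ha (mul_mem_ordGE hb hf)
  rw [mul_comm]
  exact LinearMap.congr_fun h1 f

/-- The structure of a `k((t))`-module for which `t` acts as `T`. -/
@[reducible]
def module (h : TFilt T G E) : Module (LaurentSeries k) V where
  smul f w := h.act w f
  one_smul w := by
    change h.act w 1 = w
    rw [← tpow_zero, h.act_tpow]; simp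
  mul_smul f g w := h.act_mul w f g
  smul_zero f := by
    change h.act 0 f = 0
    have := h.act_smul 0 0
    rw [zero_smul, zero_smul] at this
    rw [this, LinearMap.zero_apply]
  smul_add f w w' := by
    change h.act (w + w') f = h.act w f + h.act w' f
    rw [h.act_add, LinearMap.add_apply]
  add_smul f g w := map_add (h.act w) f g
  zero_smul w := map_zero (h.act w)

lemma isScalarTower (h : TFilt T G E) :
    letI := h.module
    IsScalarTower k (LaurentSeries k) V :=
  letI := h.module
  ⟨fun c f w => map_smul (h.act w) c f⟩

/-- Nakayama's lemma in the complete setting: the `E l` generate `G 0` modulo `G 1`, hence by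
translation with `T` every graded piece, and successive approximation generates `G M` itself. -/
lemma exists_generate (h : TFilt T G E) {M : ℤ} {w : V} (hw : w ∈ G M) :
    ∃ f : Fin n → LaurentSeries k, (∀ l, f l ∈ ordGE k M) ∧ w = ∑ l, h.act (E l) (f l) := by
  let b := Pi.basisFun (LaurentSeries k) (Fin n)
  have hLat : ∀ {i : ℤ} {f : Fin n → LaurentSeries k}, f ∈ Lat b i ↔ ∀ l, f l ∈ ordGE k i := by
    intro i f
    simp [mem_Lat, b]
  have hsum : ∀ {i : ℤ} {f : Fin n → LaurentSeries k}, f ∈ Lat b i →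
      ∑ l, h.act (E l) (f l) ∈ G i := fun {i f} hf =>
    Submodule.sum_mem _ fun l _ => by simpa using h.act_mem (h.gen_mem l) (hLat.1 hf l)
  obtain ⟨f, hf0, hf⟩ := exists_limit b
    (fun i f => w - ∑ l, h.act (E l) (f l) ∈ G (M + i)) M (v₀ := 0) (by simpa using hw) (by
      intro i f hf
      have h1 := h.zpow_mem (-(M + i)) hf
      rw [add_neg_cancel] at h1
      obtain ⟨c, hc⟩ := h.gen _ h1
      refine ⟨fun l => c l • tpow k (M + i),
        hLat.2 fun l => Submodule.smul_mem _ _ (tpow_mem _), ?_⟩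
      have h2 := h.zpow_mem (M + i) hc
      rw [map_sub, ← LinearEquiv.mul_apply, ← zpow_add, add_neg_cancel, zpow_zero,
        LinearEquiv.coe_one, id, map_sum] at h2
      push_cast
      simp only [Pi.add_apply, map_add, Finset.sum_add_distrib, map_smul, h.act_tpow]
      simp only [map_smul] at h2
      rw [← sub_sub]
      convert h2 using 1
      ring_nf)
  refine ⟨f, by simpa using hLat.1 hf0, sub_eq_zero.1 (h.sep fun N => ?_)⟩
  obtain ⟨m, hm⟩ : ∃ m : ℕ, (N : ℤ) ≤ M + m := ⟨(N - M).toNat, by omega⟩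
  obtain ⟨f', hf', hff'⟩ := hf m
  have h1 := sub_mem hf' (hsum hff')
  refine h.anti hm ?_
  convert h1 using 1
  simp only [Pi.sub_apply, map_sub, Finset.sum_sub_distrib]
  abel

lemma finite (h : TFilt T G E) :
    letI := h.module
    FiniteDimensional (LaurentSeries k) V := by
  classical
  let := h.module
  refine ⟨⟨Finset.univ.image E, ?_⟩⟩
  rw [eq_top_iff]
  rintro w -
  obtain ⟨M, hM⟩ := h.exh w
  obtain ⟨f, _, hf⟩ := h.exists_generate hM
  rw [hf]
  refine Submodule.sum_mem _ fun l _ => ?_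
  change f l • E l ∈ _
  exact Submodule.smul_mem _ _ (Submodule.subset_span (by simp))

lemma exists_bounds (h : TFilt T G E) {ι : Type*} [Finite ι] :
    letI := h.module
    letI := h.isScalarTower
    ∀ b : Module.Basis ι (LaurentSeries k) V,
      ∃ c : ℕ, (∀ j, Lat b j ≤ G (j - c)) ∧ ∀ j, G j ≤ Lat b (j - c) := by
  let := h.module
  let := h.isScalarTower
  intro b
  cases nonempty_fintype ι
  choose J hJ using fun i => h.exh (b i)
  obtain ⟨m, hm⟩ := (Set.finite_range J).bddBelow
  choose J' hJ' using fun l => exists_mem_Lat b (E l)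
  obtain ⟨m', hm'⟩ := (Set.finite_range J').bddBelow
  refine ⟨max (-m).toNat (-m').toNat, fun j w hw => ?_, fun j w hw => ?_⟩
  · rw [← b.sum_repr w]
    refine Submodule.sum_mem _ fun i _ => ?_
    have h1 := h.act_mem (h.anti (hm ⟨i, rfl⟩) (hJ i)) (hw i)
    exact h.anti (by push_cast; omega) h1
  · obtain ⟨f, hf, rfl⟩ := h.exists_generate hw
    refine Submodule.sum_mem _ fun l _ => ?_
    change f l • E l ∈ _
    exact smul_mem_Lat_of_le b (hf l) (Lat_anti b (hm' ⟨l, rfl⟩) (hJ' l)) (by push_cast; omega)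

end TFilt

section OperatorModule

variable {k : Type u} [Field k] {V : Type v} [AddCommGroup V] [Module k V]

/-- The filtration `T ^ j L`. -/
def opFilt (T : V ≃ₗ[k] V) (L : Submodule k V) (j : ℤ) : Submodule k V :=
  L.comap ((T ^ (-j) : V ≃ₗ[k] V) : V →ₗ[k] V)

lemma mem_opFilt {T : V ≃ₗ[k] V} {L : Submodule k V} {j : ℤ} {w : V} :
    w ∈ opFilt T L j ↔ (T ^ (-j)) w ∈ L := Iff.rfl

variable [Module (LaurentSeries k) V] [IsScalarTower k (LaurentSeries k) V]

/-- The filtration is `T ^ j L`. The bounds on `T ^ m` and `T⁻¹` sandwich it between multiples of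
`L`, giving separatedness, completeness and finiteness of `L / T L`. -/
lemma exists_TFilt {ι : Type*} [Finite ι] (b : Module.Basis ι (LaurentSeries k) V)
    {T : V ≃ₗ[k] V} {m c : ℕ} (hm : 0 < m) (h1 : ∀ j, ∀ w ∈ Lat b j, T w ∈ Lat b j)
    (h2 : ∀ j, ∀ w ∈ Lat b j, (T ^ m) w ∈ Lat b (j + 1))
    (h3 : ∀ j, ∀ w ∈ Lat b j, T.symm w ∈ Lat b (j - c)) :
    ∃ (n : ℕ) (E : Fin n → V), TFilt T (opFilt T (Lat b 0)) E ∧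
      (∀ N : ℕ, opFilt T (Lat b 0) (m * N) ≤ Lat b N) ∧
      ∀ N : ℕ, Lat b (c * N) ≤ opFilt T (Lat b 0) N := by
  have hpow : ∀ (n : ℕ) j, ∀ w ∈ Lat b j, (T ^ n) w ∈ Lat b j := by
    intro n
    induction n with
    | zero => intro j w hw; simpa using hw
    | succ n ih => intro j w hw; rw [pow_succ', LinearEquiv.mul_apply]; exact h1 _ _ (ih j w hw)
  have hpowm : ∀ (n : ℕ) j, ∀ w ∈ Lat b j, (T ^ (m * n)) w ∈ Lat b (j + n) := by
    intro n
    induction n with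
    | zero => intro j w hw; simpa using hw
    | succ n ih =>
      intro j w hw
      rw [show m * (n + 1) = m + m * n by ring, pow_add, LinearEquiv.mul_apply, Nat.cast_succ,
        ← add_assoc]
      exact h2 _ _ (ih j w hw)
  have hsymm : ∀ (n : ℕ) j, ∀ w ∈ Lat b j, (T ^ (-(n : ℤ))) w ∈ Lat b (j - c * n) := by
    intro n
    induction n with
    | zero => intro j w hw; simpa using hw
    | succ n ih =>
      intro j w hw
      push_cast
      rw [neg_add_rev, zpow_add, zpow_neg_one, LinearEquiv.mul_apply]
      have := h3 _ _ (ih j w hw)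
      rwa [show j - c * ((n : ℤ) + 1) = j - c * n - c by ring]
  set G := opFilt T (Lat b 0) with hG
  have hanti : ∀ {i j : ℤ}, i ≤ j → G j ≤ G i := by
    intro i j hij w hw
    rw [hG, mem_opFilt] at hw ⊢
    have := hpow (j - i).toNat _ _ hw
    rw [← zpow_natCast, ← LinearEquiv.mul_apply, ← zpow_add] at this
    rwa [show ((j - i).toNat : ℤ) + -j = -i by omega] at this
  have hz : ∀ {j : ℤ} (i : ℤ) {w : V}, w ∈ G j → (T ^ i) w ∈ G (j + i) := by
    intro j i w hw
    rw [hG, mem_opFilt] at hw ⊢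
    rw [← LinearEquiv.mul_apply, ← zpow_add]
    rwa [show -(j + i) + i = -j by ring]
  have hGL : ∀ N : ℕ, G (m * N) ≤ Lat b N := by
    intro N w hw
    rw [hG, mem_opFilt] at hw
    have := hpowm N _ _ hw
    rw [← zpow_natCast, ← LinearEquiv.mul_apply, ← zpow_add] at this
    simpa using this
  have hLG : ∀ N : ℕ, Lat b (c * N) ≤ G N := by
    intro N w hw
    rw [hG, mem_opFilt]
    simpa using hsymm N _ _ hw
  have hcompl0 : ∀ w : ℕ → V, (∀ i : ℕ, w i ∈ G i) →
      ∃ v : V, ∀ N : ℕ, v - ∑ i ∈ Finset.range N, w i ∈ G N := by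
    intro w hw
    -- Summing in blocks of length `m` makes the `i`-th block lie in `G (m i)`, hence in `t ^ i L`,
    -- where the sum converges.
    obtain ⟨v, hv⟩ := exists_sum_Lat b (fun i => ∑ l ∈ Finset.range m, w (m * i + l)) 0 (by
      intro i
      rw [zero_add]
      refine hGL i (Submodule.sum_mem _ fun l _ => hanti ?_ (hw _))
      push_cast; omega)
    have hsum : ∀ N, ∑ i ∈ Finset.range N, ∑ l ∈ Finset.range m, w (m * i + l) =
        ∑ i ∈ Finset.range (m * N), w i := by
      intro N
      induction N with
      | zero => simp
      | succ N ih => rw [Finset.sum_range_succ, ih, mul_add, mul_one, Finset.sum_range_add]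
    refine ⟨v, fun N => ?_⟩
    -- The part `c N` brings the error into `G N`; the extra `N` guarantees that at least `N` terms
    -- have been summed, even if `c = 0`.
    have h4 := hv (c * N + N)
    rw [hsum] at h4
    have h5 : N ≤ m * (c * N + N) := by nlinarith [Nat.zero_le (m * (c * N))]
    have h6 := hLG N (Lat_anti b (by push_cast; omega) h4)
    obtain ⟨r, hr⟩ := Nat.exists_eq_add_of_le h5
    rw [hr, Finset.sum_range_add, ← sub_sub] at h6
    have h7 : ∑ i ∈ Finset.range r, w (N + i) ∈ G N :=
      Submodule.sum_mem _ fun i _ => hanti (by push_cast; omega) (hw _)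
    simpa using add_mem h6 h7
  -- Since `t ^ c L` lies in `T L`, vectors of `L` are needed only modulo `t ^ c L`, that is,
  -- through their coefficients of degrees `0, …, c - 1`. The generators `E` lift a basis of the
  -- resulting finite-dimensional image.
  let coefs : Lat b 0 →ₗ[k] (ι → Fin c → k) :=
    { toFun := fun w i l => (b.repr (w : V) i).coeff (l : ℕ)
      map_add' := fun w w' => by ext; simp
      map_smul' := fun a w => by
        ext i l
        have h4 : b.repr ((a • w : Lat b 0) : V) i = a • b.repr (w : V) i := by
          rw [Submodule.coe_smul, ← C_smul, map_smul, Finsupp.smul_apply, smul_eq_mul,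
            ← smul_eq_C_mul]
        change (b.repr ((a • w : Lat b 0) : V) i).coeff _ = a * _
        rw [h4]
        rfl }
  cases nonempty_fintype ι
  let B := Module.finBasis k (LinearMap.range coefs)
  choose E hE using fun l => (B l).2
  refine ⟨_, fun l => (E l : V), ⟨hanti, fun hw => hz 1 hw, fun hw => ?_, fun {w} hw => ?_,
    fun w => ?_, fun w a hw => ?_, fun l => ?_, fun w hw => ?_⟩, hGL, hLG⟩
  · have := hz (-1) hw
    rwa [zpow_neg_one] at this
  · exact eq_zero_of_forall_mem_Lat b fun N => hGL N (by exact_mod_cast hw (m * N))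
  · obtain ⟨j, hj⟩ := exists_mem_Lat b w
    refine ⟨-((m * (-j).toNat : ℕ) : ℤ), ?_⟩
    rw [hG, mem_opFilt, neg_neg, zpow_natCast]
    exact Lat_anti b (by omega) (hpowm (-j).toNat j w hj)
  · obtain ⟨v, hv⟩ := hcompl0 (fun i => (T ^ (-a)) (w i)) (fun i => by
      have := hz (-a) (hw i)
      rwa [add_neg_cancel_comm] at this)
    refine ⟨(T ^ a) v, fun N => ?_⟩
    have := hz a (hv N)
    rw [map_sub, map_sum] at this
    simp only [← LinearEquiv.mul_apply, ← zpow_add, add_neg_cancel, zpow_zero,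
      LinearEquiv.coe_one, id] at this
    rwa [add_comm] at this
  · rw [hG, mem_opFilt]; simp
  · have hw' : w ∈ Lat b 0 := by rw [hG, mem_opFilt] at hw; simpa using hw
    let y : LinearMap.range coefs := ⟨coefs ⟨w, hw'⟩, _, rfl⟩
    refine ⟨fun l => B.repr y l, ?_⟩
    have hmem : (⟨w, hw'⟩ : Lat b 0) - ∑ l, B.repr y l • E l ∈ LinearMap.ker coefs := by
      rw [LinearMap.mem_ker, map_sub, map_sum, sub_eq_zero]
      have h4 := congrArg Subtype.val (B.sum_repr y)
      rw [Submodule.coe_sum] at h4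
      rw [show coefs ⟨w, hw'⟩ = (y : ι → Fin c → k) from rfl, ← h4]
      refine Finset.sum_congr rfl fun l _ => ?_
      rw [map_smul, hE]
      rfl
    have h5 : w - ∑ l, B.repr y l • (E l : V) ∈ Lat b (c * (1 : ℕ)) := by
      intro i r hr
      by_cases hr0 : r < 0
      · refine (sub_mem hw' (Submodule.sum_mem _ fun l _ => Submodule.smul_mem _ _ (E l).2) :
          w - ∑ l, B.repr y l • (E l : V) ∈ Lat b 0) i r hr0
      · obtain ⟨r', rfl⟩ := Int.eq_ofNat_of_zero_le (not_lt.1 hr0)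
        have := congrFun (congrFun (LinearMap.mem_ker.1 hmem) i) ⟨r', by
          have : (r' : ℤ) < c := by simpa using hr
          omega⟩
        simpa [coefs] using this
    simpa using hLG 1 h5

/-- A topologically nilpotent automorphism with bounded inverse is the uniformizer of another
structure of `k((t))`-vector space, with the same topology. -/
theorem exists_operator_module {ι : Type*} [Finite ι] (b : Module.Basis ι (LaurentSeries k) V)
    {T : V ≃ₗ[k] V} {m c : ℕ} (hm : 0 < m) (h1 : ∀ j, ∀ w ∈ Lat b j, T w ∈ Lat b j)
    (h2 : ∀ j, ∀ w ∈ Lat b j, (T ^ m) w ∈ Lat b (j + 1))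
    (h3 : ∀ j, ∀ w ∈ Lat b j, T.symm w ∈ Lat b (j - c)) :
    ∃ (V' : Type v) (_ : AddCommGroup V') (_ : Module k V') (_ : Module (LaurentSeries k) V')
      (_ : IsScalarTower k (LaurentSeries k) V') (_ : FiniteDimensional (LaurentSeries k) V')
      (e : V ≃ₗ[k] V'), (∀ w, coord k • e w = e (T w)) ∧
        adicTopology k V = (adicTopology k V').induced e := by
  obtain ⟨n, E, h, hGL, hLG⟩ := exists_TFilt b hm h1 h2 h3
  -- The new scalar action lives on the same additive group as the old one. Stating the comparison
  -- for a separate space `V'` keeps the two actions apart.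
  have key : ∀ (V' : Type v) [AddCommGroup V'] [Module k V'] [Module (LaurentSeries k) V']
      [IsScalarTower k (LaurentSeries k) V'] [FiniteDimensional (LaurentSeries k) V']
      (e : V ≃ₗ[k] V'), (∀ {ι : Type u} [Finite ι] (b' : Module.Basis ι (LaurentSeries k) V'),
        ∃ c : ℕ, (∀ j w, e w ∈ Lat b' j → w ∈ opFilt T (Lat b 0) (j - c)) ∧
          ∀ j w, w ∈ opFilt T (Lat b 0) j → e w ∈ Lat b' (j - c)) →
      adicTopology k V = (adicTopology k V').induced e := by
    intro V' _ _ _ _ _ e he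
    let b' := (Module.finBasis (LaurentSeries k) V').reindex
      (Equiv.ulift (α := Fin (Module.finrank (LaurentSeries k) V'))).symm
    obtain ⟨c', hc1, hc2⟩ := he b'
    refine adicTopology_eq_induced b b' e (fun N => ⟨c * (N + c'), fun l hl => ?_⟩)
      fun N => ⟨m * N + c', fun l hl => ?_⟩
    · have := hc2 _ _ (hLG (N + c') (by exact_mod_cast hl))
      simpa using this
    · refine hGL N ?_
      have := hc1 _ (e.symm l) (by simpa using hl)
      simpa using this
  let I1 := h.module
  let I2 := h.isScalarTower
  let I3 := h.finite
  refine ⟨V, inferInstance, inferInstance, I1, I2, I3, LinearEquiv.refl k V, ?_, ?_⟩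
  · intro w
    change h.act w (tpow k 1) = T w
    rw [h.act_tpow, zpow_one]
  · refine @key V _ _ I1 I2 I3 (LinearEquiv.refl k V) ?_
    intro ι _ b'
    obtain ⟨c', hc1, hc2⟩ := h.exists_bounds b'
    exact ⟨c', fun j w hw => hc1 j hw, fun j w hw => hc2 j hw⟩

end OperatorModule

/-! ### Continuity and linearity -/

section Continuity

variable {k : Type u} [Field k] {V : Type v} [AddCommGroup V] [Module k V]
  [Module (LaurentSeries k) V] [IsScalarTower k (LaurentSeries k) V]
  {V' : Type*} [AddCommGroup V'] [Module k V']
  [Module (LaurentSeries k) V'] [IsScalarTower k (LaurentSeries k) V']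
  {ι κ : Type*} [Finite ι]

lemma smul_smul_base (c : k) (f : LaurentSeries k) (w : V) : f • c • w = c • f • w := by
  rw [← C_smul c w, ← C_smul c, smul_smul, smul_smul, mul_comm]

/-- Continuous maps that are semilinear for monomials are semilinear. -/
lemma semilinear_of_coord (b : Module.Basis ι (LaurentSeries k) V)
    (b' : Module.Basis κ (LaurentSeries k) V') [Finite κ] (g : V →ₗ[k] V')
    (hg : ∀ N : ℤ, ∃ M : ℕ, ∀ w ∈ Lat b M, g w ∈ Lat b' N)
    (σ : LaurentSeries k →+* LaurentSeries k)
    (hσ : ∀ (c : k) f, σ (c • f) = c • σ f) (hσ' : ∀ {j f}, f ∈ ordGE k j → σ f ∈ ordGE k j)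
    (h : ∀ w, g (coord k • w) = σ (coord k) • g w) (f : LaurentSeries k) (w : V) :
    g (f • w) = σ f • g w := by
  let F : LaurentSeries k →ₗ[k] V' :=
    { toFun := fun f => g (f • w) - σ f • g w
      map_add' := fun f f' => by rw [add_smul, map_add, map_add, add_smul]; abel
      map_smul' := fun c f => by
        rw [smul_assoc, map_smul, hσ, smul_assoc, RingHom.id_apply, smul_sub] }
  refine sub_eq_zero.1 (eq_zero_of_tpow b' F ?_ ?_ f)
  · intro j
    have key : ∀ (n : ℕ) w, g (tpow k n • w) = σ (tpow k n) • g w := by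
      intro n
      induction n with
      | zero => intro w; simp
      | succ n ih =>
        intro w
        rw [Nat.cast_succ, add_comm, tpow_add, mul_smul, ← coord_eq_tpow, h, ih, map_mul, mul_smul]
    change g (tpow k j • w) - σ (tpow k j) • g w = 0
    rw [sub_eq_zero]
    obtain ⟨n, rfl | rfl⟩ := j.eq_nat_or_neg
    · exact key n w
    -- Negative powers follow from positive ones by cancelling `t ^ n`, since `σ (t ^ n)` is
    -- invertible.
    · have h1 := key n (tpow k (-n) • w)
      rw [smul_smul, tpow_mul_neg, one_smul] at h1
      rw [h1, smul_smul, ← map_mul, tpow_neg_mul, map_one, one_smul]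
  · intro N
    obtain ⟨M, hM⟩ := hg N
    obtain ⟨i, hi⟩ := exists_mem_Lat b w
    obtain ⟨i', hi'⟩ := exists_mem_Lat b' (g w)
    refine ⟨max (M - i) (N - i'), fun f hf => sub_mem (hM _ ?_) ?_⟩
    · exact smul_mem_Lat_of_le b hf hi (by have := le_max_left (M - i) (N - i'); omega)
    · exact smul_mem_Lat_of_le b' (hσ' hf) hi'
        (by have := le_max_right (M - i) (N - i'); omega)

lemma derivative_mem {j : ℤ} {f : LaurentSeries k} (hf : f ∈ ordGE k j) :
    LaurentSeries.derivative k f ∈ ordGE k (j - 1) := by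
  intro i hi
  rw [LaurentSeries.derivative_apply, LaurentSeries.hasseDeriv_coeff, hf _ (by push_cast; omega),
    smul_zero]

lemma coeff_derivative (f : LaurentSeries k) (i : ℤ) :
    (LaurentSeries.derivative k f).coeff i = (i + 1) * f.coeff (i + 1) := by
  rw [LaurentSeries.derivative_apply, LaurentSeries.hasseDeriv_coeff]
  simp

lemma derivative_tpow (j : ℤ) :
    LaurentSeries.derivative k (tpow k j) = (j : k) • tpow k (j - 1) := by
  ext i
  rw [coeff_derivative, coeff_tpow, HahnSeries.coeff_smul, coeff_tpow, smul_eq_mul]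
  by_cases h : i + 1 = j
  · rw [if_pos h, if_pos (by omega), ← h]; push_cast; ring
  · rw [if_neg h, if_neg (by omega)]; simp

/-- A continuous operator satisfying the commutation relation `[∇, t] = 1` is a connection. -/
lemma leibniz_of_coord (b : Module.Basis ι (LaurentSeries k) V) (D : V →ₗ[k] V)
    (hD : ∀ N : ℤ, ∃ M : ℕ, ∀ w ∈ Lat b M, D w ∈ Lat b N)
    (h : ∀ w, D (coord k • w) = coord k • D w + w) (f : LaurentSeries k) (w : V) :
    D (f • w) = f • D w + LaurentSeries.derivative k f • w := by
  let F : LaurentSeries k →ₗ[k] V :=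
    { toFun := fun f => D (f • w) - (f • D w + LaurentSeries.derivative k f • w)
      map_add' := fun f f' => by rw [add_smul, map_add, map_add, add_smul, add_smul]; abel
      map_smul' := fun c f => by
        rw [smul_assoc, D.map_smul, (LaurentSeries.derivative k).map_smul, smul_assoc, smul_assoc,
          RingHom.id_apply, smul_sub, smul_add] }
  refine sub_eq_zero.1 (eq_zero_of_tpow b F ?_ ?_ f)
  · intro j
    have key : ∀ (n : ℕ) w, D (tpow k n • w) = tpow k n • D w + (n : k) • tpow k (n - 1) • w := by
      intro n
      induction n with
      | zero => intro w; simp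
      | succ n ih =>
        intro w
        rw [Nat.cast_succ, add_comm, tpow_add, mul_smul, ← coord_eq_tpow, h, ih, smul_add,
          mul_smul, add_assoc, coord_eq_tpow, smul_smul_base, smul_smul (tpow k 1) (tpow k _) w,
          ← tpow_add 1 ((n : ℤ) - 1), show (1 : ℤ) + (n - 1) = n by ring, show (1 : ℤ) + n - 1 = n by ring]
        push_cast
        rw [add_smul, one_smul]
    change D (tpow k j • w) - (tpow k j • D w + LaurentSeries.derivative k (tpow k j) • w) = 0
    rw [sub_eq_zero, derivative_tpow, smul_assoc]
    obtain ⟨n, rfl | rfl⟩ := j.eq_nat_or_neg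
    · exact_mod_cast key n w
    · have h1 := key n (tpow k (-n) • w)
      rw [smul_smul, tpow_mul_neg, one_smul] at h1
      rw [h1, smul_add, smul_smul, tpow_neg_mul, one_smul, smul_smul_base,
        smul_smul, smul_smul, ← tpow_add, ← tpow_add]
      rw [show -(n : ℤ) + (n - 1) + -n = -n - 1 by ring]
      push_cast
      rw [neg_smul]
      abel
  · intro N
    obtain ⟨M, hM⟩ := hD N
    obtain ⟨i, hi⟩ := exists_mem_Lat b w
    obtain ⟨i', hi'⟩ := exists_mem_Lat b (D w)
    refine ⟨max (M - i) (max (N - i') (N - i + 1)), fun f hf => sub_mem (hM _ ?_)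
      (add_mem ?_ ?_)⟩
    · exact smul_mem_Lat_of_le b hf hi (by omega)
    · exact smul_mem_Lat_of_le b hf hi' (by omega)
    · exact smul_mem_Lat_of_le b (derivative_mem hf) hi (by omega)

end Continuity

/-! ### Scalar operators and bounds for twisted operators -/

lemma inv_mem_ordGE_zero {k : Type u} [Field k] {f : LaurentSeries k} (hf : f ∈ ordGE k 0)
    (h0 : f.coeff 0 ≠ 0) : f⁻¹ ∈ ordGE k 0 := by
  obtain ⟨p, rfl⟩ := mem_ordGE_zero.1 hf
  rw [coeff_zero_ofPowerSeries] at h0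
  rw [inv_eq_of_mul_eq_one_right (b := HahnSeries.ofPowerSeries ℤ k p⁻¹)]
  · exact ofPowerSeries_mem _
  · rw [← map_mul, PowerSeries.mul_inv_cancel p h0, map_one]

section SmulEnd

variable {k : Type u} [Field k] {V : Type v} [AddCommGroup V] [Module k V]
  [Module (LaurentSeries k) V] [IsScalarTower k (LaurentSeries k) V]

/-- Multiplication by a Laurent series as a `k`-linear endomorphism. -/
def smulEnd (V : Type v) [AddCommGroup V] [Module k V]
    [Module (LaurentSeries k) V] [IsScalarTower k (LaurentSeries k) V] (f : LaurentSeries k) :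
    V →ₗ[k] V where
  toFun w := f • w
  map_add' := smul_add f
  map_smul' c w := smul_smul_base c f w

/-- Multiplication by a nonzero Laurent series as a `k`-linear automorphism. -/
def smulEquiv (V : Type v) [AddCommGroup V] [Module k V]
    [Module (LaurentSeries k) V] [IsScalarTower k (LaurentSeries k) V] {f : LaurentSeries k}
    (hf : f ≠ 0) : V ≃ₗ[k] V :=
  { smulEnd V f with
    invFun := fun w => f⁻¹ • w
    left_inv := fun w => inv_smul_smul₀ hf w
    right_inv := fun w => smul_inv_smul₀ hf w }

lemma Twist.IsTwisted.exists_bound {τ : Twist k} {ι : Type*} [Finite ι]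
    (b : Module.Basis ι (LaurentSeries k) V) {B : V →ₗ[k] V} (hB : τ.IsTwisted B) :
    ∃ c : ℕ, ∀ j, ∀ w ∈ Lat b j, B w ∈ Lat b (j - c) := by
  cases nonempty_fintype ι
  choose J hJ using fun i => exists_mem_Lat b (B (b i))
  obtain ⟨m, hm⟩ := (Set.finite_range J).bddBelow
  refine ⟨(-m).toNat + (-τ.e).toNat, fun j w hw => ?_⟩
  rw [← b.sum_repr w, map_sum]
  refine Submodule.sum_mem _ fun i _ => ?_
  rw [hB]
  push_cast
  exact add_mem (smul_mem_Lat_of_le b (τ.sigma_mem (hw i)) (Lat_anti b (hm ⟨i, rfl⟩) (hJ i))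
    (by omega)) (smul_mem_Lat_of_le b (τ.nu_mem (hw i)) (basis_mem_Lat b i) (by omega))

end SmulEnd

/-! ### Connections as twisted operators -/

section Conn

variable {k : Type u} [Field k]

/-- The twist of `t ∇`, for a connection `∇`. -/
def connTwist (k : Type u) [Field k] : Twist k where
  sigma := RingHom.id _
  sigma_smul _ _ := rfl
  sigma_sub_mem _ := by simp
  nu := mulLin (tpow k 1) ∘ₗ LaurentSeries.derivative k
  e := 0
  nu_mem {j f} hf := mul_mem_of_le (tpow_mem 1) (derivative_mem hf) (by omega)

lemma connTwist_hasEuler : (connTwist k).HasEuler 1 := by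
  intro j f hf
  refine ⟨(connTwist k).nu_mem hf, ?_⟩
  change (tpow k 1 * LaurentSeries.derivative k f).coeff (j + 0) = _
  rw [coeff_tpow_mul, coeff_derivative]
  simp

/-- The operator `t ∇`. -/
def Conn.euler (E : Conn.{u, v} k) : E.V →ₗ[k] E.V := smulEnd E.V (tpow k 1) ∘ₗ E.nabla

lemma Conn.euler_apply (E : Conn.{u, v} k) (w : E.V) : E.euler w = tpow k 1 • E.nabla w := rfl

lemma Conn.isTwisted_euler (E : Conn.{u, v} k) : (connTwist k).IsTwisted E.euler := by
  intro f w
  rw [E.euler_apply, E.leibniz, smul_add, smul_comm, smul_smul (tpow k 1)]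
  rfl

end Conn

/-! ### The local Mellin transform: existence, uniqueness and full faithfulness -/

section Mellin

variable {k : Type u} [Field k]

lemma zFun_mem (x : k) : zFun x ∈ ordGE k 0 :=
  add_mem (C_mem x) (tpow_mem_of_le zero_le_one)

lemma coeff_zFun_zero (x : k) : (zFun x).coeff 0 = x := by
  rw [zFun, coord_eq_tpow, HahnSeries.coeff_add, coeff_tpow]
  simp

/-- The inverse `-(z∇)` of `θ`. -/
def Conn.invTheta (x : k) (E : Conn.{u, v} k) : E.V →ₗ[k] E.V := -(smulEnd E.V (zFun x) ∘ₗ E.nabla)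

lemma Conn.invTheta_apply (x : k) (E : Conn.{u, v} k) (w : E.V) :
    E.invTheta x w = -(zFun x • E.nabla w) := rfl

lemma zFun_ne_zero {x : k} (hx : x ≠ 0) : zFun x ≠ 0 := fun h => hx (by
  rw [← coeff_zFun_zero x, h, HahnSeries.coeff_zero])

variable [CharZero k]

lemma derivative_zFun (x : k) : LaurentSeries.derivative k (zFun x) = 1 := by
  ext i
  rw [coeff_derivative, zFun, coord_eq_tpow, HahnSeries.coeff_add, coeff_tpow,
    HahnSeries.C_apply, HahnSeries.coeff_single, HahnSeries.coeff_one]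
  by_cases h : i = 0
  · subst h; simp
  · rw [if_neg (by omega : ¬ i + 1 = 1), if_neg h]
    split_ifs with h'
    · have : (i : k) + 1 = 0 := by exact_mod_cast congrArg (Int.cast : ℤ → k) h'
      simp [this]
    · simp

lemma shift_coord : (1 + coord k) * shift k 1 (coord k) = coord k := by
  rw [coord_eq_tpow, shift_tpow, mul_left_comm]
  have h1 : onePow k 1 (-((1 : ℤ) : ℚ) / (1 : ℕ)) = (onePow k 1 1)⁻¹ := by
    rw [← onePow_neg]; norm_num
  have h2 := onePow_one (k := k) 1
  rw [Nat.cast_one] at h2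
  rw [h1, ← h2, mul_inv_cancel₀ (onePow_ne_zero 1 1), mul_one]

/-- This is the Leibniz rule for `z`, in the form `(θ⁻¹ + 1) Φ = Φ θ⁻¹`. Multiplied by `θ` on both
sides it is the semilinearity of `Φ` on the uniformizer. -/
lemma Conn.invTheta_smul (x : k) (E : Conn.{u, v} k) (w : E.V) :
    E.invTheta x (zFun x • w) + zFun x • w = zFun x • E.invTheta x w := by
  rw [E.invTheta_apply, E.invTheta_apply, E.leibniz, derivative_zFun, one_smul, smul_add, smul_neg]
  abel

/-- One has `θ = -(t∇)⁻¹ t z⁻¹` with `z` a unit because `x ≠ 0`. For connections the twist has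
degree `e = 0`, so a suitable lattice is preserved by `(t∇)⁻¹` with no loss, and the factor `t`
makes `θ` raise it by one. -/
lemma Conn.exists_invTheta_symm {x : k} (hx : x ≠ 0) {E : Conn.{u, v} k}
    (hE : noHorizontalSections k E) :
    ∃ (ι : Type) (_ : Finite ι) (b : Module.Basis ι (LaurentSeries k) E.V) (T : E.V ≃ₗ[k] E.V)
      (c : ℕ), (∀ w, T.symm w = E.invTheta x w) ∧ (∀ j, ∀ w ∈ Lat b j, T w ∈ Lat b (j + 1)) ∧
        ∀ j, ∀ w ∈ Lat b j, T.symm w ∈ Lat b (j - c) := by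
  obtain ⟨ι, hι, b, hb⟩ := E.isTwisted_euler.exists_bounded_inverse one_ne_zero
    connTwist_hasEuler le_rfl _ rfl (fun w hw => hE w (by
      rw [E.euler_apply] at hw
      exact (smul_eq_zero.1 hw).resolve_left (tpow_ne_zero 1)))
  have hz := zFun_ne_zero hx
  have hz' : (zFun x)⁻¹ ∈ ordGE k 0 :=
    inv_mem_ordGE_zero (zFun_mem x) (by rwa [coeff_zFun_zero])
  have hinj : Function.Injective (E.invTheta x) := by
    rw [← LinearMap.ker_eq_bot, LinearMap.ker_eq_bot']
    intro w hw
    rw [E.invTheta_apply, neg_eq_zero] at hw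
    exact hE w ((smul_eq_zero.1 hw).resolve_left hz)
  have hsurj : ∀ j, ∀ w ∈ Lat b j, ∃ u ∈ Lat b (j + 1), E.invTheta x u = w := by
    intro j w hw
    obtain ⟨u, hu, hu'⟩ := hb (j + 1) (tpow k 1 • -((zFun x)⁻¹ • w)) (by
      rw [tpow_smul_mem_Lat, add_sub_cancel_right]
      exact neg_mem (smul_mem_Lat_of_le b hz' hw (by omega)))
    refine ⟨u, by simpa [connTwist] using hu, ?_⟩
    rw [E.euler_apply] at hu'
    rw [E.invTheta_apply, smul_right_injective _ (tpow_ne_zero 1) hu', smul_neg, neg_neg,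
      smul_inv_smul₀ hz]
  obtain ⟨c, hc⟩ := E.isTwisted_euler.exists_bound b
  let S := LinearEquiv.ofBijective (E.invTheta x) ⟨hinj, fun w => by
    obtain ⟨j, hj⟩ := exists_mem_Lat b w
    obtain ⟨u, -, hu⟩ := hsurj j w hj
    exact ⟨u, hu⟩⟩
  refine ⟨ι, hι, b, S.symm, c + 1, fun w => rfl, fun j w hw => ?_, fun j w hw => ?_⟩
  · obtain ⟨u, hu, rfl⟩ := hsurj j w hw
    have : S.symm (E.invTheta x u) = u := S.symm_apply_apply u
    rwa [this]
  · change -(zFun x • E.nabla w) ∈ _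
    have h1 := hc j w hw
    rw [E.euler_apply, tpow_smul_mem_Lat] at h1
    exact neg_mem (smul_mem_Lat_of_le b (zFun_mem x) h1 (by push_cast; omega))

/-- The lattice of `Conn.exists_invTheta_symm` makes `θ` a uniformizer through
`exists_operator_module`. Multiplication by `z` is continuous, so its semilinearity over all of
`k((θ))` follows from the case of `θ`. -/
theorem exists_isMellin {x : k} (hx : x ≠ 0) (E : Conn.{u, v} k)
    (hE : noHorizontalSections k E) : ∃ (D : Diff.{u, v} k) (e : E.V ≃ₗ[k] D.V),
      IsMellin x E D e := by
  obtain ⟨ι, _, b, T, c, hT, h1, h2⟩ := Conn.exists_invTheta_symm hx hE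
  obtain ⟨V', _, _, _, _, _, e, he, htop⟩ := exists_operator_module b (m := 1) one_pos
    (fun j w hw => Lat_anti b (by omega) (h1 j w hw)) (by simpa using h1) h2
  let Phi : V' ≃ₗ[k] V' := e.symm.trans ((smulEquiv E.V (zFun_ne_zero hx)).trans e)
  have hPhi : ∀ w, Phi (e w) = e (zFun x • w) := fun w => by
    change e (zFun x • e.symm (e w)) = _
    rw [e.symm_apply_apply]
  let b' := Module.finBasis (LaurentSeries k) V'
  obtain ⟨hb1, hb2⟩ := bounds_of_adicTopology_eq b b' e htop
  have hsemi : ∀ (f : LaurentSeries k) w, Phi (f • w) = shift k 1 f • Phi w := by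
    refine semilinear_of_coord b' b' Phi.toLinearMap (fun N => ?_) (shift k 1) (shift_smul 1)
      (shift_mem 1) ?_
    · obtain ⟨M, hM⟩ := hb1 N
      obtain ⟨M', hM'⟩ := hb2 M
      exact ⟨M', fun w hw => hM _ (smul_mem_Lat_of_le b (zFun_mem x) (hM' w hw) (by omega))⟩
    · intro w
      obtain ⟨v, rfl⟩ := e.surjective w
      obtain ⟨y, rfl⟩ := T.symm.surjective v
      -- As `(1 + θ) φ(θ) = θ`, multiplication by the nonzero series `1 + θ` turns the claim into
      -- `(1 + θ) Φ θ = θ Φ`, which is `Conn.invTheta_smul`.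
      have hne : (1 + coord k : LaurentSeries k) ≠ 0 := fun h => by
        have := shift_coord (k := k)
        rw [h, zero_mul] at this
        exact tpow_ne_zero 1 this.symm
      refine smul_right_injective _ hne ?_
      change (1 + coord k) • Phi _ = (1 + coord k) • shift k 1 (coord k) • Phi _
      rw [smul_smul, shift_coord, he, T.apply_symm_apply, hPhi, hPhi, add_smul, one_smul, he, he,
        ← map_add]
      congr 1
      refine T.symm.injective ?_
      rw [map_add, T.symm_apply_apply, T.symm_apply_apply, hT, hT, E.invTheta_smul]
  refine ⟨⟨V', Phi, hsemi⟩, e, ⟨fun w => ?_, hPhi, htop⟩⟩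
  change coord k • e (E.invTheta x w) = e w
  rw [he, ← hT, T.apply_symm_apply]

lemma IsMellin.exists_preimage {x : k} {E : Conn.{u, v} k} {D : Diff.{u, v} k}
    {e : E.V ≃ₗ[k] D.V} (h : IsMellin x E D e) (w : E.V) :
    ∃ y, w = -(zFun x • E.nabla y) ∧ coord k • e w = e y := by
  obtain ⟨y, hy⟩ := e.surjective (coord k • e w)
  refine ⟨y, e.injective ?_, hy.symm⟩
  have h1 := h.theta y
  rw [hy] at h1
  exact (smul_right_injective _ (tpow_ne_zero 1) h1).symm

/-- A horizontal map commutes with `z∇`, hence with `θ`. It is continuous for the common topologies,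
so it is linear over `k((θ))`. -/
lemma IsMellin.exists_hom {x : k} {E₁ E₂ : Conn.{u, v} k} {D₁ D₂ : Diff.{u, v} k}
    {e₁ : E₁.V ≃ₗ[k] D₁.V} {e₂ : E₂.V ≃ₗ[k] D₂.V} (h₁ : IsMellin x E₁ D₁ e₁)
    (h₂ : IsMellin x E₂ D₂ e₂) (f : E₁ ⟶ E₂) :
    ∃ g : D₁ ⟶ D₂, ∀ w, Diff.Hom.map g (e₁ w) = e₂ (Conn.Hom.map f w) := by
  let F : E₁.V →ₗ[k] E₂.V := (Conn.Hom.map f).restrictScalars k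
  let G : D₁.V →ₗ[k] D₂.V := e₂.toLinearMap ∘ₗ F ∘ₗ e₁.symm.toLinearMap
  have hG : ∀ w, G (e₁ w) = e₂ (Conn.Hom.map f w) := fun w => by
    change e₂ (Conn.Hom.map f (e₁.symm (e₁ w))) = _
    rw [e₁.symm_apply_apply]
  let b₁ := Module.finBasis (LaurentSeries k) E₁.V
  let b₂ := Module.finBasis (LaurentSeries k) E₂.V
  let b₁' := Module.finBasis (LaurentSeries k) D₁.V
  let b₂' := Module.finBasis (LaurentSeries k) D₂.V
  have hlin : ∀ (f : LaurentSeries k) w, G (f • w) = f • G w := by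
    refine semilinear_of_coord b₁' b₂' G (fun N => ?_) (RingHom.id _) (fun _ _ => rfl)
      (fun hf => hf) fun w => ?_
    · obtain ⟨M, hM⟩ := (bounds_of_adicTopology_eq b₂ b₂' e₂ h₂.topology).1 N
      obtain ⟨c, hc⟩ := exists_bound_linearMap b₁ b₂ (Conn.Hom.map f)
      obtain ⟨M', hM'⟩ := (bounds_of_adicTopology_eq b₁ b₁' e₁ h₁.topology).2 (M + c)
      refine ⟨M', fun w hw => hM _ ?_⟩
      have := hc _ _ (hM' w hw)
      rwa [add_sub_cancel_right] at this
    · obtain ⟨v, rfl⟩ := e₁.surjective w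
      obtain ⟨y, hy, hy'⟩ := h₁.exists_preimage v
      rw [hy', hG, hG, hy, map_neg, map_smul, Conn.Hom.comm, RingHom.id_apply]
      exact (h₂.theta _).symm
  refine ⟨⟨⟨⟨G, G.map_add⟩, hlin⟩, fun w => ?_⟩, hG⟩
  obtain ⟨v, rfl⟩ := e₁.surjective w
  change G _ = D₂.Phi (G _)
  rw [h₁.phi, hG, hG, h₂.phi, map_smul]

/-- A map commuting with `Φ` commutes with `z`, hence with `z_x = z - x`, and by continuity is
linear over `k((z_x))`. Commutation with `θ` gives commutation with `z∇`, and `z` can be cancelled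
as `x ≠ 0`. -/
lemma IsMellin.exists_preimage_hom {x : k} (hx : x ≠ 0) {E₁ E₂ : Conn.{u, v} k}
    {D₁ D₂ : Diff.{u, v} k}
    {e₁ : E₁.V ≃ₗ[k] D₁.V} {e₂ : E₂.V ≃ₗ[k] D₂.V} (h₁ : IsMellin x E₁ D₁ e₁)
    (h₂ : IsMellin x E₂ D₂ e₂) (g : D₁ ⟶ D₂) :
    ∃ f : E₁ ⟶ E₂, ∀ w, Diff.Hom.map g (e₁ w) = e₂ (Conn.Hom.map f w) := by
  let G : D₁.V →ₗ[k] D₂.V := (Diff.Hom.map g).restrictScalars k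
  let F : E₁.V →ₗ[k] E₂.V := e₂.symm.toLinearMap ∘ₗ G ∘ₗ e₁.toLinearMap
  have hF : ∀ w, e₂ (F w) = Diff.Hom.map g (e₁ w) := fun w => by
    change e₂ (e₂.symm (Diff.Hom.map g (e₁ w))) = _
    rw [e₂.apply_symm_apply]
  let b₁ := Module.finBasis (LaurentSeries k) E₁.V
  let b₂ := Module.finBasis (LaurentSeries k) E₂.V
  let b₁' := Module.finBasis (LaurentSeries k) D₁.V
  let b₂' := Module.finBasis (LaurentSeries k) D₂.V
  have hz : ∀ w, F (zFun x • w) = zFun x • F w := fun w => e₂.injective (by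
    rw [hF, ← h₁.phi, Diff.Hom.comm, ← hF, h₂.phi])
  have hlin : ∀ (f : LaurentSeries k) w, F (f • w) = f • F w := by
    refine semilinear_of_coord b₁ b₂ F (fun N => ?_) (RingHom.id _) (fun _ _ => rfl)
      (fun hf => hf) fun w => ?_
    · obtain ⟨M, hM⟩ := (bounds_of_adicTopology_eq b₂ b₂' e₂ h₂.topology).2 N
      obtain ⟨c, hc⟩ := exists_bound_linearMap b₁' b₂' (Diff.Hom.map g)
      obtain ⟨M', hM'⟩ := (bounds_of_adicTopology_eq b₁ b₁' e₁ h₁.topology).1 (M + c)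
      refine ⟨M', fun w hw => hM _ ?_⟩
      have := hc _ _ (hM' w hw)
      rwa [add_sub_cancel_right] at this
    · have := hz w
      rw [zFun, add_smul, add_smul, map_add, C_smul, C_smul, map_smul] at this
      exact add_left_cancel this
  refine ⟨⟨⟨⟨F, F.map_add⟩, hlin⟩, fun w => ?_⟩, fun w => (hF w).symm⟩
  change F _ = E₂.nabla (F w)
  refine smul_right_injective _ (zFun_ne_zero hx) (neg_injective (e₂.injective ?_))
  refine smul_right_injective _ (tpow_ne_zero 1 : coord k ≠ 0) ?_
  change coord k • e₂ (-(zFun x • F (E₁.nabla w))) = coord k • e₂ (-(zFun x • E₂.nabla (F w)))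
  rw [h₂.theta, hF, ← hz, ← map_neg F, hF, ← map_smul, h₁.theta]

lemma IsMellin.hom_ext {x : k} {E : Conn.{u, v} k} {D₁ D₂ : Diff.{u, v} k}
    {e : E.V ≃ₗ[k] D₁.V} (_h : IsMellin x E D₁ e) {g g' : D₁ ⟶ D₂}
    (hg : ∀ w, Diff.Hom.map g (e w) = Diff.Hom.map g' (e w)) : g = g' := by
  refine Diff.Hom.ext (LinearMap.ext fun w => ?_)
  obtain ⟨v, rfl⟩ := e.surjective w
  exact hg v

/-- Two Mellin transforms of the same connection are isomorphic. -/
lemma IsMellin.exists_iso {x : k} {E : Conn.{u, v} k} {D₁ D₂ : Diff.{u, v} k}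
    {e₁ : E.V ≃ₗ[k] D₁.V} {e₂ : E.V ≃ₗ[k] D₂.V} (h₁ : IsMellin x E D₁ e₁)
    (h₂ : IsMellin x E D₂ e₂) : ∃ α : D₁ ≅ D₂, ∀ w, Diff.Hom.map α.hom (e₁ w) = e₂ w := by
  obtain ⟨g, hg⟩ := h₁.exists_hom h₂ (𝟙 E)
  obtain ⟨g', hg'⟩ := h₂.exists_hom h₁ (𝟙 E)
  replace hg : ∀ w, Diff.Hom.map g (e₁ w) = e₂ w := hg
  replace hg' : ∀ w, Diff.Hom.map g' (e₂ w) = e₁ w := hg'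
  refine ⟨⟨g, g', h₁.hom_ext fun w => ?_, h₂.hom_ext fun w => ?_⟩, hg⟩
  · change Diff.Hom.map g' (Diff.Hom.map g (e₁ w)) = e₁ w
    rw [hg, hg']
  · change Diff.Hom.map g (Diff.Hom.map g' (e₂ w)) = e₂ w
    rw [hg', hg]

theorem nonempty_transform {x : k} (hx : x ≠ 0) : Nonempty (Transform.{u, v} x) := by
  choose D e h using fun E : (noHorizontalSections.{u, v} k).FullSubcategory =>
    exists_isMellin hx E.obj E.property
  choose F hF using fun (E₁ E₂ : (noHorizontalSections.{u, v} k).FullSubcategory)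
    (f : E₁ ⟶ E₂) => (h E₁).exists_hom (h E₂) f.hom
  refine ⟨⟨⟨D, fun {E₁ E₂} f => F E₁ E₂ f, fun E => ?_, fun {E₁ E₂ E₃} f g => ?_⟩, e, h,
    fun {E₁ E₂} f => hF E₁ E₂ f⟩⟩
  · exact (h E).hom_ext fun w => hF _ _ _ w
  · refine (h E₁).hom_ext fun w => ?_
    change _ = Diff.Hom.map (F E₂ E₃ g) (Diff.Hom.map (F E₁ E₂ f) (e E₁ w))
    rw [hF, hF, hF]
    rfl

theorem Transform.exists_iso {x : k} (M M' : Transform.{u, v} x) :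
    ∃ α : M.functor ≅ M'.functor,
      ∀ E w, Diff.Hom.map (α.hom.app E) (M.ident E w) = M'.ident E w := by
  choose α hα using fun E => (M.isMellin E).exists_iso (M'.isMellin E)
  refine ⟨NatIso.ofComponents α fun {E₁ E₂} f => (M.isMellin E₁).hom_ext fun w => ?_, hα⟩
  change Diff.Hom.map (α E₂).hom (Diff.Hom.map (M.functor.map f) (M.ident E₁ w)) =
    Diff.Hom.map (M'.functor.map f) (Diff.Hom.map (α E₁).hom (M.ident E₁ w))
  rw [hα, M.map_ident, hα, M'.map_ident]

lemma Transform.faithful {x : k} (M : Transform.{u, v} x) : M.functor.Faithful where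
  map_injective {E₁ E₂ f g} h := by
    refine ObjectProperty.hom_ext _ (Conn.Hom.ext (LinearMap.ext fun w => ?_))
    refine (M.ident E₂).injective ?_
    rw [← M.map_ident, ← M.map_ident, h]

lemma Transform.full {x : k} (hx : x ≠ 0) (M : Transform.{u, v} x) : M.functor.Full where
  map_surjective {E₁ E₂} g := by
    obtain ⟨f, hf⟩ := (M.isMellin E₁).exists_preimage_hom hx (M.isMellin E₂) g
    refine ⟨ObjectProperty.homMk f, (M.isMellin E₁).hom_ext fun w => ?_⟩
    rw [M.map_ident, hf]
    rfl

end Mellin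

/-! ### Difference operators as twisted operators -/

section DiffOp

variable {k : Type u} [Field k] {V : Type v} [AddCommGroup V] [Module k V]
  [Module (LaurentSeries k) V] [IsScalarTower k (LaurentSeries k) V]

/-- The operator `t ^ (-r) (Φ - h)`. -/
def diffOp (Φ : V →ₗ[k] V) (r : ℤ) (h : LaurentSeries k) : V →ₗ[k] V :=
  smulEnd V (tpow k (-r)) ∘ₗ (Φ - smulEnd V h)

lemma diffOp_apply (Φ : V →ₗ[k] V) (r : ℤ) (h : LaurentSeries k) (w : V) :
    diffOp Φ r h w = tpow k (-r) • (Φ w - h • w) := rfl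

end DiffOp

section DiffTwist

variable {k : Type u} [Field k] [CharZero k]

/-- The twist of `t ^ (-r) (Φ - h)`, for a difference operator `Φ` over `k((t))`, where
`t = θ ^ (1/q)`. -/
def diffTwist (q : ℕ) [NeZero q] (r : ℤ) {c : ℤ} {h : LaurentSeries k} (hh : h ∈ ordGE k c) : Twist k where
  sigma := shift k q
  sigma_smul := shift_smul q
  sigma_sub_mem hf := ordGE_anti (by have := NeZero.pos q; omega) (shift_sub_mem q hf)
  nu := mulLin (tpow k (-r) * h) ∘ₗ (shiftLin k q - LinearMap.id)
  e := q + c - r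
  nu_mem {j f} hf := mul_mem_of_le (mul_mem_of_le (l := c - r) (tpow_mem (-r)) hh (by omega))
    (shift_sub_mem q hf) (by omega)

/-- The factor `φ - 1` contributes `-j/q` in degree `q`, and the leading coefficient of `h` the
rest. The operator is therefore nondegenerate precisely when `h` has nonzero coefficient in degree
`c`. -/
lemma diffTwist_hasEuler (q : ℕ) [NeZero q] (r : ℤ) {c : ℤ} {h : LaurentSeries k} (hh : h ∈ ordGE k c) :
    (diffTwist q r hh).HasEuler (-h.coeff c / q) := by
  intro j f hf
  refine ⟨(diffTwist q r hh).nu_mem hf, ?_⟩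
  obtain ⟨h1, h2⟩ := shift_sub_spec q hf
  change ((tpow k (-r) * h) * (shift k q f - f)).coeff (j + (q + c - r)) = _
  rw [mul_assoc, coeff_tpow_mul, show j + (q + c - r) - -r = c + (j + (q : ℤ)) by ring,
    coeff_mul_ordGE hh h1, h2]
  simp
  ring

variable {V : Type v} [AddCommGroup V] [Module k V]
  [Module (LaurentSeries k) V] [IsScalarTower k (LaurentSeries k) V]

lemma isTwisted_diffOp (q : ℕ) [NeZero q] {Φ : V →ₗ[k] V}
    (hΦ : ∀ (f : LaurentSeries k) w, Φ (f • w) = shift k q f • Φ w) (r : ℤ)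
    {c : ℤ} {h : LaurentSeries k} (hh : h ∈ ordGE k c) : (diffTwist q r hh).IsTwisted (diffOp Φ r h) := by
  intro f w
  change tpow k (-r) • (Φ (f • w) - h • f • w) = shift k q f • tpow k (-r) • (Φ w - h • w) +
    ((tpow k (-r) * h) * (shift k q f - f)) • w
  have h1 : shift k q f * tpow k (-r) * h = tpow k (-r) * h * shift k q f := by ring
  rw [hΦ]
  simp only [smul_sub, smul_smul, mul_sub, sub_smul, ← mul_assoc]
  rw [h1, mul_comm (shift k q f)]
  abel

/-- The automorphism `φ` has an inverse. -/
lemma exists_shift_eq (q : ℕ) [NeZero q] {j : ℤ} {g : LaurentSeries k} (hg : g ∈ ordGE k j) :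
    ∃ f ∈ ordGE k j, shift k q f = g :=
  (diffTwist q 0 (one_mem_ordGE (k := k))).exists_sigma_eq hg

lemma exists_shift_eq' (q : ℕ) [NeZero q] (g : LaurentSeries k) : ∃ f, shift k q f = g := by
  obtain ⟨j, hj⟩ := exists_mem_ordGE g
  obtain ⟨f, -, hf⟩ := exists_shift_eq q hj
  exact ⟨f, hf⟩

lemma semilinear_exists_bound (q : ℕ) [NeZero q] {V' : Type*} [AddCommGroup V'] [Module k V']
    [Module (LaurentSeries k) V'] [IsScalarTower k (LaurentSeries k) V']
    {ι κ : Type*} [Finite ι] [Finite κ]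
    (b : Module.Basis ι (LaurentSeries k) V) (b' : Module.Basis κ (LaurentSeries k) V')
    (g : V →ₗ[k] V') (hg : ∀ (f : LaurentSeries k) w, g (f • w) = shift k q f • g w) :
    ∃ c : ℕ, ∀ j, ∀ w ∈ Lat b j, g w ∈ Lat b' (j - c) :=
  Twist.IsTwisted.section_mem (τ := diffTwist q 0 (one_mem_ordGE (k := k))) b b' g hg

lemma semilinear_symm_exists_bound (q : ℕ) [NeZero q] {ι : Type*} [Finite ι]
    (b : Module.Basis ι (LaurentSeries k) V) (Φ : V ≃ₗ[k] V)
    (hΦ : ∀ (f : LaurentSeries k) w, Φ (f • w) = shift k q f • Φ w) :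
    ∃ c : ℕ, ∀ j, ∀ w ∈ Lat b j, Φ.symm w ∈ Lat b (j - c) := by
  cases nonempty_fintype ι
  choose J hJ using fun i => exists_mem_Lat b (Φ.symm (b i))
  obtain ⟨m, hm⟩ := (Set.finite_range J).bddBelow
  refine ⟨(-m).toNat, fun j w hw => ?_⟩
  rw [← b.sum_repr w, map_sum]
  refine Submodule.sum_mem _ fun i _ => ?_
  obtain ⟨f, hf, hf'⟩ := exists_shift_eq q (hw i)
  rw [← hf', show shift k q f • b i = Φ (f • Φ.symm (b i)) by rw [hΦ, Φ.apply_symm_apply],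
    Φ.symm_apply_apply]
  exact smul_mem_Lat_of_le b hf (Lat_anti b (hm ⟨i, rfl⟩) (hJ i)) (by omega)

/-- The shift is bijective on scalars, so an injective semilinear map carries a basis to a linearly
independent family of full cardinality and every combination of its images is itself an image. -/
lemma semilinear_surjective (q : ℕ) [NeZero q] {V : Type v} [AddCommGroup V] [Module k V]
    [Module (LaurentSeries k) V] [FiniteDimensional (LaurentSeries k) V]
    {Φ : V →ₗ[k] V}
    (hΦ : ∀ (f : LaurentSeries k) w, Φ (f • w) = shift k q f • Φ w)
    (hinj : Function.Injective Φ) : Function.Surjective Φ := by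
  let b := Module.finBasis (LaurentSeries k) V
  choose s hs using exists_shift_eq' (k := k) q
  have hsum : ∀ f : Fin _ → LaurentSeries k,
      ∑ i, f i • Φ (b i) = Φ (∑ i, s (f i) • b i) := fun f => by
    rw [map_sum]
    exact Finset.sum_congr rfl fun i _ => by rw [hΦ, hs]
  have hli : LinearIndependent (LaurentSeries k) fun i => Φ (b i) := by
    rw [Fintype.linearIndependent_iff]
    intro f hf i
    rw [hsum, ← map_zero Φ] at hf
    have := (Fintype.linearIndependent_iff.1 b.linearIndependent) _ (hinj hf) i
    rw [← hs (f i), this, map_zero]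
  have hspan := hli.span_eq_top_of_card_eq_finrank' (by simp)
  intro w
  obtain ⟨f, hf⟩ := (Submodule.mem_span_range_iff_exists_fun _).1
    (hspan ▸ Submodule.mem_top : w ∈ Submodule.span (LaurentSeries k) (Set.range fun i => Φ (b i)))
  exact ⟨_, by rw [← hsum, hf]⟩

end DiffTwist

/-! ### The inverse transform -/

section InverseMellin

variable {k : Type u} [Field k] [CharZero k]

/-- The operator `N` is topologically nilpotent and preserves a lattice. -/
def HasGoodLattice {V : Type v} [AddCommGroup V] [Module k V]
    [Module (LaurentSeries k) V] [IsScalarTower k (LaurentSeries k) V] (N : V →ₗ[k] V) : Prop :=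
  ∃ (ι : Type) (_ : Finite ι) (b : Module.Basis ι (LaurentSeries k) V) (m : ℕ), 0 < m ∧
    (∀ j, ∀ w ∈ Lat b j, N w ∈ Lat b j) ∧ ∀ j, ∀ w ∈ Lat b j, (N ^ m) w ∈ Lat b (j + 1)

/-- The operator `Φ - x`. -/
def Diff.subScalar (D : Diff.{u, v} k) (x : k) : D.V →ₗ[k] D.V :=
  D.Phi.toLinearMap - x • LinearMap.id

lemma Diff.subScalar_apply (D : Diff.{u, v} k) (x : k) (w : D.V) :
    D.subScalar x w = D.Phi w - x • w := rfl

lemma Diff.subScalar_eq_diffOp (D : Diff.{u, v} k) (x : k) :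
    D.subScalar x = diffOp D.Phi.toLinearMap 0 (HahnSeries.C x) := by
  ext w
  rw [diffOp_apply, D.subScalar_apply, neg_zero, tpow_zero, one_smul, C_smul]
  rfl

/-- The inverse of the local Mellin transform. -/
theorem exists_isMellin_of_hasGoodLattice {x : k} (hx : x ≠ 0) (D : Diff.{u, v} k)
    (hD : HasGoodLattice (D.subScalar x)) (hbij : Function.Bijective (D.subScalar x)) :
    ∃ (E : Conn.{u, v} k) (e : E.V ≃ₗ[k] D.V), noHorizontalSections k E ∧ IsMellin x E D e := by
  obtain ⟨ι, _, b, m, hm, h1, h2⟩ := hD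
  let T := LinearEquiv.ofBijective (D.subScalar x) hbij
  have hT : ∀ w, T w = D.Phi w - x • w := fun w => rfl
  have hTm : ∀ (n : ℕ) w, (T ^ n) w = (D.subScalar x ^ n) w := by
    intro n
    induction n with
    | zero => intro w; rfl
    | succ n ih => intro w; rw [pow_succ', pow_succ', LinearEquiv.mul_apply, ih]; rfl
  obtain ⟨c, hc⟩ : ∃ c : ℕ, ∀ j, ∀ w ∈ Lat b j, T.symm w ∈ Lat b (j - c) := by
    have htw := isTwisted_diffOp 1 D.semilinear 0 (C_mem x)
    -- The leading coefficient of `h = x` is where `x ≠ 0` enters. The twist of `Φ - x` has degree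
    -- `1`, so inverting it loses at most `dim V` powers of `θ` on the adapted lattice; only
    -- boundedness matters here.
    have hγ : -(HahnSeries.C x : LaurentSeries k).coeff 0 / (1 : ℕ) ≠ 0 := by simpa using hx
    obtain ⟨ι', _, b', hb'⟩ := htw.exists_bounded_inverse hγ (diffTwist_hasEuler 1 0 (C_mem x))
      (by simp [diffTwist]) _ rfl (fun w hw => hbij.1 (by
        rw [map_zero, D.subScalar_eq_diffOp]; exact hw))
    obtain ⟨c₁, hc₁⟩ := exists_Lat_le b b'
    obtain ⟨c₂, hc₂⟩ := exists_Lat_le b' b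
    refine ⟨c₁ + Module.finrank (LaurentSeries k) D.V + c₂, fun j w hw => ?_⟩
    obtain ⟨u, hu, huw⟩ := hb' _ w (hc₁ j hw)
    have h3 : T.symm w = u := by
      rw [LinearEquiv.symm_apply_eq, ← huw]
      exact (LinearMap.congr_fun (D.subScalar_eq_diffOp x) u).symm
    rw [h3]
    refine Lat_anti b ?_ (hc₂ _ hu)
    simp only [diffTwist]
    push_cast
    omega
  obtain ⟨V', _, _, _, _, _, e, he, htop⟩ := exists_operator_module b hm (T := T) h1
    (fun j w hw => by rw [hTm]; exact h2 j w hw) hc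
  -- Solving `θ = -(z∇)⁻¹` with `z = Φ` gives `∇ = -Φ⁻¹ θ⁻¹`.
  let Δ : D.V →ₗ[k] D.V := -(D.Phi.symm.toLinearMap ∘ₗ smulEnd D.V (tpow k (-1)))
  have hΔ : ∀ w, Δ w = -D.Phi.symm (tpow k (-1) • w) := fun w => rfl
  let nabla : V' →ₗ[k] V' := e.toLinearMap ∘ₗ Δ ∘ₗ e.symm.toLinearMap
  have hnabla : ∀ w, nabla (e w) = e (Δ w) := fun w => by
    change e (Δ (e.symm (e w))) = _
    rw [e.symm_apply_apply]
  let b' := Module.finBasis (LaurentSeries k) V'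
  obtain ⟨hb1, hb2⟩ := bounds_of_adicTopology_eq b b' e htop
  have hshift : ∀ w, D.Phi (tpow k (-1) • w) = tpow k (-1) • D.Phi w + D.Phi w := by
    intro w
    rw [D.semilinear, shift_tpow]
    have h3 : onePow k 1 (-((-1 : ℤ) : ℚ) / (1 : ℕ)) = 1 + tpow k 1 := by
      rw [show (-((-1 : ℤ) : ℚ) / (1 : ℕ)) = 1 by norm_num, onePow_one, Nat.cast_one]
    rw [h3, mul_add, mul_one, tpow_neg_mul, add_smul, one_smul]
  -- After applying `Φ`, the relation `[∇, z_x] = 1` becomes `Φ θ⁻¹ = (θ⁻¹ + 1) Φ`, which is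
  -- `hshift`.
  have hcomm : ∀ w, Δ (T w) = T (Δ w) + w := by
    intro w
    refine D.Phi.injective ?_
    simp only [hΔ, hT, map_neg, map_sub, map_add, D.Phi.apply_symm_apply, D.Phi.map_smul,
      smul_neg, smul_sub, smul_smul_base, hshift]
    abel
  have hleib : ∀ (f : LaurentSeries k) w,
      nabla (f • w) = f • nabla w + LaurentSeries.derivative k f • w := by
    refine leibniz_of_coord b' nabla (fun N => ?_) fun w => ?_
    · obtain ⟨M, hM⟩ := hb1 N
      obtain ⟨c', hc'⟩ := semilinear_symm_exists_bound 1 b D.Phi D.semilinear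
      obtain ⟨M', hM'⟩ := hb2 (M + c' + 1)
      refine ⟨M', fun w hw => hM _ (neg_mem ?_)⟩
      have h3 := hc' (M + c') _ (smul_mem_Lat_of_le b (tpow_mem (-1)) (hM' w hw) (by omega))
      rwa [add_sub_cancel_right] at h3
    · obtain ⟨v, rfl⟩ := e.surjective w
      rw [he, hnabla, hnabla, he, ← map_add, hcomm]
  have hz : ∀ w, zFun x • e w = e (D.Phi w) := fun w => by
    rw [zFun, add_smul, C_smul, he, ← map_smul, ← map_add, hT, add_sub_cancel]
  refine ⟨⟨V', nabla, hleib⟩, e.symm, fun w hw => ?_, fun w => ?_, fun w => ?_, ?_⟩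
  · obtain ⟨v, rfl⟩ := e.surjective w
    change nabla (e v) = 0 at hw
    rw [hnabla, LinearEquiv.map_eq_zero_iff, hΔ, neg_eq_zero, LinearEquiv.map_eq_zero_iff] at hw
    rw [(smul_eq_zero.1 hw).resolve_left (tpow_ne_zero _), map_zero]
  · obtain ⟨v, rfl⟩ := e.surjective w
    change coord k • e.symm (-(zFun x • nabla (e v))) = e.symm (e v)
    rw [hnabla, hz, hΔ, map_neg D.Phi, D.Phi.apply_symm_apply, map_neg e, neg_neg,
      e.symm_apply_apply, e.symm_apply_apply, smul_smul, coord_eq_tpow, tpow_mul_neg, one_smul]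
  · obtain ⟨v, rfl⟩ := e.surjective w
    change D.Phi (e.symm (e v)) = e.symm (zFun x • e v)
    rw [hz, e.symm_apply_apply, e.symm_apply_apply]
  · change adicTopology k V' = (adicTopology k D.V).induced e.symm
    rw [htop, induced_compose, show (e ∘ e.symm : V' → V') = id from funext e.apply_symm_apply]
    exact (@induced_id _ (adicTopology k V')).symm

end InverseMellin

/-! ### Subobjects and quotients of difference operators -/

section SubQuot

variable {k : Type u} [Field k] [CharZero k]

/-- The restriction of the difference operator to a stable subspace. -/
def Diff.subOp (D : Diff.{u, v} k) (W : Submodule (LaurentSeries k) D.V)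
    (hW : ∀ w ∈ W, D.Phi w ∈ W) : W →ₗ[k] W :=
  D.Phi.toLinearMap.restrict (p := W.restrictScalars k) (q := W.restrictScalars k) hW

lemma Diff.subOp_smul (D : Diff.{u, v} k) (W : Submodule (LaurentSeries k) D.V)
    (hW : ∀ w ∈ W, D.Phi w ∈ W) (f : LaurentSeries k) (w : W) :
    D.subOp W hW (f • w) = shift k 1 f • D.subOp W hW w :=
  Subtype.ext (D.semilinear f w)

lemma Diff.subOp_bijective (D : Diff.{u, v} k) (W : Submodule (LaurentSeries k) D.V)
    (hW : ∀ w ∈ W, D.Phi w ∈ W) : Function.Bijective (D.subOp W hW) := by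
  have hinj : Function.Injective (D.subOp W hW) := fun _ _ h =>
    Subtype.ext (D.Phi.injective (congrArg Subtype.val h))
  exact ⟨hinj, semilinear_surjective 1 (D.subOp_smul W hW) hinj⟩

/-- The subobject on a stable subspace. -/
def Diff.sub (D : Diff.{u, v} k) (W : Submodule (LaurentSeries k) D.V)
    (hW : ∀ w ∈ W, D.Phi w ∈ W) : Diff.{u, v} k where
  V := W
  Phi := LinearEquiv.ofBijective (D.subOp W hW) (D.subOp_bijective W hW)
  semilinear := D.subOp_smul W hW

/-- The inclusion of a subobject. -/
def Diff.subHom (D : Diff.{u, v} k) (W : Submodule (LaurentSeries k) D.V)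
    (hW : ∀ w ∈ W, D.Phi w ∈ W) : D.sub W hW ⟶ D :=
  Diff.Hom.mk (D₁ := D.sub W hW) (D₂ := D) W.subtype fun _ => rfl

lemma Diff.exists_mem_Phi_eq (D : Diff.{u, v} k) {W : Submodule (LaurentSeries k) D.V}
    (hW : ∀ w ∈ W, D.Phi w ∈ W) {w : D.V} (hw : D.Phi w ∈ W) : w ∈ W := by
  obtain ⟨y, hy⟩ := (D.subOp_bijective W hW).2 ⟨D.Phi w, hw⟩
  rw [← D.Phi.injective (congrArg Subtype.val hy : D.Phi (y : D.V) = D.Phi w)]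
  exact y.2

/-- The quotient by a stable subspace. -/
def Diff.quot (D : Diff.{u, v} k) (W : Submodule (LaurentSeries k) D.V)
    (hW : ∀ w ∈ W, D.Phi w ∈ W) : Diff.{u, v} k :=
  have hs := (exists_splitting W).choose_spec.choose_spec.2.2.1
  let Φ : (D.V ⧸ W) →ₗ[k] (D.V ⧸ W) :=
    quotOp (exists_splitting W).choose_spec.choose D.Phi.toLinearMap
  have hΦ : ∀ v, Φ (W.mkQ v) = W.mkQ (D.Phi v) := quotOp_mkQ hs hW
  { V := D.V ⧸ W
    Phi := LinearEquiv.ofBijective Φ ⟨by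
      rw [← LinearMap.ker_eq_bot, LinearMap.ker_eq_bot']
      intro y hy
      obtain ⟨v, rfl⟩ := W.mkQ_surjective y
      rw [hΦ, Submodule.mkQ_apply, Submodule.Quotient.mk_eq_zero] at hy
      rw [Submodule.mkQ_apply, Submodule.Quotient.mk_eq_zero]
      exact D.exists_mem_Phi_eq hW hy, fun y => by
      obtain ⟨v, rfl⟩ := W.mkQ_surjective y
      exact ⟨W.mkQ (D.Phi.symm v), by rw [hΦ, D.Phi.apply_symm_apply]⟩⟩
    semilinear := fun f y => by
      obtain ⟨v, rfl⟩ := W.mkQ_surjective y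
      change Φ (f • W.mkQ v) = shift k 1 f • Φ (W.mkQ v)
      rw [← map_smul, hΦ, hΦ, D.semilinear, map_smul] }

lemma Diff.quot_Phi (D : Diff.{u, v} k) (W : Submodule (LaurentSeries k) D.V)
    (hW : ∀ w ∈ W, D.Phi w ∈ W) (v : D.V) :
    (D.quot W hW).Phi (W.mkQ v) = W.mkQ (D.Phi v) :=
  quotOp_mkQ (exists_splitting W).choose_spec.choose_spec.2.2.1 hW v

/-- The projection to a quotient. -/
def Diff.quotHom (D : Diff.{u, v} k) (W : Submodule (LaurentSeries k) D.V)
    (hW : ∀ w ∈ W, D.Phi w ∈ W) : D ⟶ D.quot W hW :=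
  Diff.Hom.mk (D₁ := D) (D₂ := D.quot W hW) W.mkQ fun v => (D.quot_Phi W hW v).symm

/-- In a splitting, `N` is block triangular and its off-diagonal block is `g = p Φ s`, the scalar
`x` contributing nothing as `p s = 0`. The lattice of `W` is enlarged by `t ^ (-c)` to make this
block integral. Applying `N` another `m₁` times after `m₂` times handles the quotient component
before the component in `W`. -/
lemma HasGoodLattice.extension {V : Type v} [AddCommGroup V] [Module k V]
    [Module (LaurentSeries k) V] [IsScalarTower k (LaurentSeries k) V] {x : k} {Φ : V →ₗ[k] V}
    (hΦ : ∀ (f : LaurentSeries k) w, Φ (f • w) = shift k 1 f • Φ w) {N : V →ₗ[k] V}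
    (hN : ∀ w, N w = Φ w - x • w) {W : Submodule (LaurentSeries k) V} {NW : W →ₗ[k] W}
    (h₁ : HasGoodLattice NW) (hNW : ∀ w : W, (NW w : V) = N w) {NU : (V ⧸ W) →ₗ[k] (V ⧸ W)}
    (h₂ : HasGoodLattice NU) (hNU : ∀ v, W.mkQ (N v) = NU (W.mkQ v)) : HasGoodLattice N := by
  obtain ⟨p, s, hp, hps, hs, hv⟩ := exists_splitting W
  obtain ⟨ι, _, bW, m₁, hm₁, hW1, hW2⟩ := h₁
  obtain ⟨κ, _, bU, m₂, hm₂, hU1, hU2⟩ := h₂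
  let g : (V ⧸ W) →ₗ[k] W :=
    p.restrictScalars k ∘ₗ Φ ∘ₗ s.restrictScalars k
  obtain ⟨c, hc⟩ := semilinear_exists_bound 1 bU bW g (fun f y => by
    change p (Φ (s (f • y))) = shift k 1 f • p (Φ (s y))
    rw [map_smul, hΦ, map_smul])
  obtain ⟨b, hb⟩ := exists_basis_extension p s hp hps hs hv bW bU c
  have hNUm : ∀ (n : ℕ) v, W.mkQ ((N ^ n) v) = (NU ^ n) (W.mkQ v) := by
    intro n
    induction n with
    | zero => intro v; rfl
    | succ n ih => intro v; rw [pow_succ', pow_succ', Module.End.mul_apply, hNU, ih]; rfl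
  have hNW : ∀ v, p (N v) = NW (p v) + g (W.mkQ v) := fun v => by
    have h4 : p (x • s (W.mkQ v)) = 0 := by
      rw [← C_smul, map_smul, hps, smul_zero]
    nth_rewrite 1 [← hv v]
    rw [map_add, hN (s _), ← hNW, map_add, map_sub, h4, sub_zero, hp]
    rfl
  have h1 : ∀ j, ∀ w ∈ Lat b j, N w ∈ Lat b j := by
    intro j w hw
    rw [hb] at hw ⊢
    rw [hNU, hNW]
    exact ⟨add_mem (hW1 _ _ hw.1) (hc _ _ hw.2), hU1 _ _ hw.2⟩
  have hpow : ∀ (n : ℕ) j, ∀ w ∈ Lat b j, (N ^ n) w ∈ Lat b j := by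
    intro n
    induction n with
    | zero => intro j w hw; exact hw
    | succ n ih => intro j w hw; rw [pow_succ', Module.End.mul_apply]; exact h1 _ _ (ih j w hw)
  refine ⟨ι ⊕ κ, inferInstance, b, m₁ + m₂, by omega, h1, fun j w hw => ?_⟩
  rw [pow_add, Module.End.mul_apply]
  change (N ^ m₁) ((N ^ m₂) w) ∈ _
  have h2 := hpow m₂ j w hw
  have h3 : W.mkQ ((N ^ m₂) w) ∈ Lat bU (j + 1) := by
    rw [hNUm]
    exact hU2 _ _ ((hb _ _).1 hw).2
  set y := (N ^ m₂) w
  -- Once the quotient component lies in degree `j + 1` it stays there, so the component in `W`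
  -- deviates from `NW ^ n (p y)` only by terms in degree `j + 1 - c`, which is degree `j + 1` of
  -- the enlarged lattice.
  have h4 : ∀ n : ℕ, W.mkQ ((N ^ n) y) ∈ Lat bU (j + 1) ∧
      p ((N ^ n) y) - (NW ^ n) (p y) ∈ Lat bW (j + 1 - c) := by
    intro n
    induction n with
    | zero => exact ⟨h3, by simp⟩
    | succ n ih =>
      rw [pow_succ', Module.End.mul_apply, hNU, hNW, pow_succ', Module.End.mul_apply,
        add_sub_right_comm (NW _), ← map_sub]
      exact ⟨hU1 _ _ ih.1, add_mem (hW1 _ _ ih.2) (hc _ _ ih.1)⟩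
  rw [hb]
  refine ⟨?_, (h4 m₁).1⟩
  have h5 := hW2 _ _ ((hb _ _).1 h2).1
  have h6 := add_mem (h4 m₁).2 (show (NW ^ m₁) (p y) ∈ Lat bW (j + 1 - c) by
    rw [add_sub_right_comm]; exact h5)
  rwa [sub_add_cancel] at h6

end SubQuot

/-! ### Topological nilpotence on the standard modules -/

section Standard

variable {k : Type u} [Field k]

lemma dec_mem (m : ℕ) [NeZero m] {i : ℕ} (hi : i < m) {N : ℤ} {f : LaurentSeries k}
    (hf : f ∈ ordGE k (m * N)) : dec k m i f ∈ ordGE k N := by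
  intro j hj
  rw [coeff_dec]
  refine hf _ ?_
  have : (m : ℤ) * (j + 1) ≤ m * N := mul_le_mul_of_nonneg_left (by omega) (by omega)
  rw [mul_add] at this
  omega

/-- The decomposition of `K_m` as a vector space over `K`. -/
def decEquiv (k : Type u) [Field k] (m : ℕ) [NeZero m] :
    LaurentSeries k ≃+ (Fin m → LaurentSeries k) where
  toFun f i := dec k m i f
  invFun F := ∑ i : Fin m, tpow k (i : ℕ) * ramify k m (F i)
  left_inv f := by
    change ∑ i : Fin m, tpow k (i : ℕ) * ramify k m (dec k m i f) = f
    rw [Fin.sum_univ_eq_sum_range (fun i : ℕ => tpow k i * ramify k m (dec k m i f)), sum_dec]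
  right_inv F := by
    funext i
    change dec k m i (∑ i : Fin m, tpow k (i : ℕ) * ramify k m (F i)) = F i
    rw [map_sum]
    simp only [dec_tpow_mul_ramify m (Fin.is_lt _) i.2, Fin.val_inj]
    simp
  map_add' f g := by funext i; exact map_add _ _ _

variable [CharZero k]

/-- On `K_q`, `Φ - x = g (φ - 1) + (g - x)`; both terms raise the order in `t = θ ^ (1/q)` by at
least one. The lattice is `k[[t]]`, and the `q`-th power raises the order in `θ` by one. -/
lemma hasGoodLattice_of_isIsoTo {x : k} {S : Diff.{u, v} k} {q : ℕ} [NeZero q]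
    {g : LaurentSeries k} (hg : g.order = 0) (hgx : g.leadingCoeff = x) (h : S.IsIsoTo q g) :
    HasGoodLattice (S.subScalar x) := by
  obtain ⟨e, he, heΦ⟩ := h
  let b : Module.Basis (Fin q) (LaurentSeries k) S.V := Module.Basis.ofEquivFun
    { e.trans (decEquiv k q) with
      map_smul' := fun f w => by
        funext i
        change dec k q i (e (f • w)) = f * dec k q i (e w)
        rw [he, dec_ramify_mul q i i.2] }
  have hb : ∀ j w, w ∈ Lat b j ↔ e w ∈ ordGE k (q * j) := by
    intro j w
    have hrepr : ∀ i, b.repr w i = dec k q i (e w) := fun i => by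
      rw [← Module.Basis.equivFun_apply, Module.Basis.equivFun_ofEquivFun]; rfl
    rw [mem_Lat]
    simp only [hrepr]
    exact ⟨fun h => mem_of_dec_mem q fun i hi => h ⟨i, hi⟩, fun h i => dec_mem q i.2 h⟩
  have hgx' : g.coeff 0 = x := by
    rw [← hgx, HahnSeries.leadingCoeff_eq, hg]
  have hg0 : g ∈ ordGE k 0 := hg ▸ mem_ordGE_order g
  have hgC : g - HahnSeries.C x ∈ ordGE k 1 := by
    rw [← zero_add (1 : ℤ), mem_ordGE_succ]
    exact ⟨sub_mem hg0 (C_mem x), by simp [hgx']⟩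
  have hsmul : ∀ (c : k) w, e (c • w) = HahnSeries.C c * e w := fun c w => by
    rw [← C_smul, he, ramify_C]
  have hN : ∀ l w, e w ∈ ordGE k l → e (S.subScalar x w) ∈ ordGE k (l + 1) := by
    intro l w hw
    rw [S.subScalar_apply, map_sub, heΦ, hsmul,
      show g * shift k q (e w) - HahnSeries.C x * e w =
        g * (shift k q (e w) - e w) + (g - HahnSeries.C x) * e w by ring]
    have := NeZero.pos q
    exact add_mem (mul_mem_of_le hg0 (shift_sub_mem q hw) (by omega))
      (mul_mem_of_le hgC hw (by omega))
  have hNm : ∀ (n : ℕ) l w, e w ∈ ordGE k l → e ((S.subScalar x ^ n) w) ∈ ordGE k (l + n) := by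
    intro n
    induction n with
    | zero => intro l w hw; simpa using hw
    | succ n ih =>
      intro l w hw
      rw [pow_succ', Module.End.mul_apply, Nat.cast_succ, ← add_assoc]
      exact hN _ _ (ih l w hw)
  refine ⟨Fin q, inferInstance, b, q, NeZero.pos q, fun j w hw => ?_, fun j w hw => ?_⟩
  · rw [hb] at hw ⊢
    exact ordGE_anti (by omega) (hN _ _ hw)
  · rw [hb] at hw ⊢
    rw [mul_add, mul_one]
    exact hNm _ _ _ hw

end Standard

/-! ### Reduction to irreducible components -/

section Devissage

variable {k : Type u} [Field k] [CharZero k]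

/-- The quotient by a proper stable subspace of maximal dimension is irreducible, since a proper
nonzero stable subspace of it would pull back to a larger one. -/
lemma Diff.exists_irreducible_quot (D : Diff.{u, v} k) [Nontrivial D.V] :
    ∃ (W : Submodule (LaurentSeries k) D.V) (hW : ∀ w ∈ W, D.Phi w ∈ W),
      W ≠ ⊤ ∧ (D.quot W hW).IsIrreducible := by
  classical
  let P : ℕ → Prop := fun n => ∃ W : Submodule (LaurentSeries k) D.V,
    (∀ w ∈ W, D.Phi w ∈ W) ∧ W ≠ ⊤ ∧ Module.finrank (LaurentSeries k) W = n
  have hP0 : P 0 := ⟨⊥, fun w hw => by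
    rw [Submodule.mem_bot] at hw ⊢; rw [hw, map_zero], bot_ne_top, finrank_bot _ _⟩
  have hPb : ∀ n, P n → n ≤ Module.finrank (LaurentSeries k) D.V := by
    rintro n ⟨W, -, -, rfl⟩
    exact W.finrank_le
  obtain ⟨W, hW, hne, hfr⟩ := Nat.findGreatest_spec (P := P)
    (Nat.zero_le (Module.finrank (LaurentSeries k) D.V)) hP0
  refine ⟨W, hW, hne, ?_, fun W' hW' => ?_⟩
  · exact Submodule.Quotient.nontrivial_iff.2 hne
  · let W₁ : Submodule (LaurentSeries k) D.V := Submodule.comap W.mkQ W'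
    have hW₁ : ∀ w ∈ W₁, D.Phi w ∈ W₁ := fun w hw => by
      have := hW' _ hw
      rwa [D.quot_Phi W hW] at this
    have hle : W ≤ W₁ := fun w hw => by
      change W.mkQ w ∈ W'
      rw [Submodule.mkQ_apply, (Submodule.Quotient.mk_eq_zero W).2 hw]
      exact zero_mem _
    have hmap : W' = W₁.map W.mkQ :=
      (Submodule.map_comap_eq_of_surjective W.mkQ_surjective W').symm
    by_cases hT : W₁ = ⊤
    · right
      rw [hmap, hT, Submodule.map_top]
      exact LinearMap.range_eq_top.2 W.mkQ_surjective
    · left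
      have h1 := Nat.le_findGreatest (P := P) (hPb _ ⟨W₁, hW₁, hT, rfl⟩) ⟨W₁, hW₁, hT, rfl⟩
      rw [← hfr] at h1
      rw [hmap, ← Submodule.eq_of_le_of_finrank_le hle h1]
      exact W.mkQ_map_self

/-- Induction on the dimension along an irreducible quotient: it is a component of `D`, and the
components of the kernel are components of `D` as well. -/
theorem hasGoodLattice_of_components {x : k} (n : ℕ) (D : Diff.{u, v} k)
    (hn : Module.finrank (LaurentSeries k) D.V = n)
    (hD : ∀ S : Diff.{u, v} k, S.IsIrreducibleComponent D →
      ∃ (q : ℕ) (_ : NeZero q) (g : LaurentSeries k),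
        g.order = 0 ∧ g.leadingCoeff = x ∧ S.IsIsoTo q g) :
    HasGoodLattice (D.subScalar x) := by
  induction n using Nat.strong_induction_on generalizing D with
  | _ n ih =>
  rcases subsingleton_or_nontrivial D.V with h | h
  · exact ⟨Empty, inferInstance, Module.Basis.empty _, 1, one_pos,
      fun j w _ => by rw [Subsingleton.elim (D.subScalar x w) 0]; exact zero_mem _,
      fun j w _ => by rw [Subsingleton.elim ((D.subScalar x ^ 1) w) 0]; exact zero_mem _⟩
  · obtain ⟨W, hW, hne, hirr⟩ := D.exists_irreducible_quot
    have hq : HasGoodLattice ((D.quot W hW).subScalar x) := by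
      obtain ⟨q, _, g, hg, hgx, hiso⟩ := hD (D.quot W hW)
        ⟨hirr, D, 𝟙 D, D.quotHom W hW, Function.injective_id, W.mkQ_surjective⟩
      exact hasGoodLattice_of_isIsoTo hg hgx hiso
    have hs : HasGoodLattice ((D.sub W hW).subScalar x) := by
      refine ih _ ?_ (D.sub W hW) rfl ?_
      · rw [← hn]; exact Submodule.finrank_lt hne
      · rintro S ⟨hS, P, i, p, hi, hp⟩
        refine hD S ⟨hS, P, i ≫ D.subHom W hW, p, ?_, hp⟩
        exact Subtype.val_injective.comp hi
    refine HasGoodLattice.extension (N := D.subScalar x) D.semilinear (fun _ => rfl) hs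
      (fun _ => rfl) hq fun v => ?_
    rw [D.subScalar_apply, map_sub]
    refine congrArg₂ (· - ·) (D.quot_Phi W hW v).symm ?_
    rfl

end Devissage

/-! ### Bases of lattices -/

section LatticeBasis

variable {k : Type u} [Field k] {V : Type v} [AddCommGroup V] [Module k V]
  [Module (LaurentSeries k) V] [IsScalarTower k (LaurentSeries k) V] {ι : Type*} [Finite ι]

lemma Lat_le_of_basis_mem (b : Module.Basis ι (LaurentSeries k) V) {κ : Type*}
    (b' : Module.Basis κ (LaurentSeries k) V) (h : ∀ i, b i ∈ Lat b' 0) (j : ℤ) :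
    Lat b j ≤ Lat b' j := fun w hw => by
  have := map_mem_Lat_of_basis b b' LinearMap.id (c := 0) h hw
  rwa [add_zero] at this

lemma exists_basis_of_span (b : Module.Basis ι (LaurentSeries k) V) {y : ι → V}
    (hy : ∀ i, y i ∈ Lat b 0) (p : ι → ι → LaurentSeries k) (hp : ∀ i j, p i j ∈ ordGE k 0)
    (hb : ∀ i, b i = ∑ᶠ j, p i j • y j) :
    ∃ b' : Module.Basis ι (LaurentSeries k) V, (∀ i, b' i = y i) ∧ ∀ j, Lat b' j = Lat b j := by
  cases nonempty_fintype ι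
  simp only [finsum_eq_sum_of_fintype] at hb
  have hspan : ⊤ ≤ Submodule.span (LaurentSeries k) (Set.range y) := by
    rw [← b.span_eq, Submodule.span_le]
    rintro _ ⟨i, rfl⟩
    rw [hb]
    exact Submodule.sum_mem _ fun j _ => Submodule.smul_mem _ _ (Submodule.subset_span ⟨j, rfl⟩)
  have hfin : FiniteDimensional (LaurentSeries k) V := Module.Basis.finiteDimensional_of_finite b
  have hcard : Fintype.card ι = Module.finrank (LaurentSeries k) V :=
    (Module.finrank_eq_card_basis b).symm
  let b' := basisOfTopLeSpanOfCardEqFinrank y hspan hcard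
  have hb' : ∀ i, b' i = y i := fun i => by simp [b']
  refine ⟨b', hb', fun j => le_antisymm (Lat_le_of_basis_mem b' b (fun i => ?_) j)
    (Lat_le_of_basis_mem b b' (fun i => ?_) j)⟩
  · rw [hb']; exact hy i
  · rw [hb]
    refine Submodule.sum_mem _ fun l _ => ?_
    rw [← hb']
    exact smul_mem_Lat_of_le b' (hp i l) (basis_mem_Lat b' l) (by omega)

/-- A family congruent to a basis of a lattice is a basis of the lattice. -/
lemma exists_basis_of_congr (b : Module.Basis ι (LaurentSeries k) V) {y : ι → V}
    (hy : ∀ i, y i - b i ∈ Lat b 1) :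
    ∃ b' : Module.Basis ι (LaurentSeries k) V, (∀ i, b' i = y i) ∧ ∀ j, Lat b' j = Lat b j := by
  let g : V →ₗ[LaurentSeries k] V := b.constr ℕ y
  have hgb : ∀ i, g (b i) = y i := fun i => b.constr_basis ℕ y i
  have hg : ∀ j, ∀ w ∈ Lat b j, g w - w ∈ Lat b (j + 1) := fun j w hw =>
    map_mem_Lat_of_basis b b (g - LinearMap.id) (c := 1)
      (fun i => by rw [LinearMap.sub_apply, hgb]; exact hy i) hw
  have hg' : ∀ j, ∀ w ∈ Lat b j, g w ∈ Lat b j := fun j w hw => by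
    have := add_mem (Lat_anti b (by omega : j ≤ j + 1) (hg j w hw)) hw
    rwa [sub_add_cancel] at this
  -- As `g` is the identity modulo `t`, it cannot raise the order: `w = g w - (g w - w)` improves
  -- the order of `w` by one step until that of `g w` is reached. This gives injectivity and the
  -- equality of lattices.
  have hclimb : ∀ j w, g w ∈ Lat b j → w ∈ Lat b j := by
    intro j w hw
    obtain ⟨l, hl⟩ := exists_mem_Lat b w
    have : ∀ n : ℕ, w ∈ Lat b (min j (l + n)) := by
      intro n
      induction n with
      | zero => exact Lat_anti b (by simp) hl
      | succ n ih =>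
        have h1 := sub_mem (Lat_anti b (by omega : min j (l + (n + 1 : ℕ)) ≤ j) hw)
          (Lat_anti b (by omega : min j (l + (n + 1 : ℕ)) ≤ min j (l + n) + 1) (hg _ w ih))
        rwa [sub_sub_cancel] at h1
    exact Lat_anti b (by omega) (this (j - l).toNat)
  have hinj : Function.Injective g := by
    rw [← LinearMap.ker_eq_bot, LinearMap.ker_eq_bot']
    intro w hw
    exact eq_zero_of_forall_mem_Lat b fun N => hclimb N w (by rw [hw]; exact zero_mem _)
  have hfin : FiniteDimensional (LaurentSeries k) V := Module.Basis.finiteDimensional_of_finite b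
  let e := LinearEquiv.ofInjectiveEndo g hinj
  have he : ∀ w, e w = g w := fun w => rfl
  refine ⟨b.map e, fun i => by rw [Module.Basis.map_apply, he, hgb], fun j => ?_⟩
  have h1 : ∀ w, w ∈ Lat (b.map e) j ↔ e.symm w ∈ Lat b j := fun w => Iff.rfl
  ext w
  rw [h1]
  refine ⟨fun h => ?_, fun h => hclimb j _ ?_⟩
  · have := hg' j _ h
    rwa [← he, e.apply_symm_apply] at this
  · rwa [← he, e.apply_symm_apply]

end LatticeBasis

/-! ### Rescaling of cyclic twisted operators -/

namespace Twist

variable {k : Type u} [Field k] {τ : Twist k}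

/-- The twist of `t ^ (-p) B`. -/
def scale (τ : Twist k) (p : ℤ) : Twist k where
  sigma := τ.sigma
  sigma_smul := τ.sigma_smul
  sigma_sub_mem := τ.sigma_sub_mem
  nu := mulLin (tpow k (-p)) ∘ₗ τ.nu
  e := τ.e - p
  nu_mem hf := mul_mem_of_le (tpow_mem (-p)) (τ.nu_mem hf) (by omega)

/-- The twist of `B - λ`. -/
def translate (τ : Twist k) (he : 1 ≤ τ.e) (l : k) : Twist k where
  sigma := τ.sigma
  sigma_smul := τ.sigma_smul
  sigma_sub_mem := τ.sigma_sub_mem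
  nu := τ.nu + l • (τ.sigmaLin - LinearMap.id)
  e := 1
  nu_mem hf := add_mem (ordGE_anti (by omega) (τ.nu_mem hf)) (Submodule.smul_mem _ _ (τ.sigma_sub_mem hf))

variable {V : Type v} [AddCommGroup V] [Module k V] [Module (LaurentSeries k) V]
  [IsScalarTower k (LaurentSeries k) V]

lemma IsTwisted.scale {B : V →ₗ[k] V} (hB : τ.IsTwisted B) (p : ℤ) :
    (τ.scale p).IsTwisted (smulEnd V (tpow k (-p)) ∘ₗ B) := by
  intro f w
  change tpow k (-p) • B (f • w) = τ.sigma f • tpow k (-p) • B w + (tpow k (-p) * τ.nu f) • w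
  rw [hB, smul_add, smul_comm, smul_smul (tpow k (-p)) (τ.nu f)]

lemma IsTwisted.map_mem_Lat {B : V →ₗ[k] V} (hB : τ.IsTwisted B) (he : 0 ≤ τ.e) {ι : Type*}
    [Finite ι] {b : Module.Basis ι (LaurentSeries k) V} (hb : ∀ i, B (b i) ∈ Lat b 0) (j : ℤ)
    (w : V) (hw : w ∈ Lat b j) : B w ∈ Lat b j := by
  cases nonempty_fintype ι
  rw [← b.sum_repr w, map_sum]
  refine Submodule.sum_mem _ fun i _ => ?_
  rw [hB]
  exact add_mem (smul_mem_Lat_of_le b (τ.sigma_mem (hw i)) (hb i) (by omega))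
    (smul_mem_Lat_of_le b (τ.nu_mem (hw i)) (basis_mem_Lat b i) (by omega))

/-- The lattice spanned by the vectors `t ^ (-p i) B ^ i v`. -/
lemma IsTwisted.exists_rescaled_lattice {B : V →ₗ[k] V} (hB : τ.IsTwisted B) {n : ℕ} {v : V}
    (b : Module.Basis (Fin n) (LaurentSeries k) V) (hb : ∀ i, b i = (B ^ (i : ℕ)) v) {p : ℤ}
    (hp : p ≤ τ.e) (hc : ∀ i : Fin n, b.repr ((B ^ n) v) i ∈ ordGE k (p * (n - (i : ℕ)))) :
    ∃ e : Module.Basis (Fin n) (LaurentSeries k) V,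
      (∀ i, e i = tpow k (-(p * (i : ℕ))) • (B ^ (i : ℕ)) v) ∧
      (∀ w i, e.repr w i = tpow k (p * (i : ℕ)) * b.repr w i) ∧
      (∀ i ≤ n, (B ^ i) v ∈ Lat e (p * i)) ∧
      ∀ j, ∀ w ∈ Lat e j, (smulEnd V (tpow k (-p)) ∘ₗ B) w ∈ Lat e j := by
  let e : Module.Basis (Fin n) (LaurentSeries k) V := b.isUnitSMul
    (w := fun i => tpow k (-(p * (i : ℕ)))) fun i => IsUnit.mk0 _ (tpow_ne_zero _)
  have he : ∀ i, e i = tpow k (-(p * (i : ℕ))) • (B ^ (i : ℕ)) v := fun i => by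
    rw [← hb]; exact b.isUnitSMul_apply _ i
  have hrepr : ∀ w i, e.repr w i = tpow k (p * (i : ℕ)) * b.repr w i := fun w i => by
    rw [show e.repr w i = (tpow k (-(p * (i : ℕ))))⁻¹ • b.repr w i by
      simp [e, Module.Basis.repr_isUnitSMul, Units.smul_def], tpow_inv, neg_neg, smul_eq_mul]
  -- The range includes `i = n`, where the membership is exactly the hypothesis on the Newton
  -- polygon.
  have hpow : ∀ i ≤ n, (B ^ i) v ∈ Lat e (p * i) := by
    intro i hi
    rcases hi.lt_or_eq with h | rfl
    · have h1 : (B ^ i) v = tpow k (p * i) • e ⟨i, h⟩ := by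
        rw [he, smul_smul, tpow_mul_neg, one_smul]
      rw [h1, tpow_smul_mem_Lat, sub_self]
      exact basis_mem_Lat e _
    · intro l
      rw [hrepr, tpow_mul_mem]
      rw [← mul_sub]
      exact hc l
  refine ⟨e, he, hrepr, hpow, (hB.scale p).map_mem_Lat (by change 0 ≤ τ.e - p; omega) fun i => ?_⟩
  have h1 : (smulEnd V (tpow k (-p)) ∘ₗ B) (e i) =
      (tpow k (-p) * τ.sigma (tpow k (-(p * (i : ℕ))))) • (B ^ ((i : ℕ) + 1)) v +
        (tpow k (-p) * τ.nu (tpow k (-(p * (i : ℕ))))) • (B ^ (i : ℕ)) v := by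
    change tpow k (-p) • B (e i) = _
    rw [he, hB, pow_succ', Module.End.mul_apply, smul_add, smul_smul, smul_smul]
  rw [h1]
  refine add_mem (smul_mem_Lat_of_le e (mul_mem_ordGE (tpow_mem _) (τ.sigma_mem (tpow_mem _)))
    (hpow _ i.2) ?_) (smul_mem_Lat_of_le e (mul_mem_ordGE (tpow_mem _) (τ.nu_mem (tpow_mem _)))
    (hpow _ i.2.le) (by omega))
  push_cast
  rw [mul_add]
  omega

/-- Rescaling a cyclic twisted operator according to its slope. -/
lemma IsTwisted.exists_rescaled_basis {B : V →ₗ[k] V} (hB : τ.IsTwisted B) {n : ℕ} {v : V}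
    (b : Module.Basis (Fin n) (LaurentSeries k) V) (hb : ∀ i, b i = (B ^ (i : ℕ)) v)
    {p : ℤ} (hp : p + 1 ≤ τ.e) (hc : ∀ i : Fin n, b.repr ((B ^ n) v) i ∈ ordGE k (p * (n - (i : ℕ)))) :
    ∃ b' : Module.Basis (Fin n) (LaurentSeries k) V,
      (∀ i, b' i = ((smulEnd V (tpow k (-p)) ∘ₗ B) ^ (i : ℕ)) v) ∧
      (∀ j, ∀ w ∈ Lat b' j, (smulEnd V (tpow k (-p)) ∘ₗ B) w ∈ Lat b' j) ∧
      ((smulEnd V (tpow k (-p)) ∘ₗ B) ^ n) v - ∑ i : Fin n,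
        (b.repr ((B ^ n) v) i).coeff (p * (n - (i : ℕ))) •
          ((smulEnd V (tpow k (-p)) ∘ₗ B) ^ (i : ℕ)) v ∈ Lat b' 1 := by
  set B₁ := smulEnd V (tpow k (-p)) ∘ₗ B with hB₁def
  have hB₁ : ∀ w, B₁ w = tpow k (-p) • B w := fun w => rfl
  obtain ⟨e, he, hrepr, hpow, hLat⟩ := hB.exists_rescaled_lattice b hb (by omega) hc
  let y : ℕ → V := fun i => tpow k (-(p * i)) • (B ^ i) v
  have hy0 : ∀ i ≤ n, y i ∈ Lat e 0 := fun i hi => by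
    rw [tpow_smul_mem_Lat, sub_neg_eq_add, zero_add]; exact hpow i hi
  have hye : ∀ i : Fin n, y i = e i := fun i => (he i).symm
  -- The error has a part from `σ - 1`, of degree at least one, and a part from `ν`, of degree `e -
  -- p`. The strict inequality `p + 1 ≤ e` makes the second vanish modulo `t`; hence the rescaled
  -- operator is still cyclic on `v`.
  have hstep : ∀ i < n, B₁ (y i) - y (i + 1) ∈ Lat e 1 := by
    intro i hi
    have h1 : B₁ (y i) - y (i + 1) =
        (tpow k (-p) * (τ.sigma (tpow k (-(p * i))) - tpow k (-(p * i)))) • (B ^ (i + 1)) v +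
          (tpow k (-p) * τ.nu (tpow k (-(p * i)))) • (B ^ i) v := by
      rw [hB₁, hB, pow_succ' B i, Module.End.mul_apply, mul_sub, sub_smul, ← tpow_add,
        smul_add, smul_smul, smul_smul]
      change _ - tpow k (-(p * (i + 1 : ℕ))) • (B ^ (i + 1)) v = _
      rw [pow_succ' B i, Module.End.mul_apply,
        show -p + -(p * (i : ℤ)) = -(p * (i + 1 : ℕ)) by push_cast; ring]
      abel
    rw [h1]
    refine add_mem (smul_mem_Lat_of_le e (mul_mem_of_le (l := -p + (-(p * i) + 1)) (tpow_mem _)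
      (τ.sigma_sub_mem (tpow_mem _)) (by omega)) (hpow (i + 1) hi) ?_)
      (smul_mem_Lat_of_le e (mul_mem_of_le (l := -p + (-(p * i) + τ.e)) (tpow_mem _)
      (τ.nu_mem (tpow_mem _)) (by omega)) (hpow i hi.le) (by omega))
    push_cast
    rw [mul_add]
    omega
  have hcong : ∀ i ≤ n, (B₁ ^ i) v - y i ∈ Lat e 1 := by
    intro i
    induction i with
    | zero => intro _; simp [y]
    | succ i ih =>
      intro hi
      have h1 := add_mem (hLat _ _ (ih (by omega))) (hstep i hi)
      rwa [map_sub, sub_add_sub_cancel, ← Module.End.mul_apply, ← pow_succ'] at h1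
  obtain ⟨b', hb', hLat'⟩ := exists_basis_of_congr e
    (y := fun i : Fin n => (B₁ ^ (i : ℕ)) v) (fun i => by rw [← hye]; exact hcong i i.2.le)
  refine ⟨b', hb', fun j w hw => ?_, ?_⟩
  · rw [hLat'] at hw ⊢
    exact hLat j w hw
  · rw [hLat']
    -- The coordinates of `y n` in the rescaled basis are `t ^ (-p (n - i)) aᵢ`, so modulo `t` only
    -- the coefficients of `aᵢ` in degree `p (n - i)` survive.
    have h1 : y n - ∑ i : Fin n,
        (b.repr ((B ^ n) v) i).coeff (p * (n - (i : ℕ))) • e i ∈ Lat e 1 := by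
      intro l
      have h2 : e.repr (∑ i : Fin n,
          (b.repr ((B ^ n) v) i).coeff (p * (n - (i : ℕ))) • e i) l =
          HahnSeries.C ((b.repr ((B ^ n) v) l).coeff (p * (n - (l : ℕ)))) := by
        simp only [← C_smul]
        exact congrFun (e.repr_sum_self _) l
      rw [map_sub, Finsupp.sub_apply, h2, show y n = tpow k (-(p * n)) • (B ^ n) v from rfl,
        map_smul, Finsupp.smul_apply, hrepr, smul_eq_mul, ← mul_assoc, ← tpow_add,
        show -(p * (n : ℤ)) + p * ((l : ℕ) : ℤ) = -(p * (n - (l : ℕ))) by ring]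
      rw [← zero_add (1 : ℤ), mem_ordGE_succ]
      refine ⟨sub_mem ?_ (C_mem _), ?_⟩
      · rw [tpow_mul_mem]
        simpa using hc l
      · rw [HahnSeries.coeff_sub, coeff_tpow_mul]
        simp
    have h3 : ∑ i : Fin n, (b.repr ((B ^ n) v) i).coeff (p * (n - (i : ℕ))) • e i -
        ∑ i : Fin n, (b.repr ((B ^ n) v) i).coeff (p * (n - (i : ℕ))) • (B₁ ^ (i : ℕ)) v ∈
          Lat e 1 := by
      rw [← Finset.sum_sub_distrib]
      refine Submodule.sum_mem _ fun i _ => ?_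
      rw [← smul_sub, ← hye, ← neg_sub ((B₁ ^ (i : ℕ)) v), smul_neg]
      exact neg_mem (Submodule.smul_mem _ _ (hcong i i.2.le))
    have h4 := add_mem (add_mem (hcong n le_rfl) h1) h3
    rwa [sub_add_sub_cancel, sub_add_sub_cancel] at h4

end Twist

/-! ### Reduction of lattices -/

section Reduction

variable {k : Type u} [Field k] {V : Type v} [AddCommGroup V] [Module k V]
  [Module (LaurentSeries k) V] {ι : Type*} (b : Module.Basis ι (LaurentSeries k) V)

/-- The vectors with homogeneous coordinates of degree `i`. -/
def embL [Fintype ι] (i : ℤ) : (ι → k) →ₗ[k] V := Fintype.linearCombination k fun l => tpow k i • b l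

lemma embL_apply [Fintype ι] (i : ℤ) (x : ι → k) : embL b i x = ∑ l, x l • tpow k i • b l := rfl

variable [IsScalarTower k (LaurentSeries k) V]

lemma repr_base_smul (c : k) (w : V) (l : ι) : b.repr (c • w) l = c • b.repr w l := by
  rw [← C_smul, map_smul, Finsupp.smul_apply, smul_eq_mul, ← smul_eq_C_mul]

/-- The coefficients of degree `i` of the coordinates. -/
def redL (i : ℤ) : V →ₗ[k] (ι → k) where
  toFun w l := (b.repr w l).coeff i
  map_add' w w' := by ext; simp
  map_smul' c w := by
    funext l
    rw [repr_base_smul, HahnSeries.coeff_smul]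
    rfl

lemma redL_apply (i : ℤ) (w : V) (l : ι) : redL b i w l = (b.repr w l).coeff i := rfl

lemma mem_Lat_succ {i : ℤ} {w : V} : w ∈ Lat b (i + 1) ↔ w ∈ Lat b i ∧ redL b i w = 0 := by
  rw [mem_Lat, mem_Lat, funext_iff]
  simp only [mem_ordGE_succ, forall_and]
  rfl

variable {b} in
lemma pow_mem_Lat {C : V →ₗ[k] V} (hC : ∀ j, ∀ w ∈ Lat b j, C w ∈ Lat b j) (n : ℕ) {i : ℤ} {w : V}
    (hw : w ∈ Lat b i) : (C ^ n) w ∈ Lat b i := by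
  induction n with
  | zero => exact hw
  | succ n ih => rw [pow_succ', Module.End.mul_apply]; exact hC _ _ ih

variable [Fintype ι]

lemma embL_mem (i : ℤ) (x : ι → k) : embL b i x ∈ Lat b i := by
  rw [embL_apply]
  exact Submodule.sum_mem _ fun l _ => Submodule.smul_mem _ _
    (smul_mem_Lat_of_le b (tpow_mem i) (basis_mem_Lat b l) (by omega))

lemma redL_embL (i : ℤ) (x : ι → k) : redL b i (embL b i x) = x := by
  classical
  funext l
  rw [redL_apply, embL_apply, map_sum, Finset.sum_apply', HahnSeries.coeff_sum,
    Finset.sum_eq_single l]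
  · rw [repr_base_smul, map_smul, Finsupp.smul_apply, Module.Basis.repr_self, Finsupp.single_eq_same,
      HahnSeries.coeff_smul, smul_eq_mul, smul_eq_mul, mul_one, coeff_tpow, if_pos rfl, mul_one]
  · intro m _ hm
    rw [repr_base_smul, map_smul, Finsupp.smul_apply, Module.Basis.repr_self,
      Finsupp.single_eq_of_ne (Ne.symm hm)]
    simp
  · simp

lemma sub_embL_mem {i : ℤ} {w : V} (hw : w ∈ Lat b i) :
    w - embL b i (redL b i w) ∈ Lat b (i + 1) := by
  rw [mem_Lat_succ, map_sub, redL_embL, sub_self]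
  exact ⟨sub_mem hw (embL_mem b i _), rfl⟩

/-- The operator induced on the graded piece of degree `i`. -/
def redOp (C : V →ₗ[k] V) (i : ℤ) : (ι → k) →ₗ[k] (ι → k) := redL b i ∘ₗ C ∘ₗ embL b i

variable {b}

lemma redL_map {C : V →ₗ[k] V} (hC : ∀ j, ∀ w ∈ Lat b j, C w ∈ Lat b j) {i : ℤ} {w : V}
    (hw : w ∈ Lat b i) : redL b i (C w) = redOp b C i (redL b i w) := by
  have h1 := ((mem_Lat_succ b).1 (hC _ _ (sub_embL_mem b hw))).2
  rw [map_sub, map_sub, sub_eq_zero] at h1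
  exact h1

lemma redL_pow {C : V →ₗ[k] V} (hC : ∀ j, ∀ w ∈ Lat b j, C w ∈ Lat b j) (n : ℕ) {i : ℤ} {w : V}
    (hw : w ∈ Lat b i) : redL b i ((C ^ n) w) = (redOp b C i ^ n) (redL b i w) := by
  induction n with
  | zero => rfl
  | succ n ih =>
    rw [pow_succ', Module.End.mul_apply, redL_map hC (pow_mem_Lat hC n hw), ih, pow_succ',
      Module.End.mul_apply]

end Reduction

/-! ### Splitting by eigenvalues -/

namespace Twist

variable {k : Type u} [Field k] {τ : Twist k}
  {V : Type v} [AddCommGroup V] [Module k V] [Module (LaurentSeries k) V]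
  [IsScalarTower k (LaurentSeries k) V]

lemma IsTwisted.translate {B : V →ₗ[k] V} (hB : τ.IsTwisted B) (he : 1 ≤ τ.e) (l : k) :
    (τ.translate he l).IsTwisted (B - l • LinearMap.id) := by
  intro f w
  change B (f • w) - l • f • w = τ.sigma f • (B w - l • w) + (τ.nu f + l • (τ.sigma f - f)) • w
  rw [hB, smul_sub, add_smul, smul_assoc, sub_smul, smul_sub, smul_smul_base]
  abel

/-- The vectors on which a twisted operator is topologically nilpotent form a subspace. -/
lemma IsTwisted.exists_nilpotent_subspace {C : V →ₗ[k] V} (hC : τ.IsTwisted C) (he : 1 ≤ τ.e)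
    {ι : Type*} [Finite ι] (b : Module.Basis ι (LaurentSeries k) V)
    (hLat : ∀ j, ∀ w ∈ Lat b j, C w ∈ Lat b j) :
    ∃ W : Submodule (LaurentSeries k) V, (∀ w ∈ W, C w ∈ W) ∧
      ∀ w, w ∈ W ↔ ∀ N : ℕ, ∃ M : ℕ, (C ^ M) w ∈ Lat b N := by
  cases nonempty_fintype ι
  let P : ℕ → V → Prop := fun N w => ∃ M : ℕ, (C ^ M) w ∈ Lat b N
  have hPadd : ∀ {N w w'}, P N w → P N w' → P N (w + w') := by
    rintro N w w' ⟨M, hM⟩ ⟨M', hM'⟩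
    refine ⟨M + M', ?_⟩
    rw [map_add]
    refine add_mem ?_ ?_
    · rw [add_comm, pow_add, Module.End.mul_apply]; exact pow_mem_Lat hLat M' hM
    · rw [pow_add, Module.End.mul_apply]; exact pow_mem_Lat hLat M hM'
  have hPL : ∀ {N : ℕ} {w}, w ∈ Lat b N → P N w := fun hw => ⟨0, hw⟩
  have hPC : ∀ {N w}, P N w → P N (C w) := by
    rintro N w ⟨M, hM⟩
    refine ⟨M, ?_⟩
    rw [← Module.End.mul_apply, ← pow_succ, pow_succ', Module.End.mul_apply]
    exact hLat _ _ hM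
  have hPpow : ∀ {N w} (M : ℕ), P N ((C ^ M) w) → P N w := by
    rintro N w M ⟨M', hM'⟩
    rw [← Module.End.mul_apply, ← pow_add] at hM'
    exact ⟨_, hM'⟩
  have hW0C : ∀ {w}, (∀ N, P N w) → ∀ (i : ℕ) N, P N ((C ^ i) w) := by
    intro w hw i
    induction i with
    | zero => exact hw
    | succ i ih => intro N; rw [pow_succ', Module.End.mul_apply]; exact hPC (ih N)
  -- The integer `d` measures how far `f w` is from `t ^ N L`. The commutator `C (f y) - f C y =
  -- (σ(f) - f) C y + ν(f) y` involves scalars of order one higher, so it is covered by a smaller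
  -- `d`, while `f (Cᴹ w)` is small for large `M`.
  have key : ∀ (N d : ℕ) (j l : ℤ) (f : LaurentSeries k) (w : V), f ∈ ordGE k j →
      w ∈ Lat b l → (∀ N, P N w) → (N : ℤ) ≤ j + l + d → P N (f • w) := by
    intro N d
    induction d with
    | zero =>
      intro j l f w hf hw _ hN
      exact hPL (smul_mem_Lat_of_le b hf hw (by simpa using hN))
    | succ d ih =>
      intro j l f w hf hw hw0 hN
      push_cast at hN
      have h1 : ∀ i : ℕ, P N ((C ^ i) (f • w) - f • (C ^ i) w) := by
        intro i
        induction i with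
        | zero => rw [pow_zero, Module.End.one_apply, Module.End.one_apply, sub_self]
                  exact hPL (zero_mem _)
        | succ i ih' =>
          have h2 : (C ^ (i + 1)) (f • w) - f • (C ^ (i + 1)) w =
              C ((C ^ i) (f • w) - f • (C ^ i) w) +
                ((τ.sigma f - f) • (C ^ (i + 1)) w + τ.nu f • (C ^ i) w) := by
            rw [map_sub, hC, pow_succ', Module.End.mul_apply, Module.End.mul_apply, sub_smul]
            abel
          rw [h2]
          refine hPadd (hPC ih') (hPadd ?_ ?_)
          · exact ih (j + 1) l _ _ (τ.sigma_sub_mem hf) (pow_mem_Lat hLat _ hw) (hW0C hw0 _)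
              (by omega)
          · exact ih (j + 1) l _ _ (ordGE_anti (by omega) (τ.nu_mem hf)) (pow_mem_Lat hLat _ hw)
              (hW0C hw0 _) (by omega)
      obtain ⟨M, hM⟩ := hw0 (N - j).toNat
      refine hPpow M ?_
      have h3 := hPadd (h1 M) (hPL (N := N)
        (smul_mem_Lat_of_le b hf hM (by omega : (N : ℤ) ≤ j + (N - j).toNat)))
      rwa [sub_add_cancel] at h3
  refine ⟨⟨⟨⟨{w | ∀ N, P N w}, fun hw hw' N => hPadd (hw N) (hw' N)⟩,
    fun N => hPL (zero_mem _)⟩, fun f w hw N => ?_⟩, fun w hw N => hPC (hw N), fun w => Iff.rfl⟩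
  obtain ⟨j, hj⟩ := exists_mem_ordGE f
  obtain ⟨l, hl⟩ := exists_mem_Lat b w
  exact key N (N - j - l).toNat j l f w hj hl hw (by omega)

/-- If the reduction of a twisted operator has two distinct eigenvalues, then there is a proper
stable subspace. -/
theorem IsTwisted.exists_stable_of_eigenvectors {B : V →ₗ[k] V} (hB : τ.IsTwisted B)
    (he : 1 ≤ τ.e) {ι : Type*} [Finite ι] (b : Module.Basis ι (LaurentSeries k) V)
    (hLat : ∀ j, ∀ w ∈ Lat b j, B w ∈ Lat b j) {l m : k} (hlm : l ≠ m) {w₀ w₁ : V}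
    (h₀' : w₀ ∉ Lat b 1) (h₀l : B w₀ - l • w₀ ∈ Lat b 1)
    (h₁' : w₁ ∉ Lat b 1) (h₁m : B w₁ - m • w₁ ∈ Lat b 1) :
    ∃ W : Submodule (LaurentSeries k) V, W ≠ ⊥ ∧ W ≠ ⊤ ∧ ∀ w ∈ W, B w ∈ W := by
  cases nonempty_fintype ι
  set C := B - l • LinearMap.id with hCdef
  have hC : ∀ w, C w = B w - l • w := fun w => rfl
  have hCLat : ∀ j, ∀ w ∈ Lat b j, C w ∈ Lat b j := fun j w hw =>
    sub_mem (hLat j w hw) (Submodule.smul_mem _ _ hw)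
  obtain ⟨W, hWC, hW⟩ := (hB.translate he l).exists_nilpotent_subspace le_rfl b hCLat
  refine ⟨W, ?_, ?_, fun w hw => ?_⟩
  -- The eigenvector modulo `t` is lifted to a vector on which `C = B - l` is topologically
  -- nilpotent. The corrections lie in `t L`, so the limit is nonzero.
  · obtain ⟨w, hw0, hw⟩ := exists_limit b
      (fun i w => ∃ M : ℕ, (C ^ M) w ∈ Lat b (1 + i)) 1 (v₀ := w₀) ⟨1, by simpa [hC] using h₀l⟩ (by
      rintro i w ⟨M, hM⟩
      set y := (C ^ M) w with hy
      -- On a finite-dimensional graded piece the images of the powers of `C` stabilize. The class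
      -- of `Cⁿ y` can then be written as `C ^ (n + M)` of some `x`, and subtracting a lift of `x`
      -- from `w` gains one degree.
      obtain ⟨n, hn⟩ := IsArtinian.monotone_stabilizes
        (LinearMap.iterateRange (redOp b C (1 + i)))
      have h2 : (redOp b C (1 + i) ^ n) (redL b (1 + i) y) ∈
          LinearMap.range (redOp b C (1 + i) ^ (n + M)) := by
        have h3 : LinearMap.range (redOp b C (1 + i) ^ n) =
            LinearMap.range (redOp b C (1 + i) ^ (n + M)) := hn (n + M) (by omega)
        rw [← h3]
        exact ⟨_, rfl⟩
      obtain ⟨x, hx⟩ := h2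
      refine ⟨-embL b (1 + i) x, neg_mem (embL_mem b _ x), n + M, ?_⟩
      have h4 : (C ^ (n + M)) (w + -embL b (1 + i) x) =
          (C ^ n) y - (C ^ (n + M)) (embL b (1 + i) x) := by
        rw [map_add, map_neg, ← sub_eq_add_neg, hy, ← Module.End.mul_apply, ← pow_add]
      rw [h4, Nat.cast_succ, ← add_assoc, mem_Lat_succ]
      refine ⟨sub_mem (pow_mem_Lat hCLat n hM) (pow_mem_Lat hCLat _ (embL_mem b _ x)), ?_⟩
      rw [map_sub, redL_pow hCLat n hM, redL_pow hCLat _ (embL_mem b _ x), redL_embL, hx,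
        sub_self])
    have hwW : w ∈ W := by
      rw [hW]
      intro N
      obtain ⟨v', ⟨M, hM⟩, hv'⟩ := hw N
      refine ⟨M, Lat_anti b (by omega : (N : ℤ) ≤ 1 + N) ?_⟩
      have h5 := add_mem (pow_mem_Lat hCLat M hv') hM
      rwa [← map_add, sub_add_cancel] at h5
    rintro rfl
    rw [(Submodule.mem_bot _).1 hwW, zero_sub] at hw0
    exact h₀' (by simpa using neg_mem hw0)
  · rintro rfl
    obtain ⟨M, hM⟩ := (hW w₁).1 Submodule.mem_top 1
    -- On `w₁` the operator `C` acts modulo `t` by the nonzero scalar `m - l`, so none of its powers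
    -- moves `w₁` into `t L`.
    have h2 : ∀ i : ℕ, (C ^ i) w₁ - (m - l) ^ i • w₁ ∈ Lat b 1 := by
      intro i
      induction i with
      | zero => simp
      | succ i ih =>
        have h3 : (C ^ (i + 1)) w₁ - (m - l) ^ (i + 1) • w₁ =
            C ((C ^ i) w₁ - (m - l) ^ i • w₁) + (m - l) ^ i • (B w₁ - m • w₁) := by
          rw [map_sub, map_smul, hC w₁, pow_succ', Module.End.mul_apply, pow_succ, mul_smul,
            sub_smul, smul_sub, smul_sub, smul_sub]
          abel
        rw [h3]
        exact add_mem (hCLat _ _ ih) (Submodule.smul_mem _ _ h₁m)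
    have h4 := sub_mem (show (C ^ M) w₁ ∈ Lat b 1 by simpa using hM) (h2 M)
    rw [sub_sub_cancel] at h4
    have h5 := Submodule.smul_mem _ ((m - l) ^ M)⁻¹ h4
    rw [inv_smul_smul₀ (pow_ne_zero _ (sub_ne_zero.2 hlm.symm))] at h5
    exact h₁' h5
  · have h2 : B w = C w + (HahnSeries.C l : LaurentSeries k) • w := by
      rw [hC, C_smul, sub_add_cancel]
    rw [h2]
    exact add_mem (hWC w hw) (Submodule.smul_mem _ _ hw)

end Twist

/-! ### Cyclic operators -/

section Cyclic

variable {k : Type u} [Field k]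

/-- The characteristic polynomial `X ^ n - ∑ aᵢ X ^ i` of a cyclic operator. -/
def cyclicPoly {n : ℕ} (a : Fin n → k) : Polynomial k :=
  Polynomial.X ^ n - ∑ i : Fin n, Polynomial.C (a i) * Polynomial.X ^ (i : ℕ)

lemma cyclicPoly_monic {n : ℕ} (a : Fin n → k) : (cyclicPoly a).Monic :=
  Polynomial.monic_X_pow_sub (Polynomial.degree_sum_fin_lt a)

lemma natDegree_cyclicPoly {n : ℕ} (a : Fin n → k) : (cyclicPoly a).natDegree = n := by
  refine Polynomial.natDegree_eq_of_degree_eq_some ?_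
  rw [cyclicPoly, Polynomial.degree_sub_eq_left_of_degree_lt, Polynomial.degree_X_pow]
  rw [Polynomial.degree_X_pow]
  exact Polynomial.degree_sum_fin_lt a

lemma coeff_cyclicPoly {n : ℕ} (a : Fin n → k) (i : Fin n) : (cyclicPoly a).coeff i = -a i := by
  rw [cyclicPoly, Polynomial.coeff_sub, Polynomial.coeff_X_pow, if_neg i.2.ne,
    Polynomial.finsetSum_coeff, Finset.sum_eq_single i]
  · simp
  · intro l _ hl
    rw [Polynomial.coeff_C_mul_X_pow, if_neg fun h => hl (Fin.ext h.symm)]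
  · simp

lemma aeval_cyclicPoly {V : Type v} [AddCommGroup V] [Module k V] {n : ℕ} (a : Fin n → k)
    (B : V →ₗ[k] V) (v : V) :
    Polynomial.aeval B (cyclicPoly a) v = (B ^ n) v - ∑ i : Fin n, a i • (B ^ (i : ℕ)) v := by
  simp [cyclicPoly]

lemma cyclicPoly_eq_pow [IsAlgClosed k] {n : ℕ} {a : Fin n → k} {l : k}
    (h : ∀ m, (cyclicPoly a).IsRoot m → m = l) :
    cyclicPoly a = (Polynomial.X - Polynomial.C l) ^ n := by
  have hs := IsAlgClosed.splits (cyclicPoly a)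
  have hr : (cyclicPoly a).roots = Multiset.replicate n l := by
    rw [Multiset.eq_replicate, ← hs.natDegree_eq_card_roots, natDegree_cyclicPoly]
    exact ⟨rfl, fun m hm => h m (Polynomial.isRoot_of_mem_roots hm)⟩
  rw [hs.eq_prod_roots_of_monic (cyclicPoly_monic a), hr, Multiset.map_replicate,
    Multiset.prod_replicate]

variable {V : Type v} [AddCommGroup V] [Module k V] [Module (LaurentSeries k) V]
  [IsScalarTower k (LaurentSeries k) V]

/-- For `χ = (X - l) p`, the vector `p(B) v` is an eigenvector modulo `t` because `χ(B) v` vanishes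
there. It is nonzero modulo `t` as `p` is monic of degree `n - 1` and the iterates form a basis. -/
lemma exists_eigenvector_of_root {B : V →ₗ[k] V} {n : ℕ} {v : V}
    (b : Module.Basis (Fin n) (LaurentSeries k) V) (hb : ∀ i, b i = (B ^ (i : ℕ)) v)
    {a : Fin n → k} (ha : (B ^ n) v - ∑ i, a i • (B ^ (i : ℕ)) v ∈ Lat b 1) {l : k}
    (hl : (cyclicPoly a).IsRoot l) : ∃ w, w ∉ Lat b 1 ∧ B w - l • w ∈ Lat b 1 := by
  obtain ⟨p, hp⟩ := Polynomial.dvd_iff_isRoot.2 hl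
  have hpm : p.Monic := (Polynomial.monic_X_sub_C l).of_mul_monic_left (hp ▸ cyclicPoly_monic a)
  have hdeg : p.natDegree + 1 = n := by
    have h1 := natDegree_cyclicPoly a
    rw [hp, (Polynomial.monic_X_sub_C l).natDegree_mul hpm, Polynomial.natDegree_X_sub_C] at h1
    omega
  have hw : Polynomial.aeval B p v = embL b 0 fun i => p.coeff i := by
    rw [Polynomial.aeval_eq_sum_range' (by omega : p.natDegree < n), LinearMap.sum_apply,
      embL_apply, ← Fin.sum_univ_eq_sum_range (fun i => (p.coeff i • B ^ i) v)]
    refine Finset.sum_congr rfl fun i _ => ?_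
    rw [tpow_zero, one_smul, hb]
    rfl
  refine ⟨Polynomial.aeval B p v, fun h => ?_, ?_⟩
  · rw [← zero_add (1 : ℤ), mem_Lat_succ, hw, redL_embL] at h
    have h1 := congrFun h.2 ⟨p.natDegree, by omega⟩
    exact one_ne_zero (hpm.symm.trans h1)
  · rw [← aeval_cyclicPoly, hp, map_mul, Module.End.mul_apply] at ha
    simpa [sub_smul, Algebra.smul_def] using ha

/-- Two distinct roots of the reduced characteristic polynomial give two eigenvectors modulo `t` and
hence a proper stable subspace; otherwise the polynomial is a pure power. -/
theorem Twist.IsTwisted.exists_stable_or_eq [IsAlgClosed k] {τ : Twist k} {B : V →ₗ[k] V}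
    (hB : τ.IsTwisted B) (he : 1 ≤ τ.e) {n : ℕ} (hn : 0 < n) {v : V}
    (b : Module.Basis (Fin n) (LaurentSeries k) V) (hb : ∀ i, b i = (B ^ (i : ℕ)) v)
    (hLat : ∀ j, ∀ w ∈ Lat b j, B w ∈ Lat b j)
    {a : Fin n → k} (ha : (B ^ n) v - ∑ i, a i • (B ^ (i : ℕ)) v ∈ Lat b 1) :
    (∃ W : Submodule (LaurentSeries k) V, W ≠ ⊥ ∧ W ≠ ⊤ ∧ ∀ w ∈ W, B w ∈ W) ∨
      ∃ l : k, cyclicPoly a = (Polynomial.X - Polynomial.C l) ^ n := by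
  obtain ⟨l, hl⟩ := IsAlgClosed.exists_root (cyclicPoly a) (by
    rw [Polynomial.degree_eq_natDegree (cyclicPoly_monic a).ne_zero, natDegree_cyclicPoly]
    exact_mod_cast hn.ne')
  by_cases h : ∀ m, (cyclicPoly a).IsRoot m → m = l
  · exact Or.inr ⟨l, cyclicPoly_eq_pow h⟩
  · push Not at h
    obtain ⟨m, hm, hml⟩ := h
    obtain ⟨w₀, h₀, h₀'⟩ := exists_eigenvector_of_root b hb ha hl
    obtain ⟨w₁, h₁, h₁'⟩ := exists_eigenvector_of_root b hb ha hm
    exact Or.inl (hB.exists_stable_of_eigenvectors he b hLat hml.symm h₀ h₀' h₁ h₁')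

/-- The binomial formula relates the iterates of `B` and of `B - l` by matrices with constant
entries in both directions, so the two families span the same lattice. -/
lemma exists_translated_basis {B : V →ₗ[k] V} {n : ℕ} {v : V}
    (b : Module.Basis (Fin n) (LaurentSeries k) V) (hb : ∀ i, b i = (B ^ (i : ℕ)) v)
    (l : k) : ∃ b' : Module.Basis (Fin n) (LaurentSeries k) V,
      (∀ i, b' i = ((B - l • LinearMap.id : V →ₗ[k] V) ^ (i : ℕ)) v) ∧
        ∀ j, Lat b' j = Lat b j := by
  have hexp : ∀ (A : V →ₗ[k] V) (c : k) (i : Fin n),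
      ((A + c • LinearMap.id : V →ₗ[k] V) ^ (i : ℕ)) v =
        ∑ j : Fin n, (((i : ℕ).choose j : k) * c ^ ((i : ℕ) - j)) • (A ^ (j : ℕ)) v := by
    intro A c i
    have hcomm : Commute A (c • LinearMap.id : Module.End k V) :=
      Algebra.commute_algebraMap_right c A
    rw [Fin.sum_univ_eq_sum_range
      (fun j => (((i : ℕ).choose j : k) * c ^ ((i : ℕ) - j)) • (A ^ j) v) n]
    rw [hcomm.add_pow, LinearMap.sum_apply]
    rw [← Finset.sum_subset (Finset.range_subset_range.2 i.2)]
    · refine Finset.sum_congr rfl fun j _ => ?_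
      have h1 : (c • LinearMap.id : Module.End k V) ^ ((i : ℕ) - j) =
          c ^ ((i : ℕ) - j) • (1 : Module.End k V) := by
        rw [← Module.End.one_eq_id, smul_pow, one_pow]
      rw [h1, mul_smul]
      simp only [Module.End.mul_apply, Module.End.natCast_apply, LinearMap.smul_apply,
        Module.End.one_apply, map_smul, map_nsmul, Nat.cast_smul_eq_nsmul]
    · intro j _ hj
      rw [Nat.choose_eq_zero_of_lt (by simpa using hj)]
      simp
  refine exists_basis_of_span b (fun i => ?_)
    (fun i j => HahnSeries.C (((i : ℕ).choose j : k) * l ^ ((i : ℕ) - j)))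
    (fun i j => C_mem _) fun i => ?_
  · rw [sub_eq_add_neg, ← neg_smul, hexp]
    refine Submodule.sum_mem _ fun j _ => Submodule.smul_mem _ _ ?_
    rw [← hb]
    exact basis_mem_Lat b j
  · rw [finsum_eq_sum_of_fintype, hb]
    simp only [C_smul]
    rw [← hexp, sub_add_cancel]

end Cyclic

/-! ### The regular case -/

section Regular

variable {k : Type u} [Field k] {τ : Twist k}
  {V : Type v} [AddCommGroup V] [Module k V] [Module (LaurentSeries k) V]
  [IsScalarTower k (LaurentSeries k) V]

lemma redL_smul {ι : Type*} (b : Module.Basis ι (LaurentSeries k) V) {i j : ℤ}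
    {f : LaurentSeries k} (hf : f ∈ ordGE k i) {w : V} (hw : w ∈ Lat b j) :
    redL b (i + j) (f • w) = f.coeff i • redL b j w := by
  funext l
  rw [redL_apply, map_smul, Finsupp.smul_apply, smul_eq_mul, coeff_mul_ordGE hf (hw l)]
  rfl

lemma redL_eq_zero {ι : Type*} (b : Module.Basis ι (LaurentSeries k) V) {i : ℤ} {w : V}
    (hw : w ∈ Lat b (i + 1)) : redL b i w = 0 := ((mem_Lat_succ b).1 hw).2

/-- When `e = 0` the term `ν(t ^ i) = γ i t ^ i + …` has the same degree as the main term, so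
passing to degree `i` translates the reduced operator by `γ i`, as for the residue of a regular
connection. -/
lemma Twist.IsTwisted.redOp_eq {γ : k} (hν : τ.HasEuler γ) (he : τ.e = 0) {B : V →ₗ[k] V}
    (hB : τ.IsTwisted B) {ι : Type*} [Fintype ι] {b : Module.Basis ι (LaurentSeries k) V}
    (hLat : ∀ j, ∀ w ∈ Lat b j, B w ∈ Lat b j) (i : ℤ) :
    redOp b B i = redOp b B 0 + (γ * i) • LinearMap.id := by
  refine LinearMap.ext fun x => ?_
  have h0 := embL_mem b 0 x
  have hemb : embL b i x = tpow k i • embL b 0 x := by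
    rw [embL_apply, embL_apply, Finset.smul_sum]
    refine Finset.sum_congr rfl fun l _ => ?_
    rw [tpow_zero, one_smul, smul_smul_base]
  have h1 : B (embL b i x) = tpow k i • B (embL b 0 x) +
      ((τ.sigma (tpow k i) - tpow k i) • B (embL b 0 x) + τ.nu (tpow k i) • embL b 0 x) := by
    rw [hemb, hB, sub_smul]
    abel
  have h2 := hLat _ _ h0
  obtain ⟨h3, h4⟩ := hν i (tpow k i) (tpow_mem i)
  rw [he, add_zero] at h3 h4
  have e1 := redL_smul b (tpow_mem i) h2
  have e2 := redL_eq_zero b (i := i)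
    (smul_mem_Lat_of_le b (τ.sigma_sub_mem (tpow_mem i)) h2 (by omega))
  have e3 := redL_smul b h3 h0
  rw [add_zero] at e1 e3
  change redL b i (B (embL b i x)) = redL b 0 (B (embL b 0 x)) + (γ * i) • x
  rw [h1, map_add, map_add, e1, e2, e3, h4, redL_embL, coeff_tpow, if_pos rfl, one_smul, zero_add]
  simp

/-- In the regular case there is an eigenvector. -/
theorem Twist.IsTwisted.exists_eigenvector [IsAlgClosed k] [CharZero k] {γ : k} (hγ : γ ≠ 0)
    (hν : τ.HasEuler γ) (he : τ.e = 0) {B : V →ₗ[k] V} (hB : τ.IsTwisted B) {ι : Type*}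
    [Finite ι] [Nonempty ι] (b : Module.Basis ι (LaurentSeries k) V)
    (hLat : ∀ j, ∀ w ∈ Lat b j, B w ∈ Lat b j) : ∃ (w : V) (l : k), w ≠ 0 ∧ B w = l • w := by
  cases nonempty_fintype ι
  set β := redOp b B 0 with hβ
  obtain ⟨l₀, hl₀⟩ := Module.End.exists_eigenvalue β
  have hfin : {j : ℕ | Module.End.HasEigenvalue β (l₀ - γ * j)}.Finite :=
    (Module.End.finite_hasEigenvalue β).preimage fun i _ j _ hij => by
      have : γ * (i : k) = γ * j := sub_right_injective hij
      exact_mod_cast mul_left_cancel₀ hγ this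
  -- There are finitely many eigenvalues and `γ ≠ 0` in characteristic zero. With `j₀` maximal, no
  -- `l - γ j` with `j ≥ 1` is an eigenvalue, so `B - l` is invertible on all graded pieces of
  -- positive degree and the eigenvector lifts without obstruction.
  obtain ⟨j₀, hj₀, hmax⟩ := hfin.exists_maximal ⟨0, by simpa using hl₀⟩
  set l := l₀ - γ * j₀ with hl
  have hnot : ∀ j : ℕ, ¬ Module.End.HasEigenvalue β (l - γ * (j + 1 : ℕ)) := by
    intro j hj
    have h1 : (j₀ + (j + 1)) ∈ {j : ℕ | Module.End.HasEigenvalue β (l₀ - γ * j)} := by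
      change Module.End.HasEigenvalue β (l₀ - γ * (j₀ + (j + 1) : ℕ))
      rwa [show l₀ - γ * (j₀ + (j + 1) : ℕ) = l - γ * (j + 1 : ℕ) by rw [hl]; push_cast; ring]
    have := hmax h1 (by omega)
    omega
  set C := B - l • LinearMap.id with hCdef
  have hC : ∀ w, C w = B w - l • w := fun w => rfl
  have hCLat : ∀ j, ∀ w ∈ Lat b j, C w ∈ Lat b j := fun j w hw =>
    sub_mem (hLat j w hw) (Submodule.smul_mem _ _ hw)
  have hred : ∀ (i : ℤ) x, redOp b C i x = β x - (l - γ * i) • x := by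
    intro i x
    have h1 : redOp b C i x = redOp b B i x - l • x := by
      change redL b i (B (embL b i x) - l • embL b i x) = _
      rw [map_sub, map_smul, redL_embL]
      rfl
    rw [h1, hB.redOp_eq hν he hLat i, ← hβ, sub_smul l (γ * i)]
    simp only [LinearMap.add_apply, LinearMap.smul_apply, LinearMap.id_apply]
    abel
  have hsurj : ∀ i : ℕ, Function.Surjective (redOp b C (1 + i)) := by
    intro i
    refine LinearMap.surjective_of_injective ?_
    rw [← LinearMap.ker_eq_bot, LinearMap.ker_eq_bot']
    intro x hx
    by_contra hne
    refine hnot i (Module.End.hasEigenvalue_of_hasEigenvector (x := x)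
      ⟨Module.End.mem_eigenspace_iff.2 ?_, hne⟩)
    rw [hred, sub_eq_zero] at hx
    rw [hx]
    congr 2
    push_cast
    ring
  obtain ⟨x₀, hx₀, hx₀ne⟩ := (show Module.End.HasEigenvalue β l from hj₀).exists_hasEigenvector
  rw [Module.End.mem_eigenspace_iff] at hx₀
  obtain ⟨w, hw0, hw⟩ := exists_limit b (fun i w => C w ∈ Lat b (1 + i)) 1
    (v₀ := embL b 0 x₀) (by
      have h1 := embL_mem b 0 x₀
      rw [Nat.cast_zero, add_comm, mem_Lat_succ]
      refine ⟨hCLat _ _ h1, ?_⟩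
      rw [redL_map hCLat h1, redL_embL, hred, hx₀]
      simp) (by
      intro i w hw
      obtain ⟨x, hx⟩ := hsurj i (-redL b (1 + i) (C w))
      refine ⟨embL b (1 + i) x, embL_mem b _ x, ?_⟩
      rw [Nat.cast_succ, ← add_assoc, mem_Lat_succ, map_add]
      refine ⟨add_mem hw (hCLat _ _ (embL_mem b _ x)), ?_⟩
      rw [map_add, redL_map hCLat (embL_mem b _ x), redL_embL, hx, add_neg_cancel])
  refine ⟨w, l, ?_, ?_⟩
  · rintro rfl
    rw [zero_sub] at hw0
    have h1 : embL b 0 x₀ ∈ Lat b (0 + 1) := by simpa using neg_mem hw0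
    rw [mem_Lat_succ, redL_embL] at h1
    exact hx₀ne h1.2
  · rw [← sub_eq_zero, ← hC]
    refine eq_zero_of_forall_mem_Lat b fun N => ?_
    obtain ⟨w', hw', hww'⟩ := hw N
    have h1 := add_mem (hCLat _ _ hww') hw'
    rw [← map_add, sub_add_cancel] at h1
    exact Lat_anti b (by omega) h1

end Regular

/-! ### Ramified base change -/

section Ramified

variable {k : Type u} [Field k] [CharZero k]
  {V : Type v} [AddCommGroup V] [Module k V] [Module (LaurentSeries k) V]
  [IsScalarTower k (LaurentSeries k) V]

/-- The base change of a difference operator to a ramified extension. -/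
lemma exists_ramified (q m : ℕ) [NeZero q] [NeZero m] [NeZero (q * m)] {n : ℕ}
    (b : Module.Basis (Fin n) (LaurentSeries k) V) {Φ : V →ₗ[k] V}
    (hΦ : ∀ (f : LaurentSeries k) w, Φ (f • w) = shift k q f • Φ w)
    (hsurj : Function.Surjective Φ) :
    ∃ (j : V →ₗ[k] (Fin n → LaurentSeries k))
      (Ψ : (Fin n → LaurentSeries k) →ₗ[k] (Fin n → LaurentSeries k)),
      (∀ v i, j v i = ramify k m (b.repr v i)) ∧
      (∀ (f : LaurentSeries k) w, Ψ (f • w) = shift k (q * m) f • Ψ w) ∧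
      Function.Surjective Ψ ∧ ∀ v, Ψ (j v) = j (Φ v) := by
  let j : V →ₗ[k] (Fin n → LaurentSeries k) :=
    { toFun := fun v i => ramify k m (b.repr v i)
      map_add' := fun v w => by funext i; simp
      map_smul' := fun c v => by
        funext i
        rw [repr_base_smul, ramify_smul]
        rfl }
  have hj : ∀ (f : LaurentSeries k) v, j (f • v) = ramify k m f • j v := fun f v => by
    funext i
    change ramify k m (b.repr (f • v) i) = ramify k m f * ramify k m (b.repr v i)
    rw [map_smul, Finsupp.smul_apply, smul_eq_mul, map_mul]
  let Ψ : (Fin n → LaurentSeries k) →ₗ[k] (Fin n → LaurentSeries k) :=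
    { toFun := fun F => ∑ i, shift k (q * m) (F i) • j (Φ (b i))
      map_add' := fun F G => by
        rw [← Finset.sum_add_distrib]
        refine Finset.sum_congr rfl fun i _ => ?_
        rw [Pi.add_apply, map_add, add_smul]
      map_smul' := fun c F => by
        rw [RingHom.id_apply, Finset.smul_sum]
        refine Finset.sum_congr rfl fun i _ => ?_
        rw [Pi.smul_apply, shift_smul, smul_assoc] }
  have hΨ : ∀ F, Ψ F = ∑ i, shift k (q * m) (F i) • j (Φ (b i)) := fun F => rfl
  have hsemi : ∀ (f : LaurentSeries k) w, Ψ (f • w) = shift k (q * m) f • Ψ w := fun f w => by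
    rw [hΨ, hΨ, Finset.smul_sum]
    refine Finset.sum_congr rfl fun i _ => ?_
    rw [Pi.smul_apply, smul_eq_mul, map_mul, mul_smul]
  have hcomm : ∀ v, Ψ (j v) = j (Φ v) := fun v => by
    conv_rhs => rw [← b.sum_repr v]
    rw [hΨ, map_sum, map_sum]
    refine Finset.sum_congr rfl fun i _ => ?_
    rw [hΦ, hj, ← shift_ramify]
    rfl
  refine ⟨j, Ψ, fun v i => rfl, hsemi, fun F => ?_, hcomm⟩
  choose s hs using exists_shift_eq' (k := k) (q * m)
  choose y hy using fun i => hsurj (b i)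
  -- The map `Ψ` sends `j (y i)` to `j (b i)`, the `i`-th standard vector, and `s` inverts the shift
  -- on the coefficients.
  refine ⟨∑ i, s (F i) • j (y i), ?_⟩
  rw [map_sum]
  funext l
  rw [Finset.sum_apply, Finset.sum_eq_single l]
  · rw [hsemi, hs, hcomm, hy, Pi.smul_apply]
    change F l * ramify k m (b.repr (b l) l) = F l
    simp
  · intro i _ hi
    rw [hsemi, hs, hcomm, hy, Pi.smul_apply]
    change F i * ramify k m (b.repr (b i) l) = 0
    simp [Finsupp.single_eq_of_ne hi.symm]
  · simp

/-- The existence of a nonzero morphism to an operator of rank one over a ramified extension. -/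
def HasQuotient (q : ℕ) (Φ : V →ₗ[k] V) : Prop :=
  ∃ (M N : ℕ) (_ : NeZero M) (_ : NeZero N) (g : LaurentSeries k) (F : V →+ LaurentSeries k),
    N = q * M ∧ F ≠ 0 ∧ (∀ (f : LaurentSeries k) w, F (f • w) = ramify k M f * F w) ∧
      ∀ w, F (Φ w) = g * shift k N (F w)

/-- The map is restricted along `j`, and ramification indices multiply. It remains nonzero because
the vectors `j (b i)` span the base change. -/
lemma HasQuotient.of_ramified {V : Type v} [AddCommGroup V] [Module k V]
    [Module (LaurentSeries k) V] {q m n : ℕ} [NeZero m]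
    {b : Module.Basis (Fin n) (LaurentSeries k) V} {Φ : V →ₗ[k] V}
    {j : V →ₗ[k] (Fin n → LaurentSeries k)}
    {Ψ : (Fin n → LaurentSeries k) →ₗ[k] (Fin n → LaurentSeries k)}
    (hj : ∀ v i, j v i = ramify k m (b.repr v i)) (hcomm : ∀ v, Ψ (j v) = j (Φ v))
    (h : HasQuotient (q * m) Ψ) : HasQuotient q Φ := by
  obtain ⟨M, N, _, _, g, F, hN, hF, hF1, hF2⟩ := h
  have : NeZero (m * M) := ⟨mul_ne_zero (NeZero.ne m) (NeZero.ne M)⟩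
  refine ⟨m * M, N, inferInstance, inferInstance, g, F.comp j.toAddMonoidHom, by rw [hN, mul_assoc],
    fun h => hF ?_, fun f w => ?_, fun w => ?_⟩
  · refine DFunLike.ext _ _ fun x => ?_
    have h1 : x = ∑ i, x i • j (b i) := by
      funext l
      rw [Finset.sum_apply, Finset.sum_eq_single l]
      · rw [Pi.smul_apply, hj]; simp
      · intro i _ hi
        rw [Pi.smul_apply, hj]; simp [Finsupp.single_eq_of_ne hi.symm]
      · simp
    rw [h1, map_sum]
    refine Finset.sum_eq_zero fun i _ => ?_
    rw [hF1]
    exact mul_eq_zero_of_right _ (DFunLike.congr_fun h (b i))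
  · have h1 : j (f • w) = ramify k m f • j w := by
      funext i
      rw [Pi.smul_apply, hj, hj, map_smul, Finsupp.smul_apply, smul_eq_mul, map_mul, smul_eq_mul]
    change F (j (f • w)) = _ * F (j w)
    rw [h1, hF1, ramify_ramify]
  · change F (j (Φ w)) = g * shift k N (F (j w))
    rw [← hcomm, hF2]

/-- All difference operators of dimension `n` have a quotient of rank one. -/
def AllHaveQuotient (k : Type u) [Field k] [CharZero k] (n : ℕ) : Prop :=
  ∀ (q : ℕ) [NeZero q] (V : Type u) [AddCommGroup V] [Module k V] [Module (LaurentSeries k) V]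
    [IsScalarTower k (LaurentSeries k) V] [FiniteDimensional (LaurentSeries k) V] (Φ : V →ₗ[k] V),
    (∀ (f : LaurentSeries k) w, Φ (f • w) = shift k q f • Φ w) → Function.Surjective Φ →
    Module.finrank (LaurentSeries k) V = n → HasQuotient q Φ

/-- A nonzero map out of the smaller nonzero quotient by `W` is composed with the projection. -/
lemma HasQuotient.of_stable {n : ℕ} (ih : ∀ m < n, 0 < m → AllHaveQuotient k m) (q : ℕ) [NeZero q]
    {V : Type u} [AddCommGroup V] [Module k V] [Module (LaurentSeries k) V]
    [IsScalarTower k (LaurentSeries k) V] [FiniteDimensional (LaurentSeries k) V] {Φ : V →ₗ[k] V}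
    (hΦ : ∀ (f : LaurentSeries k) w, Φ (f • w) = shift k q f • Φ w) (hsurj : Function.Surjective Φ)
    (hn : Module.finrank (LaurentSeries k) V = n) {W : Submodule (LaurentSeries k) V} (hW0 : W ≠ ⊥)
    (hW1 : W ≠ ⊤) (hW : ∀ w ∈ W, Φ w ∈ W) : HasQuotient q Φ := by
  obtain ⟨-, s, -, -, hs, -⟩ := exists_splitting W
  have hQ := quotOp_mkQ hs hW
  have hdim := W.finrank_quotient_add_finrank
  have h0 : 0 < Module.finrank (LaurentSeries k) W :=
    Module.finrank_pos_iff.2 (Submodule.nontrivial_iff_ne_bot.2 hW0)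
  have h1 : 0 < Module.finrank (LaurentSeries k) (V ⧸ W) :=
    Module.finrank_pos_iff.2 (Submodule.Quotient.nontrivial_iff.2 hW1)
  obtain ⟨M, N, hM, hN, g, F, hNM, hF, hF1, hF2⟩ := ih _ (by omega) h1 q (V ⧸ W) (quotOp s Φ)
    (fun f y => by
      obtain ⟨v, rfl⟩ := W.mkQ_surjective y
      rw [← map_smul, hQ, hQ, hΦ, map_smul]) (fun y => by
      obtain ⟨v, rfl⟩ := W.mkQ_surjective y
      obtain ⟨w, rfl⟩ := hsurj v
      exact ⟨W.mkQ w, hQ w⟩) rfl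
  refine ⟨M, N, hM, hN, g, F.comp W.mkQ.toAddMonoidHom, hNM, fun h => hF ?_, fun f w => ?_,
    fun w => ?_⟩
  · refine DFunLike.ext _ _ fun y => ?_
    obtain ⟨v, rfl⟩ := W.mkQ_surjective y
    exact DFunLike.congr_fun h v
  · change F (W.mkQ (f • w)) = _ * F (W.mkQ w)
    rw [map_smul, hF1]
  · change F (W.mkQ (Φ w)) = g * shift k N (F (W.mkQ w))
    rw [← hQ, hF2]

lemma allHaveQuotient_one : AllHaveQuotient k 1 := by
  intro q _ V _ _ _ _ _ Φ hΦ _ hdim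
  let b : Module.Basis Unit (LaurentSeries k) V :=
    Module.basisUnique Unit hdim
  have hb : ∀ w, w = b.repr w () • b () := fun w => by
    conv_lhs => rw [← b.sum_repr w]
    simp
  refine ⟨1, q, inferInstance, inferInstance, b.repr (Φ (b ())) (),
    (b.coord ()).toAddMonoidHom, by rw [mul_one], fun h => ?_, fun f w => ?_, fun w => ?_⟩
  · have h1 : b.repr (b ()) () = 0 := DFunLike.congr_fun h (b ())
    simp at h1
  · change b.repr (f • w) () = _ * b.repr w ()
    rw [b.repr.map_smul, ramify_one, Finsupp.smul_apply, smul_eq_mul]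
  · change b.repr (Φ w) () = _ * shift k q (b.repr w ())
    conv_lhs => rw [hb w]
    rw [hΦ, b.repr.map_smul, Finsupp.smul_apply, smul_eq_mul, mul_comm]

end Ramified

/-! ### Reduction of the rank -/

section Turrittin

variable {k : Type u} [Field k]

/-- The Newton polygon of a family of coefficients has a side of smallest slope. -/
lemma exists_min_slope {n : ℕ} {c : Fin n → LaurentSeries k} (hc : ∃ i, c i ≠ 0) :
    ∃ i₀, c i₀ ≠ 0 ∧ ∀ i, c i ≠ 0 →
      (c i₀).order * (n - (i : ℕ)) ≤ (c i).order * (n - (i₀ : ℕ)) := by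
  classical
  obtain ⟨i, hi⟩ := hc
  obtain ⟨i₀, hi₀, hmin⟩ := (Finset.univ.filter fun i => c i ≠ 0).exists_min_image
    (fun i => ((c i).order : ℚ) / (n - (i : ℕ))) ⟨i, by simpa using hi⟩
  refine ⟨i₀, by simpa using hi₀, fun i hi => ?_⟩
  have hpos : ∀ i : Fin n, (0 : ℚ) < n - (i : ℕ) := fun i => by
    have : ((i : ℕ) : ℚ) < n := by exact_mod_cast i.2
    linarith
  have h1 := hmin i (by simpa using hi)
  rw [div_le_div_iff₀ (hpos _) (hpos _)] at h1
  exact_mod_cast h1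

lemma mem_ordGE_of_le_order {f : LaurentSeries k} {j : ℤ} (h : f ≠ 0 → j ≤ f.order) :
    f ∈ ordGE k j := by
  by_cases hf : f = 0
  · rw [hf]; exact zero_mem _
  · exact ordGE_anti (h hf) (mem_ordGE_order f)

lemma le_order_of_mem {f : LaurentSeries k} (hf : f ≠ 0) {j : ℤ} (h : f ∈ ordGE k j) :
    j ≤ f.order := by
  by_contra hlt
  exact coeff_order_ne hf (h _ (by omega))

lemma eq_zero_of_cyclicPoly_eq {n : ℕ} {a : Fin n → k}
    (h : cyclicPoly a = (Polynomial.X - Polynomial.C 0) ^ n) (i : Fin n) : a i = 0 := by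
  have h1 := coeff_cyclicPoly a i
  rw [h, Polynomial.C_0, sub_zero, Polynomial.coeff_X_pow, if_neg i.2.ne] at h1
  exact neg_eq_zero.1 h1.symm

lemma semilinear_injective [CharZero k] (q : ℕ) [NeZero q] {V : Type v} [AddCommGroup V]
    [Module k V] [Module (LaurentSeries k) V] [FiniteDimensional (LaurentSeries k) V] {Φ : V →ₗ[k] V}
    (hΦ : ∀ (f : LaurentSeries k) w, Φ (f • w) = shift k q f • Φ w) (hsurj : Function.Surjective Φ) :
    Function.Injective Φ := by
  let b := Module.finBasis (LaurentSeries k) V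
  have hexp : ∀ w, Φ w = ∑ i, shift k q (b.repr w i) • Φ (b i) := fun w => by
    conv_lhs => rw [← b.sum_repr w]
    rw [map_sum]
    exact Finset.sum_congr rfl fun i _ => hΦ _ _
  have hli : LinearIndependent (LaurentSeries k) (fun i => Φ (b i)) := by
    refine linearIndependent_of_top_le_span_of_card_eq_finrank (fun y _ => ?_) (by simp)
    obtain ⟨w, rfl⟩ := hsurj y
    rw [hexp w]
    exact sum_mem fun i _ => Submodule.smul_mem _ _ (Submodule.subset_span ⟨i, rfl⟩)
  refine (injective_iff_map_eq_zero Φ).2 fun w hw => ?_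
  rw [hexp w] at hw
  have h1 := Fintype.linearIndependent_iff.1 hli _ hw
  refine b.ext_elem fun i => ?_
  rw [map_zero, Finsupp.zero_apply]
  exact (shift k q).injective ((h1 i).trans (map_zero _).symm)

section Stable

variable {V : Type v} [AddCommGroup V] [Module k V] [Module (LaurentSeries k) V]
  [IsScalarTower k (LaurentSeries k) V]

lemma smulEnd_comp_diffOp (Φ : V →ₗ[k] V) (p r : ℤ) (h : LaurentSeries k) :
    smulEnd V (tpow k (-p)) ∘ₗ diffOp Φ r h = diffOp Φ (r + p) h := by
  refine LinearMap.ext fun w => ?_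
  change tpow k (-p) • tpow k (-r) • (Φ w - h • w) = tpow k (-(r + p)) • (Φ w - h • w)
  rw [smul_smul, ← tpow_add, neg_add_rev]

lemma diffOp_sub (Φ : V →ₗ[k] V) (r : ℤ) (h : LaurentSeries k) (l : k) :
    diffOp Φ r h - l • LinearMap.id = diffOp Φ r (h + l • tpow k r) := by
  refine LinearMap.ext fun w => ?_
  change tpow k (-r) • (Φ w - h • w) - l • w = tpow k (-r) • (Φ w - (h + l • tpow k r) • w)
  rw [add_smul, ← sub_sub, smul_sub _ (Φ w - h • w), smul_assoc, smul_smul_base, smul_smul,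
    tpow_neg_mul, one_smul]

lemma stable_of_diffOp {Φ : V →ₗ[k] V} {r : ℤ} {h : LaurentSeries k}
    {W : Submodule (LaurentSeries k) V} (hW : ∀ w ∈ W, diffOp Φ r h w ∈ W) (w : V) (hw : w ∈ W) :
    Φ w ∈ W := by
  have h1 : Φ w = tpow k r • diffOp Φ r h w + h • w := by
    rw [diffOp_apply, smul_smul, tpow_mul_neg, one_smul, sub_add_cancel]
  rw [h1]
  exact add_mem (W.smul_mem _ (hW w hw)) (W.smul_mem _ hw)

lemma diffOp_zero_zero (Φ : V →ₗ[k] V) : diffOp Φ 0 0 = Φ := by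
  refine LinearMap.ext fun w => ?_
  rw [diffOp_apply, neg_zero, tpow_zero, one_smul, zero_smul, sub_zero]

end Stable

variable [CharZero k] [IsAlgClosed k] {n : ℕ}
  (ih : ∀ m < n, 0 < m → AllHaveQuotient k m) (q : ℕ) [NeZero q]
  {V : Type u} [AddCommGroup V] [Module k V] [Module (LaurentSeries k) V]
  [IsScalarTower k (LaurentSeries k) V] {Φ : V →ₗ[k] V}
  (hΦ : ∀ (f : LaurentSeries k) w, Φ (f • w) = shift k q f • Φ w) (hsurj : Function.Surjective Φ)

include ih hΦ hsurj

/-- Either the rank can be reduced, or the operator has, to leading order, a unique eigenvalue. -/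
lemma hasQuotient_or_exists_translate (hn : 0 < n) {r c : ℤ} {h : LaurentSeries k}
    (hh : h ∈ ordGE k c)
    {v : V} (b : Module.Basis (Fin n) (LaurentSeries k) V)
    (hb : ∀ i, b i = (diffOp Φ r h ^ (i : ℕ)) v) {p : ℤ} (hp : p + 1 ≤ q + c - r)
    (hc : ∀ i : Fin n, b.repr ((diffOp Φ r h ^ n) v) i ∈ ordGE k (p * (n - (i : ℕ)))) :
    HasQuotient q Φ ∨ ∃ (l : k) (b' : Module.Basis (Fin n) (LaurentSeries k) V),
      cyclicPoly (fun i : Fin n =>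
        (b.repr ((diffOp Φ r h ^ n) v) i).coeff (p * (n - (i : ℕ)))) =
        (Polynomial.X - Polynomial.C l) ^ n ∧
      (∀ i, b' i = (diffOp Φ (r + p) (h + l • tpow k (r + p)) ^ (i : ℕ)) v) ∧
      (diffOp Φ (r + p) (h + l • tpow k (r + p)) ^ n) v ∈ Lat b' 1 := by
  have htw := isTwisted_diffOp q hΦ r hh
  obtain ⟨b₁, hb₁, hLat, hmem⟩ := htw.exists_rescaled_basis b hb (p := p) hp hc
  have htw₁ := isTwisted_diffOp q hΦ (r + p) hh
  simp only [smulEnd_comp_diffOp] at hb₁ hLat hmem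
  rcases htw₁.exists_stable_or_eq (by change 1 ≤ (q : ℤ) + c - (r + p); omega) hn b₁ hb₁ hLat hmem
    with ⟨W, hW0, hW1, hW⟩ | ⟨l, hl⟩
  · left
    have hfin : FiniteDimensional (LaurentSeries k) V := Module.Basis.finiteDimensional_of_finite b
    refine HasQuotient.of_stable ih q hΦ hsurj ?_ hW0 hW1 (stable_of_diffOp hW)
    rw [Module.finrank_eq_card_basis b, Fintype.card_fin]
  · right
    obtain ⟨b₂, hb₂, hLat₂⟩ := exists_translated_basis b₁ hb₁ l
    refine ⟨l, b₂, hl, by simpa only [diffOp_sub] using hb₂, ?_⟩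
    rw [← diffOp_sub, hLat₂]
    -- With a single eigenvalue the relation modulo `t` reads `(B - l)ⁿ v = 0`, and subtracting `l`
    -- from the rescaled operator amounts to adding `l t ^ (r + p)` to `h`.
    rw [← aeval_cyclicPoly, hl, map_pow] at hmem
    have h1 : Polynomial.aeval (diffOp Φ (r + p) h) (Polynomial.X - Polynomial.C l) =
        diffOp Φ (r + p) h - l • LinearMap.id := by
      rw [map_sub, Polynomial.aeval_X, Polynomial.aeval_C]
      rfl
    rwa [h1] at hmem

/-- Nonintegral slopes. -/
lemma hasQuotient_of_slope {r c : ℤ} {h : LaurentSeries k} (hh : h ∈ ordGE k c)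
    {v : V} (b : Module.Basis (Fin n) (LaurentSeries k) V)
    (hb : ∀ i, b i = (diffOp Φ r h ^ (i : ℕ)) v) {i₀ : Fin n} {p : ℤ}
    (hmin : ∀ i, b.repr ((diffOp Φ r h ^ n) v) i ≠ 0 →
      p * (n - (i : ℕ)) ≤ (b.repr ((diffOp Φ r h ^ n) v) i).order * (n - (i₀ : ℕ)))
    (hi₀ : (b.repr ((diffOp Φ r h ^ n) v) i₀).coeff p ≠ 0)
    (hdvd : ¬ ((n : ℤ) - (i₀ : ℕ)) ∣ p) (hp : p + 1 ≤ (n - (i₀ : ℕ)) * (q + c - r)) :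
    HasQuotient q Φ := by
  obtain ⟨m, hm⟩ : ∃ m : ℕ, n = i₀ + m := Nat.exists_eq_add_of_le i₀.2.le
  have hm' : (n : ℤ) - (i₀ : ℕ) = m := by omega
  rw [hm'] at hdvd hp
  have : NeZero m := ⟨by have := i₀.2; omega⟩
  have : NeZero (q * m) := ⟨mul_ne_zero (NeZero.ne q) (NeZero.ne m)⟩
  obtain ⟨j, Ψ, hj, hΨ, hΨs, hcomm⟩ := exists_ramified q m b hΦ hsurj
  refine HasQuotient.of_ramified hj hcomm ?_
  have hjs : ∀ (f : LaurentSeries k) w, j (f • w) = ramify k m f • j w := fun f w => by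
    funext i
    rw [Pi.smul_apply, hj, hj, map_smul, Finsupp.smul_apply, smul_eq_mul, map_mul, smul_eq_mul]
  have hB : ∀ (i : ℕ), (diffOp Ψ (m * r) (ramify k m h) ^ i) (j v) = j ((diffOp Φ r h ^ i) v) := by
    intro i
    induction i with
    | zero => rfl
    | succ i ih' =>
      rw [pow_succ', Module.End.mul_apply, ih', pow_succ', Module.End.mul_apply, diffOp_apply,
        diffOp_apply, hjs, map_sub, hjs, hcomm, ramify_tpow, mul_neg]
  let b' := Pi.basisFun (LaurentSeries k) (Fin n)
  have hb' : ∀ i, b' i = (diffOp Ψ (m * r) (ramify k m h) ^ (i : ℕ)) (j v) := fun i => by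
    rw [hB, ← hb, Pi.basisFun_apply]
    funext l
    rw [hj, Module.Basis.repr_self]
    by_cases hl : l = i
    · subst hl; simp
    · rw [Pi.single_eq_of_ne hl, Finsupp.single_eq_of_ne hl, map_zero]
  have hrepr : ∀ i, b'.repr ((diffOp Ψ (m * r) (ramify k m h) ^ n) (j v)) i =
      ramify k m (b.repr ((diffOp Φ r h ^ n) v) i) := fun i => by
    rw [hB, Pi.basisFun_repr, hj]
  have hn : 0 < n := i₀.pos
  -- Ramification of index `m = n - i₀` turns the slope `p / m` into the integer `p`, and `hp`
  -- becomes the strict bound required of an integral slope.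
  rcases hasQuotient_or_exists_translate (n := n) ih (q * m) hΨ hΨs hn (ramify_mem m hh) b' hb'
    (p := p) (by push_cast; linarith) (fun i => by
      rw [hrepr]
      by_cases h0 : b.repr ((diffOp Φ r h ^ n) v) i = 0
      · rw [h0, map_zero]; exact zero_mem _
      · refine ordGE_anti ?_ (ramify_mem m (mem_ordGE_order _))
        rw [mul_comm (m : ℤ), ← hm']
        exact hmin i h0) with h1 | ⟨l, -, hl, -⟩
  · exact h1
  · exfalso
    simp only [hrepr] at hl
    -- The coefficient of `X ^ (n - 1)` is read in degree `p`, which is not a multiple of `m`, so it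
    -- vanishes for a series in `t ^ m`. Hence `n l = 0` and `l = 0`, against the nonzero
    -- coefficient at `i₀`. The single-eigenvalue case cannot occur.
    have h2 := coeff_cyclicPoly (fun i : Fin n =>
      (ramify k m (b.repr ((diffOp Φ r h ^ n) v) i)).coeff (p * (n - (i : ℕ)))) ⟨n - 1, by omega⟩
    simp only at h2
    rw [hl, sub_eq_add_neg, ← Polynomial.C_neg, Polynomial.coeff_X_add_C_pow, coeff_ramify_of_not_dvd m _ (by
      rwa [Nat.cast_sub (by omega), Nat.cast_one, sub_sub_cancel, mul_one]), neg_zero,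
      Nat.sub_sub_self (by omega), pow_one] at h2
    have hl0 : l = 0 := by
      rcases mul_eq_zero.1 h2 with h3 | h3
      · exact neg_eq_zero.1 h3
      · rw [Nat.cast_eq_zero, Nat.choose_eq_zero_iff] at h3
        omega
    rw [hl0] at hl
    have h3 := eq_zero_of_cyclicPoly_eq hl i₀
    rw [hm', mul_comm, coeff_ramify_mul] at h3
    exact hi₀ h3

/-- A nonintegral slope after a first approximation. -/
lemma hasQuotient_of_not_integral {v : V} {c r : ℤ} {h : LaurentSeries k}
    (hh : h ∈ ordGE k c) (hd : 1 ≤ q + c - r)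
    (b : Module.Basis (Fin n) (LaurentSeries k) V)
    (hb : ∀ i, b i = (diffOp Φ r h ^ (i : ℕ)) v) (hnil : (diffOp Φ r h ^ n) v ∈ Lat b 1)
    (hc : ¬ ∀ i : Fin n, b.repr ((diffOp Φ r h ^ n) v) i ∈ ordGE k (1 * (n - (i : ℕ)))) :
    HasQuotient q Φ := by
  push Not at hc
  obtain ⟨i, hi⟩ := hc
  have hi0 : b.repr ((diffOp Φ r h ^ n) v) i ≠ 0 := fun h0 => hi (by rw [h0]; exact zero_mem _)
  obtain ⟨i₀, hi₀, hmin⟩ := exists_min_slope ⟨i, hi0⟩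
  have h1 : (b.repr ((diffOp Φ r h ^ n) v) i).order < n - (i : ℕ) := by
    by_contra h2
    exact hi (ordGE_anti (by omega) (mem_ordGE_order _))
  have h2 := hmin i hi0
  have h3 := le_order_of_mem hi₀ (hnil i₀)
  have hpos : ∀ i : Fin n, (1 : ℤ) ≤ n - (i : ℕ) := fun i => by have := i.2; omega
  have h4 : (b.repr ((diffOp Φ r h ^ n) v) i₀).order < n - (i₀ : ℕ) := by
    have := hpos i
    have := hpos i₀
    by_contra! h5
    nlinarith
  -- Nilpotence modulo `t` makes the smallest slope positive, and the failure of `hc` makes it less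
  -- than one; it is not an integer.
  refine hasQuotient_of_slope ih q hΦ hsurj hh b hb hmin (coeff_order_ne hi₀) (fun hdvd => ?_) ?_
  · exact absurd (Int.le_of_dvd (by omega) hdvd) (by omega)
  · have := hpos i₀
    nlinarith

/-- The successive approximation of an eigenvalue. -/
lemma hasQuotient_of_nilpotent (hn : 2 ≤ n) {v : V} {c : ℤ} (d : ℕ) {r : ℤ} {h : LaurentSeries k}
    (hh : h ∈ ordGE k c) (hhc : h.coeff c ≠ 0) (hcr : c ≤ r) (hd : q + c - r = d + 1)
    (b : Module.Basis (Fin n) (LaurentSeries k) V)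
    (hb : ∀ i, b i = (diffOp Φ r h ^ (i : ℕ)) v) (hnil : (diffOp Φ r h ^ n) v ∈ Lat b 1) :
    HasQuotient q Φ := by
  induction d generalizing r h b with
  | zero =>
    by_cases hc : ∀ i : Fin n, b.repr ((diffOp Φ r h ^ n) v) i ∈ ordGE k (1 * (n - (i : ℕ)))
    -- Here the twist has degree one, and division by `t` brings it to degree zero: the operator is
    -- regular, and an eigenvector spans a stable line, proper because `n ≥ 2`. Its nonzero Euler
    -- coefficient comes from `h.coeff c`.
    · obtain ⟨e, -, -, -, hLat⟩ := (isTwisted_diffOp q hΦ r hh).exists_rescaled_lattice b hb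
        (p := 1) (by change 1 ≤ (q : ℤ) + c - r; omega) hc
      rw [smulEnd_comp_diffOp] at hLat
      have : Nonempty (Fin n) := ⟨⟨0, by omega⟩⟩
      obtain ⟨w, l, hw, hl⟩ := (isTwisted_diffOp q hΦ (r + 1) hh).exists_eigenvector
        (div_ne_zero (neg_ne_zero.2 hhc) (Nat.cast_ne_zero.2 (NeZero.ne q)))
        (diffTwist_hasEuler q (r + 1) hh) (by change (q : ℤ) + c - (r + 1) = 0; omega) e hLat
      have hfin : FiniteDimensional (LaurentSeries k) V := Module.Basis.finiteDimensional_of_finite b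
      have hrank : Module.finrank (LaurentSeries k) V = n := by
        rw [Module.finrank_eq_card_basis b, Fintype.card_fin]
      refine HasQuotient.of_stable ih q hΦ hsurj hrank
        (W := Submodule.span (LaurentSeries k) {w}) (by simpa using hw) (fun h1 => ?_) ?_
      · have h2 := finrank_span_singleton (K := LaurentSeries k) hw
        rw [h1, finrank_top, hrank] at h2
        omega
      · intro y hy
        obtain ⟨f, rfl⟩ := Submodule.mem_span_singleton.1 hy
        have h1 : Φ w = (tpow k (r + 1) * HahnSeries.C l + h) • w := by
          rw [add_smul, mul_smul, C_smul, ← hl, diffOp_apply, smul_smul, tpow_mul_neg, one_smul,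
            sub_add_cancel]
        rw [hΦ, h1, smul_smul]
        exact Submodule.smul_mem _ _ (Submodule.mem_span_singleton_self w)
    · exact hasQuotient_of_not_integral ih q hΦ hsurj hh (by omega) b hb hnil hc
  | succ d ihd =>
    by_cases hc : ∀ i : Fin n, b.repr ((diffOp Φ r h ^ n) v) i ∈ ordGE k (1 * (n - (i : ℕ)))
    · rcases hasQuotient_or_exists_translate ih q hΦ hsurj (by omega) hh b hb (p := 1)
        (by push_cast at hd; omega) hc with h1 | ⟨l, b', -, hb', hnil'⟩
      · exact h1
      -- Passing from `r` to `r + 1` lowers the degree `q + c - r` by one. The correction has order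
      -- greater than `c`, so the leading coefficient of `h` is unchanged.
      · refine ihd (r := r + 1) (h := h + l • tpow k (r + 1))
          (add_mem hh (Submodule.smul_mem _ _ (tpow_mem_of_le (by omega)))) ?_ (by omega)
          (by push_cast at hd; omega) b' hb' hnil'
        rw [HahnSeries.coeff_add, HahnSeries.coeff_smul, coeff_tpow, if_neg (by omega), smul_zero,
          add_zero]
        exact hhc
    · exact hasQuotient_of_not_integral ih q hΦ hsurj hh (by push_cast at hd; omega) b hb hnil hc

/-- The smallest slope of `Φ` itself exists because injectivity gives `Φⁿ v ≠ 0`. If it is an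
integer `r`, either the rank drops or `Φ` is approximated by `l t ^ r` with `l ≠ 0`, after which
`hasQuotient_of_nilpotent` refines the approximation; otherwise `hasQuotient_of_slope` applies. -/
theorem hasQuotient_of_cyclic (hn : 2 ≤ n) {v : V} (b : Module.Basis (Fin n) (LaurentSeries k) V)
    (hb : ∀ i, b i = (Φ ^ (i : ℕ)) v) : HasQuotient q Φ := by
  have hfin : FiniteDimensional (LaurentSeries k) V := Module.Basis.finiteDimensional_of_finite b
  have hinj := semilinear_injective q hΦ hsurj
  have hv : v ≠ 0 := by
    have h1 := b.ne_zero ⟨0, by omega⟩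
    rwa [hb, pow_zero] at h1
  have hne : ∃ i, b.repr ((Φ ^ n) v) i ≠ 0 := by
    by_contra! h0
    have h1 : (Φ ^ n) v = 0 := b.ext_elem fun i => by rw [h0 i, map_zero, Finsupp.zero_apply]
    rw [Module.End.pow_apply] at h1
    exact hv (hinj.iterate n (h1.trans (iterate_map_zero Φ n).symm))
  obtain ⟨i₀, hi₀, hmin⟩ := exists_min_slope hne
  have hpos : ∀ i : Fin n, (1 : ℤ) ≤ n - (i : ℕ) := fun i => by have := i.2; omega
  have hq : (1 : ℤ) ≤ q := by have := NeZero.pos q; omega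
  set p := (b.repr ((Φ ^ n) v) i₀).order with hp
  have hzero : ∀ c : ℤ, (0 : LaurentSeries k) ∈ ordGE k c := fun c => zero_mem _
  by_cases hdvd : ((n : ℤ) - (i₀ : ℕ)) ∣ p
  · obtain ⟨r, hr⟩ := hdvd
    have hc : ∀ i : Fin n, b.repr ((Φ ^ n) v) i ∈ ordGE k (r * (n - (i : ℕ))) := fun i =>
      mem_ordGE_of_le_order fun h0 => by
        have h1 := hmin i h0
        rw [hr] at h1
        have h2 := hpos i₀
        nlinarith
    -- For `h = 0` the integer `c` is a free parameter, and `r + 1` is large enough for the bound on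
    -- the slope.
    rcases hasQuotient_or_exists_translate ih q hΦ hsurj (by omega) (hzero (r + 1)) (v := v)
      (r := 0) b (by simpa only [diffOp_zero_zero] using hb) (p := r) (by omega)
      (by simpa only [diffOp_zero_zero] using hc) with h1 | ⟨l, b', hl, hb', hnil⟩
    · exact h1
    · simp only [diffOp_zero_zero] at hl
      simp only [zero_add] at hb' hnil
      have hl0 : l ≠ 0 := by
        rintro rfl
        have h1 := eq_zero_of_cyclicPoly_eq hl i₀
        rw [mul_comm, ← hr] at h1
        exact coeff_order_ne hi₀ h1
      -- With `h = l t ^ r` both `c` and the scaling exponent equal `r`, so the degree of the twist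
      -- is `q`; this is the number of remaining approximation steps.
      obtain ⟨d, hd⟩ : ∃ d : ℕ, q = d + 1 := Nat.exists_eq_succ_of_ne_zero (NeZero.ne q)
      refine hasQuotient_of_nilpotent ih q hΦ hsurj hn (c := r) d
        (Submodule.smul_mem _ _ (tpow_mem r)) ?_ le_rfl (by rw [hd]; push_cast; ring) b' hb' hnil
      rw [HahnSeries.coeff_smul, coeff_tpow, if_pos rfl, smul_eq_mul, mul_one]
      exact hl0
  · refine hasQuotient_of_slope ih q hΦ hsurj (hzero (|p| + 1)) (r := 0) (v := v) b
      (by simpa only [diffOp_zero_zero] using hb) (i₀ := i₀) (p := p)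
      (by simpa only [diffOp_zero_zero] using hmin) ?_ hdvd ?_
    · rw [diffOp_zero_zero]; exact coeff_order_ne hi₀
    · have h1 := le_abs_self p
      have h2 := abs_nonneg p
      have h3 := hpos i₀
      nlinarith

end Turrittin

/-! ### Ramified rank one quotients of all difference operators -/

section Main

variable {k : Type u} [Field k] [CharZero k] [IsAlgClosed k]

/-- Induction on the rank: a nonzero vector generates a cyclic stable subspace. If it is proper, the
rank drops; if not, `hasQuotient_of_cyclic` applies. -/
theorem allHaveQuotient (n : ℕ) : 0 < n → AllHaveQuotient k n := by
  induction n using Nat.strong_induction_on with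
  | _ n ih =>
    intro hn
    rcases Nat.lt_or_ge n 2 with h1 | h2
    · obtain rfl : n = 1 := by omega
      exact allHaveQuotient_one
    intro q _ V _ _ _ _ _ Φ hΦ hsurj hrank
    have : Nontrivial V := Module.nontrivial_of_finrank_pos (R := LaurentSeries k) (by omega)
    obtain ⟨v, hv⟩ := exists_ne (0 : V)
    obtain ⟨m, hli, hmem⟩ := exists_linearIndependent_initial (K := LaurentSeries k)
      fun i => (Φ ^ i) v
    have hm : 0 < m := by
      rcases Nat.eq_zero_or_pos m with rfl | h
      · simp at hmem; exact absurd hmem hv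
      · exact h
    have hW : ∀ w ∈ Submodule.span (LaurentSeries k) (Set.range fun i : Fin m => (Φ ^ (i : ℕ)) v),
        Φ w ∈ Submodule.span (LaurentSeries k) (Set.range fun i : Fin m => (Φ ^ (i : ℕ)) v) := by
      intro w hw
      have h3 := isTwisted_diffOp q hΦ 0 (zero_mem (ordGE k 0))
      rw [diffOp_zero_zero] at h3
      exact h3.mem_span hmem hw
    by_cases htop : Submodule.span (LaurentSeries k) (Set.range fun i : Fin m => (Φ ^ (i : ℕ)) v) = ⊤
    · let b := Module.Basis.mk hli htop.ge
      obtain rfl : m = n := by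
        rw [← hrank, Module.finrank_eq_card_basis b, Fintype.card_fin]
      exact hasQuotient_of_cyclic ih q hΦ hsurj h2 b fun i => by rw [Module.Basis.mk_apply]
    · refine HasQuotient.of_stable ih q hΦ hsurj hrank (fun h0 => ?_) htop hW
      have h3 := Submodule.subset_span (R := LaurentSeries k)
        (Set.mem_range_self (f := fun i : Fin m => (Φ ^ (i : ℕ)) v) ⟨0, hm⟩)
      rw [h0] at h3
      exact hv (by simpa using h3)

/-- Base change of index one replaces `V` by `Kⁿ`, which lies in the universe of `k`, where the
induction was carried out. -/
theorem hasQuotient (q : ℕ) [NeZero q] {V : Type v} [AddCommGroup V] [Module k V]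
    [Module (LaurentSeries k) V] [IsScalarTower k (LaurentSeries k) V]
    [FiniteDimensional (LaurentSeries k) V] [Nontrivial V] {Φ : V →ₗ[k] V}
    (hΦ : ∀ (f : LaurentSeries k) w, Φ (f • w) = shift k q f • Φ w)
    (hsurj : Function.Surjective Φ) : HasQuotient q Φ := by
  have : NeZero (q * 1) := ⟨by rw [mul_one]; exact NeZero.ne q⟩
  obtain ⟨j, Ψ, hj, hΨ, hΨs, hcomm⟩ :=
    exists_ramified q 1 (Module.finBasis (LaurentSeries k) V) hΦ hsurj
  exact HasQuotient.of_ramified hj hcomm (allHaveQuotient (Module.finrank (LaurentSeries k) V)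
    Module.finrank_pos (q * 1) _ _ hΨ hΨs
    (by simp))

end Main

/-! ### Rotations of the coordinate and descent -/

section Rot

variable {k : Type u} [Field k]

/-- The substitution `t ↦ ζ t`. -/
def rot (ζ : kˣ) : LaurentSeries k →+* LaurentSeries k :=
  laurentSubst (PowerSeries.C (ζ : k) * PowerSeries.X) (by simp)
    (mul_ne_zero (by simp) X_ne_zero)

lemma rot_smul (ζ : kˣ) (c : k) (f : LaurentSeries k) : rot ζ (c • f) = c • rot ζ f :=
  laurentSubst_smul _ _ c f

lemma rot_tpow (ζ : kˣ) (j : ℤ) : rot ζ (tpow k j) = ((ζ ^ j : kˣ) : k) • tpow k j := by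
  rw [rot, laurentSubst_tpow, map_mul, HahnSeries.ofPowerSeries_X, HahnSeries.ofPowerSeries_C,
    mul_zpow, ← map_zpow₀, smul_eq_C_mul, Units.val_zpow_eq_zpow_val, tpow_eq_zpow j]
  rfl

lemma rot_mem (ζ : kˣ) {j : ℤ} {f : LaurentSeries k} (hf : f ∈ ordGE k j) :
    rot ζ f ∈ ordGE k j := by
  obtain ⟨p, rfl⟩ := exists_eq_tpow_mul hf
  rw [map_mul, rot_tpow, smul_mul_assoc, rot, laurentSubst_coe]
  refine Submodule.smul_mem _ _ ?_
  rw [tpow_mul_mem, sub_self]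
  exact ofPowerSeries_mem _

lemma coeff_rot (ζ : kˣ) (f : LaurentSeries k) (j : ℤ) :
    (rot ζ f).coeff j = ((ζ ^ j : kˣ) : k) * f.coeff j := by
  obtain ⟨a, ha⟩ := exists_mem_ordGE f
  refine ordGE_induction (p := fun f => (rot ζ f).coeff j = ((ζ ^ j : kˣ) : k) * f.coeff j)
    (N := j + 1) ?_ ?_ ?_ ha
  · intro f g hf hg
    rw [map_add, HahnSeries.coeff_add, HahnSeries.coeff_add, hf, hg, mul_add]
  · intro i _ c
    rw [rot_smul, rot_tpow]
    simp only [HahnSeries.coeff_smul, coeff_tpow, smul_eq_mul]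
    by_cases h : j = i
    · subst h; simp [mul_comm]
    · simp [h]
  · intro f hf
    rw [hf j (by omega), rot_mem ζ hf j (by omega), mul_zero]

lemma rot_one (f : LaurentSeries k) : rot 1 f = f := by
  ext j
  rw [coeff_rot, one_zpow, Units.val_one, one_mul]

lemma rot_rot (ζ ξ : kˣ) (f : LaurentSeries k) : rot ζ (rot ξ f) = rot (ζ * ξ) f := by
  ext j
  rw [coeff_rot, coeff_rot, coeff_rot, mul_zpow, Units.val_mul, mul_assoc]

lemma rot_ramify {ζ : kˣ} {m : ℕ} [NeZero m] (hζ : ζ ^ m = 1) (f : LaurentSeries k) :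
    rot ζ (ramify k m f) = ramify k m f := by
  ext j
  rw [coeff_rot]
  by_cases hj : (m : ℤ) ∣ j
  · obtain ⟨i, rfl⟩ := hj
    rw [zpow_mul, zpow_natCast, hζ, one_zpow, Units.val_one, one_mul]
  · rw [coeff_ramify_of_not_dvd m f hj, mul_zero]

/-- Invariance forces `ζ ^ j = 1` for each exponent `j` with nonzero coefficient, so all these
exponents are multiples of the order `m` of `ζ`. -/
lemma ramify_dec_of_rot_eq {ζ : kˣ} {m : ℕ} [NeZero m] (hm : orderOf ζ = m) {f : LaurentSeries k}
    (hf : rot ζ f = f) : ramify k m (dec k m 0 f) = f := by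
  ext j
  by_cases hj : (m : ℤ) ∣ j
  · obtain ⟨i, rfl⟩ := hj
    rw [coeff_ramify_mul, coeff_dec, Nat.cast_zero, add_zero]
  · rw [coeff_ramify_of_not_dvd m _ hj]
    by_contra h0
    have h1 := coeff_rot ζ f j
    rw [hf] at h1
    have h2 : ((ζ ^ j : kˣ) : k) = 1 := by
      have := sub_eq_zero.2 h1
      rw [← one_sub_mul] at this
      rcases mul_eq_zero.1 this with h | h
      · exact (sub_eq_zero.1 h).symm
      · exact absurd h.symm h0
    rw [← hm, orderOf_dvd_iff_zpow_eq_one] at hj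
    exact hj (Units.val_eq_one.1 h2)

lemma shift_rot [CharZero k] {q : ℕ} [NeZero q] {ζ : kˣ} (hζ : ζ ^ q = 1) (f : LaurentSeries k) :
    shift k q (rot ζ f) = rot ζ (shift k q f) := by
  let R : LaurentSeries k →ₗ[k] LaurentSeries k :=
    { toFun := rot ζ, map_add' := map_add _, map_smul' := rot_smul ζ }
  have h1 : ∀ y, rot ζ (onePow k q y) = onePow k q y := fun y => by
    have : onePow k q y = ramify k q (HahnSeries.ofPowerSeries ℤ k (binomialSeries k y)) := by
      rw [onePow, ramify, laurentSubst_coe, ← expand_apply q (NeZero.ne q)]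
    rw [this, rot_ramify hζ]
  have := eq_zero_of_tpow (Module.Basis.singleton Unit (LaurentSeries k))
    ((shiftLin k q).comp R - R.comp (shiftLin k q)) ?_ ?_ f
  · exact sub_eq_zero.1 this
  · intro j
    change shift k q (rot ζ _) - rot ζ (shift k q _) = 0
    rw [rot_tpow, shift_smul, shift_tpow, map_mul, rot_tpow, h1, smul_mul_assoc, sub_self]
  · refine fun N => ⟨N, fun f hf _ => ?_⟩
    simp only [Module.Basis.singleton_repr]
    exact sub_mem (shift_mem _ (rot_mem ζ hf)) (rot_mem _ (shift_mem q hf))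

end Rot

/-- The ambient space of maps may have infinite dimension, so the eigenvector comes from a
polynomial annihilating one vector: linear factors are removed until the next quotient no longer
kills it. -/
lemma exists_eigenvector_of_aeval {k E : Type*} [Field k] [IsAlgClosed k] [AddCommGroup E]
    [Module k E] {W : Submodule k E} {T : Module.End k E} (hT : ∀ w ∈ W, T w ∈ W)
    {p : Polynomial k} (hp : p ≠ 0) {w : E} (hw : w ∈ W) (hw0 : w ≠ 0)
    (hpw : Polynomial.aeval T p w = 0) : ∃ w' ∈ W, ∃ l : k, w' ≠ 0 ∧ T w' = l • w' := by
  have hW : ∀ p : Polynomial k, ∀ w ∈ W, Polynomial.aeval T p w ∈ W := fun p w hw => by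
    induction p using Polynomial.induction_on' with
    | add p q hp hq => rw [map_add]; exact add_mem hp hq
    | monomial n a =>
      rw [Polynomial.aeval_monomial, Module.End.mul_apply, Module.algebraMap_end_apply]
      refine W.smul_mem _ ?_
      induction n with
      | zero => exact hw
      | succ n ih => rw [pow_succ', Module.End.mul_apply]; exact hT _ ih
  induction hn : p.natDegree generalizing p with
  | zero =>
    rw [Polynomial.eq_C_of_natDegree_eq_zero hn] at hpw hp
    rw [Polynomial.aeval_C, Module.algebraMap_end_apply] at hpw
    exact absurd ((smul_eq_zero.1 hpw).resolve_right hw0) (by simpa using hp)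
  | succ n ih =>
    obtain ⟨r, hr⟩ := IsAlgClosed.exists_root p (by
      rw [Polynomial.degree_eq_natDegree hp, hn]; exact_mod_cast Nat.succ_ne_zero n)
    obtain ⟨p', rfl⟩ := Polynomial.dvd_iff_isRoot.2 hr
    have hp' : p' ≠ 0 := right_ne_zero_of_mul hp
    by_cases h0 : Polynomial.aeval T p' w = 0
    · refine ih hp' h0 ?_
      rw [Polynomial.natDegree_mul (Polynomial.X_sub_C_ne_zero r) hp',
        Polynomial.natDegree_X_sub_C] at hn
      omega
    · refine ⟨_, hW p' w hw, r, h0, ?_⟩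
      rw [map_mul, Module.End.mul_apply, map_sub, Polynomial.aeval_X, Polynomial.aeval_C,
        LinearMap.sub_apply, Module.algebraMap_end_apply] at hpw
      exact sub_eq_zero.1 hpw

/-! ### Minimal ramification and the irreducible difference modules -/

section Descent

variable {k : Type u} [Field k] [CharZero k]

section

variable {V : Type v} [AddCommGroup V] [Module k V] [Module (LaurentSeries k) V]

/-- The morphisms from `(V, Φ)` to `D_{g,M}`. -/
def mapsTo (Φ : V →ₗ[k] V) (M : ℕ) [NeZero M] (g : LaurentSeries k) :
    Submodule k (V →ₗ[k] LaurentSeries k) where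
  carrier := {G | (∀ (f : LaurentSeries k) w, G (f • w) = ramify k M f * G w) ∧
    ∀ w, G (Φ w) = g * shift k M (G w)}
  zero_mem' := ⟨fun _ _ => by simp, fun _ => by simp⟩
  add_mem' {a b} ha hb := ⟨fun f w => by
    rw [LinearMap.add_apply, ha.1, hb.1, LinearMap.add_apply, mul_add], fun w => by
    rw [LinearMap.add_apply, ha.2, hb.2, LinearMap.add_apply, map_add, mul_add]⟩
  smul_mem' c a ha := ⟨fun f w => by
    rw [LinearMap.smul_apply, ha.1, LinearMap.smul_apply, mul_smul_comm], fun w => by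
    rw [LinearMap.smul_apply, ha.2, LinearMap.smul_apply, shift_smul, mul_smul_comm]⟩

/-- The operator `f ↦ c⁻¹ f(ζ t)`. -/
def rotMul (ζ : kˣ) (c : LaurentSeries k) : Module.End k (LaurentSeries k) where
  toFun f := c⁻¹ * rot ζ f
  map_add' f g := by rw [map_add, mul_add]
  map_smul' a f := by rw [rot_smul, mul_smul_comm, RingHom.id_apply]

omit [CharZero k] in
lemma rotMul_pow (ζ : kˣ) (c f : LaurentSeries k) (i : ℕ) :
    (rotMul ζ c ^ i) f = (∏ j ∈ Finset.range i, rot (ζ ^ j) c)⁻¹ * rot (ζ ^ i) f := by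
  induction i generalizing f with
  | zero =>
    change f = _
    simp [rot_one]
  | succ i ih =>
    rw [pow_succ, Module.End.mul_apply, ih, Finset.prod_range_succ, mul_inv, mul_assoc]
    change _ * rot _ (c⁻¹ * rot ζ f) = _
    rw [map_mul, rot_rot, map_inv₀, ← pow_succ]

/-- Descent of a morphism along a rotation. -/
lemma exists_mapsTo_of_rot [IsAlgClosed k] {Φ : V →ₗ[k] V} (hsurj : Function.Surjective Φ) {M : ℕ}
    [NeZero M] {g : LaurentSeries k} {F : V →ₗ[k] LaurentSeries k} (hF : F ∈ mapsTo Φ M g)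
    (hF0 : F ≠ 0) {ζ : kˣ} (hζ : ζ ^ M = 1) (hζ1 : ζ ≠ 1) {c : LaurentSeries k} (hc : c ≠ 0)
    (hgc : rot ζ g * shift k M c = g * c) :
    ∃ (M' : ℕ) (_ : NeZero M') (g' : LaurentSeries k) (F' : V →ₗ[k] LaurentSeries k),
      M' < M ∧ F' ∈ mapsTo Φ M' g' ∧ F' ≠ 0 := by
  obtain ⟨m, hm⟩ : ∃ m, orderOf ζ = m := ⟨_, rfl⟩
  obtain ⟨M', hM'⟩ : m ∣ M := hm ▸ orderOf_dvd_of_pow_eq_one hζ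
  have hMne := NeZero.ne M
  have : NeZero m := ⟨fun h => hMne (by rw [hM', h, zero_mul])⟩
  have : NeZero M' := ⟨fun h => hMne (by rw [hM', h, mul_zero])⟩
  have hm2 : 2 ≤ m := by
    have h1 : m ≠ 1 := fun h => hζ1 (orderOf_eq_one_iff.1 (hm.trans h))
    have h0 := NeZero.ne m
    omega
  -- The relation `hgc` says that `c` is an isomorphism between `D_{g,M}` and its conjugate by `ζ`;
  -- twisting by it gives the operator `T`, which preserves the morphisms to `D_{g,M}`.
  let T : Module.End k (V →ₗ[k] LaurentSeries k) := LinearMap.compRight k (rotMul ζ c)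
  have hTpow : ∀ i G w, (T ^ i) G w = (rotMul ζ c ^ i) (G w) := fun i => by
    induction i with
    | zero => exact fun _ _ => rfl
    | succ i ih =>
      intro G w
      rw [pow_succ, Module.End.mul_apply, ih, pow_succ, Module.End.mul_apply]
      rfl
  have hsc : shift k M c ≠ 0 := (map_ne_zero _).2 hc
  have hT : ∀ G ∈ mapsTo Φ M g, T G ∈ mapsTo Φ M g := fun G hG => by
    refine ⟨fun f w => ?_, fun w => ?_⟩
    · change c⁻¹ * rot ζ (G (f • w)) = _ * (c⁻¹ * rot ζ (G w))
      rw [hG.1, map_mul, rot_ramify hζ, mul_left_comm]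
    · change c⁻¹ * rot ζ (G (Φ w)) = g * shift k M (c⁻¹ * rot ζ (G w))
      rw [hG.2, map_mul, map_mul, shift_rot hζ, map_inv₀]
      field_simp
      rw [mul_right_comm, hgc]
      ring
  obtain ⟨w₀, hw₀⟩ : ∃ w, F (Φ w) ≠ 0 := by
    by_contra! h
    refine hF0 (LinearMap.ext fun w => ?_)
    obtain ⟨w', rfl⟩ := hsurj w
    exact h w'
  set A := ∏ j ∈ Finset.range m, rot (ζ ^ j) c with hA
  have hA0 : A ≠ 0 := Finset.prod_ne_zero_iff.2 fun j _ => (map_ne_zero _).2 hc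
  have hTm : ∀ G w, (T ^ m) G w = A⁻¹ * G w := fun G w => by
    rw [hTpow, rotMul_pow, ← hm, pow_orderOf_eq_one, rot_one, hm]
  have hTmem : (T ^ m) F ∈ mapsTo Φ M g := by
    generalize m = i
    induction i with
    | zero => exact hF
    | succ i ih => rw [pow_succ', Module.End.mul_apply]; exact hT _ ih
  -- Since `ζ ^ m = 1`, `T ^ m` is multiplication by `A⁻¹`. Comparing the equivariance of `F` and
  -- `A⁻¹ F` at a vector with `F (Φ w₀) ≠ 0` shows that `A⁻¹` is shift-invariant, hence a constant
  -- `a`. The polynomial `X ^ m - a` then annihilates `F`.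
  have hAs : shift k M A⁻¹ = A⁻¹ := by
    have h1 := hTmem.2 w₀
    rw [hTm, hTm, map_mul, mul_left_comm, ← hF.2] at h1
    exact (mul_right_cancel₀ hw₀ h1).symm
  have hAC := eq_C_of_shift_eq M hAs
  set a := (A⁻¹).coeff 0
  obtain ⟨G, hG, l, hG0, hGl⟩ := exists_eigenvector_of_aeval hT
    (p := Polynomial.X ^ m - Polynomial.C a)
    (Polynomial.X_pow_sub_C_ne_zero (NeZero.pos m) a) hF hF0 (by
      refine LinearMap.ext fun w => ?_
      rw [map_sub, map_pow, Polynomial.aeval_X, Polynomial.aeval_C, LinearMap.sub_apply,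
        Module.algebraMap_end_apply, LinearMap.sub_apply, hTm, hAC, LinearMap.smul_apply,
        smul_eq_C_mul, sub_self, LinearMap.zero_apply])
  obtain ⟨v₀, hv₀⟩ : ∃ w, G w ≠ 0 := by
    by_contra! h
    exact hG0 (LinearMap.ext h)
  have hrot : ∀ w, rot ζ (G w) = l • (c * G w) := fun w => by
    have h1 : c⁻¹ * rot ζ (G w) = l • G w := congrArg (fun H : V →ₗ[k] LaurentSeries k => H w) hGl
    rw [← mul_smul_comm, ← h1, mul_inv_cancel_left₀ hc]
  have hl : l ≠ 0 := by
    rintro rfl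
    have h1 := hrot v₀
    rw [zero_smul] at h1
    exact hv₀ ((_root_.map_eq_zero _).1 h1)
  -- The rotation multiplies every value of the eigenvector `G` by the same factor `l c`, so ratios
  -- of values are invariant and lie in the subfield of index `m`. This lowers the ramification to
  -- `M' = M / m`.
  have hfix : ∀ w, rot ζ (G w / G v₀) = G w / G v₀ := fun w => by
    have hl' : (HahnSeries.C l : LaurentSeries k) ≠ 0 := by simpa using hl
    rw [map_div₀, hrot, hrot, smul_eq_C_mul, smul_eq_C_mul]
    field_simp
  have hH : ∀ w, ramify k m (dec k m 0 (G w / G v₀)) = G w / G v₀ := fun w =>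
    ramify_dec_of_rot_eq hm (hfix w)
  have hdec : ∀ f, dec k m 0 (ramify k m f) = f := fun f => by
    have := dec_tpow_mul_ramify m (NeZero.pos m) (NeZero.pos m) f
    rwa [Nat.cast_zero, tpow_zero, one_mul, if_pos rfl] at this
  obtain rfl : M = M' * m := by rw [hM', mul_comm]
  have hs0 : shift k (M' * m) (G v₀) ≠ 0 := (map_ne_zero _).2 hv₀
  refine ⟨M', inferInstance, dec k m 0 (G (Φ v₀) / G v₀),
    dec k m 0 ∘ₗ { toFun := fun w => G w / G v₀, map_add' := ?_, map_smul' := ?_ }, ?_, ⟨?_, ?_⟩, ?_⟩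
  · intro w w'; rw [map_add, add_div]
  · intro b w; rw [map_smul, RingHom.id_apply, div_eq_mul_inv, div_eq_mul_inv, smul_mul_assoc]
  · have := NeZero.pos M'
    nlinarith
  · intro f w
    change dec k m 0 (G (f • w) / G v₀) = _ * dec k m 0 (G w / G v₀)
    rw [hG.1, mul_div_assoc, ← ramify_ramify, dec_ramify_mul m 0 (NeZero.pos m)]
  · intro w
    change dec k m 0 (G (Φ w) / G v₀) = _ * shift k M' (dec k m 0 (G w / G v₀))
    refine (ramify k m).injective ?_
    rw [map_mul, ← shift_ramify, hH, hH, hH, hG.2, hG.2, map_div₀]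
    field_simp
  · intro h
    have h1 : dec k m 0 (G v₀ / G v₀) = 0 := congrArg (fun H : V →ₗ[k] LaurentSeries k => H v₀) h
    rw [div_self hv₀] at h1
    have h2 := hdec 1
    rw [map_one, h1] at h2
    exact zero_ne_one h2

lemma mapsTo_apply_eq_sum {Φ : V →ₗ[k] V} {M : ℕ} [NeZero M] {g : LaurentSeries k}
    {F : V →ₗ[k] LaurentSeries k} (hF : F ∈ mapsTo Φ M g) {ι : Type*} [Fintype ι]
    (b : Module.Basis ι (LaurentSeries k) V) (w : V) :
    F w = ∑ i, ramify k M (b.repr w i) * F (b i) := by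
  conv_lhs => rw [← b.sum_repr w]
  rw [map_sum]
  exact Finset.sum_congr rfl fun i _ => hF.1 _ _

/-- The `M` conjugates of `F` under rotation by roots of unity are vectors in a space of dimension
less than `M`, hence dependent. As in Artin's independence of characters, the first linear relation
is compatible with `Φ`, and any nonzero coefficient of it identifies two conjugates of `D_{g,M}`. -/
lemma exists_rot_of_finrank_lt [IsAlgClosed k] [FiniteDimensional (LaurentSeries k) V]
    {Φ : V →ₗ[k] V} {M : ℕ} [NeZero M] {g : LaurentSeries k} {F : V →ₗ[k] LaurentSeries k}
    (hF : F ∈ mapsTo Φ M g) (hF0 : F ≠ 0) (hM : Module.finrank (LaurentSeries k) V < M) :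
    ∃ (ζ : kˣ) (c : LaurentSeries k), ζ ^ M = 1 ∧ ζ ≠ 1 ∧ c ≠ 0 ∧
      rot ζ g * shift k M c = g * c := by
  obtain ⟨ω', hω'⟩ := HasEnoughRootsOfUnity.exists_primitiveRoot k M
  obtain ⟨ω, rfl⟩ := hω'.isUnit (NeZero.ne M)
  have hω : ω ^ M = 1 := Units.ext (by simpa using hω'.pow_eq_one)
  have hωo : orderOf ω = M := by rw [← orderOf_units, ← hω'.eq_orderOf]
  have hωp : ∀ j : ℕ, (ω ^ j) ^ M = 1 := fun j => by rw [pow_right_comm, hω, one_pow]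
  let b := Module.finBasis (LaurentSeries k) V
  let y : ℕ → (Fin (Module.finrank (LaurentSeries k) V) → LaurentSeries k) :=
    fun j i => rot (ω ^ j) (F (b i))
  obtain ⟨n, hli, hmem⟩ := exists_linearIndependent_initial (K := LaurentSeries k) y
  have hn : n < M := by
    have := hli.fintype_card_le_finrank
    simp at this
    omega
  obtain ⟨a, ha⟩ := Submodule.mem_span_range_iff_exists_fun (LaurentSeries k) |>.1 hmem
  have hrot : ∀ (j : ℕ) w, rot (ω ^ j) (F w) =
      ∑ i, ramify k M (b.repr w i) * y j i := fun j w => by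
    rw [mapsTo_apply_eq_sum hF b w, map_sum]
    exact Finset.sum_congr rfl fun i _ => by rw [map_mul, rot_ramify (hωp j)]
  have hsum : ∀ w, ∑ j : Fin n, a j * rot (ω ^ (j : ℕ)) (F w) = rot (ω ^ n) (F w) := fun w => by
    simp only [hrot, Finset.mul_sum]
    rw [Finset.sum_comm, ← ha]
    refine Finset.sum_congr rfl fun i _ => ?_
    rw [Finset.sum_apply, Finset.mul_sum]
    exact Finset.sum_congr rfl fun j _ => by rw [Pi.smul_apply, smul_eq_mul, mul_left_comm]
  have hrel : ∀ j : Fin n, a j * rot (ω ^ (j : ℕ)) g = rot (ω ^ n) g * shift k M (a j) := by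
    -- Evaluating the relation at `Φ w` and comparing it with its image under the twisted shift
    -- eliminates the `n`-th conjugate. The `d j` are the coefficients of the remaining relation
    -- pulled back through the shift, and they vanish by independence of the first `n` conjugates.
    choose d hd using fun j : Fin n =>
      exists_shift_eq' M (a j * rot (ω ^ (j : ℕ)) g - rot (ω ^ n) g * shift k M (a j))
    have hd0 : ∀ w, ∑ j : Fin n, d j * rot (ω ^ (j : ℕ)) (F w) = 0 := fun w => by
      refine (shift k M).injective ?_
      rw [map_sum, map_zero]
      have h1 : ∀ j : Fin n, shift k M (d j * rot (ω ^ (j : ℕ)) (F w)) =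
          a j * rot (ω ^ (j : ℕ)) (F (Φ w)) -
            rot (ω ^ n) g * shift k M (a j * rot (ω ^ (j : ℕ)) (F w)) := fun j => by
        rw [map_mul, hd, hF.2, map_mul, map_mul, shift_rot (hωp j)]
        ring
      rw [Finset.sum_congr rfl fun j _ => h1 j, Finset.sum_sub_distrib, hsum, ← Finset.mul_sum,
        ← map_sum, hsum, hF.2, map_mul, shift_rot (hωp n), sub_self]
    have hd1 := Fintype.linearIndependent_iff.1 hli d (by
      funext i
      rw [Finset.sum_apply]
      exact hd0 (b i))
    intro j
    have h1 := hd j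
    rw [hd1 j, map_zero] at h1
    exact sub_eq_zero.1 h1.symm
  obtain ⟨j, hj⟩ : ∃ j, a j ≠ 0 := by
    by_contra! h0
    refine hF0 (LinearMap.ext fun w => ?_)
    have h1 := hsum w
    simp only [h0, zero_mul, Finset.sum_const_zero] at h1
    exact (_root_.map_eq_zero _).1 h1.symm
  refine ⟨(ω ^ (j : ℕ))⁻¹ * ω ^ n, rot (ω ^ (j : ℕ))⁻¹ (a j), ?_, fun h => ?_, ?_, ?_⟩
  · rw [mul_pow, inv_pow, hωp, hωp, inv_one, mul_one]
  · have h1 : ω ^ (j : ℕ) = ω ^ n := by rwa [inv_mul_eq_one] at h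
    have h2 := pow_injOn_Iio_orderOf (x := ω) (by have := j.2; simp [hωo]; omega)
      (by simpa [hωo] using hn) h1
    exact j.2.ne h2
  · exact (map_ne_zero _).2 hj
  · have hinv : ((ω ^ (j : ℕ))⁻¹) ^ M = 1 := by rw [inv_pow, hωp, inv_one]
    rw [← rot_rot, shift_rot hinv, ← map_mul, ← hrel j, map_mul, rot_rot, inv_mul_cancel, rot_one,
      mul_comm]

end

/-- Irreducible objects are isomorphic to some `D_{g,q}`. -/
theorem Diff.IsIrreducible.exists_isIsoTo [IsAlgClosed k] {S : Diff.{u, v} k}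
    (hS : S.IsIrreducible) :
    ∃ (q : ℕ) (_ : NeZero q) (g : LaurentSeries k), S.IsIsoTo q g := by
  classical
  have hnt := hS.1
  have hsurj : Function.Surjective S.Phi.toLinearMap := S.Phi.surjective
  have hex : ∃ M : ℕ, ∃ (_ : NeZero M) (g : LaurentSeries k) (F : S.V →ₗ[k] LaurentSeries k),
      F ∈ mapsTo S.Phi.toLinearMap M g ∧ F ≠ 0 := by
    obtain ⟨M, N, hM, hN, g, F, hNM, hF0, hF1, hF2⟩ :=
      hasQuotient 1 (Φ := S.Phi.toLinearMap) S.semilinear hsurj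
    obtain rfl : N = M := by rw [hNM, one_mul]
    refine ⟨N, hN, g, { toFun := F, map_add' := map_add F, map_smul' := fun c w => ?_ },
      ⟨hF1, hF2⟩, fun h => hF0 (AddMonoidHom.ext fun w => ?_)⟩
    · rw [← C_smul, hF1, ramify_C, ← smul_eq_C_mul, RingHom.id_apply]
    · exact congrArg (fun G : S.V →ₗ[k] LaurentSeries k => G w) h
  obtain ⟨hM, g, F, hF, hF0⟩ := Nat.find_spec hex
  set M := Nat.find hex with hMdef
  -- If the minimal `M` exceeded the dimension, a rotation would identify conjugates and descent
  -- would lower `M`. In the other direction irreducibility makes `F` injective into a `K`-space of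
  -- dimension `M`, so `F` is bijective.
  have hrank : M ≤ Module.finrank (LaurentSeries k) S.V := by
    by_contra! hlt
    obtain ⟨ζ, c, hζ, hζ1, hc, hgc⟩ := exists_rot_of_finrank_lt hF hF0 hlt
    obtain ⟨M', hM', g', F', hlt', hF', hF0'⟩ := exists_mapsTo_of_rot hsurj hF hF0 hζ hζ1 hc hgc
    exact Nat.find_min hex hlt' ⟨hM', g', F', hF', hF0'⟩
  let L : S.V →ₗ[LaurentSeries k] (Fin M → LaurentSeries k) :=
    { toFun := fun w => decEquiv k M (F w)
      map_add' := fun w w' => by rw [map_add, map_add]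
      map_smul' := fun f w => by
        funext i
        change dec k M i (F (f • w)) = f * dec k M i (F w)
        rw [hF.1, dec_ramify_mul M i i.2] }
  have hker : LinearMap.ker L = ⊥ := by
    have hmem : ∀ w, w ∈ LinearMap.ker L ↔ F w = 0 := fun w => by
      rw [LinearMap.mem_ker]
      exact (decEquiv k M).map_eq_zero_iff
    refine (hS.2 (LinearMap.ker L) fun w hw => ?_).resolve_right fun htop => ?_
    · rw [hmem] at hw ⊢
      change F (S.Phi.toLinearMap w) = 0
      rw [hF.2, hw, map_zero, mul_zero]
    · exact hF0 (LinearMap.ext fun w => (hmem w).1 (htop ▸ Submodule.mem_top))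
  have hLinj := LinearMap.ker_eq_bot.1 hker
  have hLsurj : Function.Surjective L := by
    refine (LinearMap.injective_iff_surjective_of_finrank_eq_finrank ?_).1 hLinj
    refine le_antisymm (LinearMap.finrank_le_finrank_of_injective hLinj) ?_
    simpa using hrank
  refine ⟨M, hM, g, AddEquiv.ofBijective F.toAddMonoidHom ⟨fun w w' h => hLinj ?_, fun y => ?_⟩,
    hF.1, hF.2⟩
  · exact congrArg (decEquiv k M) h
  · obtain ⟨w, hw⟩ := hLsurj (decEquiv k M y)
    exact ⟨w, (decEquiv k M).injective hw⟩

end Descent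

/-! ### The image of the transform -/

section Image

variable {k : Type u} [Field k] [CharZero k]

/-- The operator `Φ - x` is topologically nilpotent. -/
def Diff.TopNilpotent (D : Diff.{u, v} k) (x : k) : Prop :=
  ∀ (w : D.V) (l : D.V →ₗ[LaurentSeries k] LaurentSeries k) (N : ℤ),
    ∃ m₀ : ℕ, ∀ m ≥ m₀, l ((D.subScalar x ^ m) w) ∈ ordGE k N

lemma Diff.Hom.map_subScalar_pow {D₁ D₂ : Diff.{u, v} k} (f : D₁ ⟶ D₂) (x : k) (m : ℕ) (w : D₁.V) :
    Diff.Hom.map f ((D₁.subScalar x ^ m) w) = (D₂.subScalar x ^ m) (Diff.Hom.map f w) := by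
  induction m with
  | zero => rfl
  | succ m ih =>
    rw [pow_succ', Module.End.mul_apply, pow_succ', Module.End.mul_apply, ← ih,
      Diff.subScalar_apply, Diff.subScalar_apply, map_sub, Diff.Hom.comm, ← C_smul, map_smul, C_smul]

/-- Topological nilpotence is tested on linear functionals. They extend along injections and pull
back along surjections, so the property passes to subquotients without a choice of lattices. -/
lemma Diff.TopNilpotent.of_injective {x : k} {P D : Diff.{u, v} k} (hD : D.TopNilpotent x) (i : P ⟶ D)
    (hi : Function.Injective (Diff.Hom.map i)) : P.TopNilpotent x := by
  intro w l N
  obtain ⟨g, hg⟩ := (Diff.Hom.map i).exists_leftInverse_of_injective (LinearMap.ker_eq_bot.2 hi)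
  obtain ⟨m₀, hm₀⟩ := hD (Diff.Hom.map i w) (l ∘ₗ g) N
  refine ⟨m₀, fun m hm => ?_⟩
  have h1 := hm₀ m hm
  rw [← Diff.Hom.map_subScalar_pow, LinearMap.comp_apply] at h1
  have h2 := LinearMap.congr_fun hg ((P.subScalar x ^ m) w)
  rw [LinearMap.comp_apply] at h2
  rwa [h2] at h1

lemma Diff.TopNilpotent.of_surjective {x : k} {P S : Diff.{u, v} k} (hP : P.TopNilpotent x) (p : P ⟶ S)
    (hp : Function.Surjective (Diff.Hom.map p)) : S.TopNilpotent x := by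
  intro w l N
  obtain ⟨w, rfl⟩ := hp w
  obtain ⟨m₀, hm₀⟩ := hP w (l ∘ₗ Diff.Hom.map p) N
  refine ⟨m₀, fun m hm => ?_⟩
  rw [← Diff.Hom.map_subScalar_pow]
  exact hm₀ m hm

lemma IsMellin.subScalar_eq {x : k} {E : Conn.{u, v} k} {D : Diff.{u, v} k} {e : E.V ≃ₗ[k] D.V}
    (h : IsMellin x E D e) (w : E.V) : D.subScalar x (e w) = e (tpow k 1 • w) := by
  rw [Diff.subScalar_apply, h.phi, ← map_smul, ← map_sub, zFun, add_smul, C_smul,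
    add_sub_cancel_left, coord_eq_tpow]

lemma IsMellin.topNilpotent {x : k} {E : Conn.{u, v} k} {D : Diff.{u, v} k} {e : E.V ≃ₗ[k] D.V}
    (h : IsMellin x E D e) : D.TopNilpotent x := by
  intro w l N
  obtain ⟨w, rfl⟩ := e.surjective w
  have hpow : ∀ m : ℕ, (D.subScalar x ^ m) (e w) = e (tpow k m • w) := fun m => by
    induction m with
    | zero => rw [Nat.cast_zero, tpow_zero, one_smul]; rfl
    | succ m ih =>
      rw [pow_succ', Module.End.mul_apply, ih, h.subScalar_eq, smul_smul, ← tpow_add, Nat.cast_succ,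
        add_comm]
  let b := Module.finBasis (LaurentSeries k) E.V
  let b' := Module.finBasis (LaurentSeries k) D.V
  obtain ⟨c, hc⟩ := exists_bound_linearMap b' (Module.Basis.singleton Unit (LaurentSeries k)) l
  obtain ⟨M, hM⟩ := (bounds_of_adicTopology_eq b b' e h.topology).1 (N + c)
  obtain ⟨j, hj⟩ := exists_mem_Lat b w
  refine ⟨(M - j).toNat, fun m hm => ?_⟩
  have h1 := hc _ _ (hM (tpow k m • w) ((tpow_smul_mem_Lat b).2 (Lat_anti b (by omega) hj))) ()
  rw [Module.Basis.singleton_repr, add_sub_cancel_right] at h1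
  rwa [hpow]

/-- On `K_q`, `Φ - x = g (φ - 1) + (g - x)`. If `g - x` had a leading term of degree at most zero,
it would dominate the other summand, and the iterates applied to `1` would not tend to zero. So `g =
x + …`, of order zero because `x ≠ 0`. -/
lemma Diff.TopNilpotent.order_eq {x : k} (hx : x ≠ 0) {S : Diff.{u, v} k} (hS : S.TopNilpotent x)
    {q : ℕ} [NeZero q] {g : LaurentSeries k} (hg : S.IsIsoTo q g) :
    g.order = 0 ∧ g.leadingCoeff = x := by
  obtain ⟨e, he, hePhi⟩ := hg
  have hsucc : ∀ m, e ((S.subScalar x ^ (m + 1)) (e.symm 1)) =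
      g * (shift k q (e ((S.subScalar x ^ m) (e.symm 1))) - e ((S.subScalar x ^ m) (e.symm 1))) +
        (g - HahnSeries.C x) * e ((S.subScalar x ^ m) (e.symm 1)) := fun m => by
    rw [pow_succ', Module.End.mul_apply, Diff.subScalar_apply, map_sub, hePhi, ← C_smul, he, ramify_C]
    ring
  have hnil : ∃ m₀ : ℕ, ∀ m ≥ m₀, e ((S.subScalar x ^ m) (e.symm 1)) ∈ ordGE k 1 := by
    let L : Fin q → S.V →ₗ[LaurentSeries k] LaurentSeries k := fun i =>
      { toFun := fun w => dec k q i (e w)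
        map_add' := fun w w' => by rw [map_add, map_add]
        map_smul' := fun f w => by
          rw [he, dec_ramify_mul q i i.2]
          rfl }
    choose m₀ hm₀ using fun i => hS (e.symm 1) (L i) 1
    refine ⟨Finset.univ.sup m₀, fun m hm => ?_⟩
    refine ordGE_anti (by have := NeZero.pos q; omega) (mem_of_dec_mem q (N := 1) fun i hi => ?_)
    exact hm₀ ⟨i, hi⟩ m ((Finset.le_sup (Finset.mem_univ _)).trans hm)
  have hmem : g - HahnSeries.C x ∈ ordGE k 1 := by
    by_contra hcon
    set h := g - HahnSeries.C x with hh
    have h0 : h ≠ 0 := fun h0 => hcon (by rw [h0]; exact zero_mem _)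
    have hp : h.order ≤ 0 := by
      by_contra hp
      exact hcon (ordGE_anti (by omega) (mem_ordGE_order h))
    have hgm : g ∈ ordGE k h.order := by
      have : g = h + HahnSeries.C x := by rw [hh, sub_add_cancel]
      rw [this]
      exact add_mem (mem_ordGE_order h) (ordGE_anti hp (C_mem x))
    have hq : (1 : ℤ) ≤ q := by have := NeZero.pos q; omega
    -- By induction the leading term of the `m`-th iterate is the `m`-th power of the leading term
    -- of `h = g - x`: the summand with `φ - 1` is of higher order by at least `q ≥ 1`.
    have key : ∀ m : ℕ, e ((S.subScalar x ^ m) (e.symm 1)) ∈ ordGE k (m * h.order) ∧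
        (e ((S.subScalar x ^ m) (e.symm 1))).coeff (m * h.order) = h.coeff h.order ^ m := by
      intro m
      induction m with
      | zero =>
        rw [pow_zero, Module.End.one_apply, AddEquiv.apply_symm_apply, Nat.cast_zero, zero_mul, pow_zero]
        exact ⟨one_mem_ordGE, by simp⟩
      | succ m ih =>
        have h1 := mul_mem_ordGE hgm (shift_sub_mem q ih.1)
        have h2 := mul_mem_ordGE (mem_ordGE_order h) ih.1
        have h3 := coeff_mul_ordGE (mem_ordGE_order h) ih.1
        have h4 : ((m + 1 : ℕ) : ℤ) * h.order = h.order + m * h.order := by push_cast; ring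
        rw [hsucc, h4]
        refine ⟨add_mem (ordGE_anti (by omega) h1) h2, ?_⟩
        rw [HahnSeries.coeff_add, h1 _ (by omega), zero_add, h3, ih.2, pow_succ']
    obtain ⟨m₀, hm₀⟩ := hnil
    have h1 := (key m₀).2
    rw [hm₀ m₀ le_rfl _ (by nlinarith)] at h1
    exact pow_ne_zero m₀ (coeff_order_ne h0) h1.symm
  have hc : g.coeff 0 = x := by
    have h1 := hmem 0 (by omega)
    rw [HahnSeries.coeff_sub, sub_eq_zero] at h1
    rw [h1]
    simp
  have hg0 : g ∈ ordGE k 0 := by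
    have : g = (g - HahnSeries.C x) + HahnSeries.C x := by rw [sub_add_cancel]
    rw [this]
    exact add_mem (ordGE_anti (by omega) hmem) (C_mem x)
  have hne : g.coeff 0 ≠ 0 := by rw [hc]; exact hx
  have hord : g.order = 0 := le_antisymm (HahnSeries.order_le_of_coeff_ne_zero hne)
    (le_order_of_mem (HahnSeries.ne_zero_of_coeff_ne_zero hne) hg0)
  exact ⟨hord, by rw [HahnSeries.leadingCoeff_eq, hord, hc]⟩

/-- Under the identification, `Φ - x` is multiplication by `z_x`: it is bijective and topologically
nilpotent. The latter passes to irreducible components, which are of the form `D_{g,q}` and so have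
`g = x + …`. -/
theorem IsMellin.orderZero [IsAlgClosed k] {x : k} (hx : x ≠ 0) {E : Conn.{u, v} k}
    {D : Diff.{u, v} k} {e : E.V ≃ₗ[k] D.V} (h : IsMellin x E D e) : orderZero x D := by
  constructor
  · rintro S ⟨hS, P, i, p, hi, hp⟩
    obtain ⟨q, hq, g, hg⟩ := hS.exists_isIsoTo
    obtain ⟨h1, h2⟩ :=
      ((h.topNilpotent.of_injective i hi).of_surjective p hp).order_eq hx hg
    exact ⟨q, hq, g, h1, h2, hg⟩
  · have h1 : (fun w : D.V => D.Phi w - x • w) =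
        e ∘ smulEquiv E.V (tpow_ne_zero (k := k) 1) ∘ e.symm := by
      funext w
      obtain ⟨w, rfl⟩ := e.surjective w
      rw [← Diff.subScalar_apply, h.subScalar_eq, Function.comp_apply, Function.comp_apply,
        e.symm_apply_apply]
      rfl
    rw [h1]
    exact e.bijective.comp ((smulEquiv E.V _).bijective.comp e.symm.bijective)

/-- For essential surjectivity, `hasGoodLattice_of_components` makes `Φ - x` a uniformizer for a
connection, and uniqueness of the transform identifies the value of `M` on it with the given object.
-/
theorem Transform.isEquivalence_lift [IsAlgClosed k] {x : k} (hx : x ≠ 0) (M : Transform.{u, v} x)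
    (h : ∀ E, LocalMellin.orderZero.{u, v} x (M.functor.obj E)) :
    ((LocalMellin.orderZero.{u, v} x).lift M.functor h).IsEquivalence where
  faithful := by
    have := M.faithful
    infer_instance
  full := by
    have := M.full hx
    infer_instance
  essSurj := ⟨fun D => by
    obtain ⟨E, e, hE, he⟩ := exists_isMellin_of_hasGoodLattice hx D.obj
      (hasGoodLattice_of_components _ D.obj rfl D.property.1) D.property.2
    obtain ⟨α, -⟩ := (M.isMellin ⟨E, hE⟩).exists_iso he
    exact ⟨⟨E, hE⟩, ⟨(LocalMellin.orderZero x).isoMk α⟩⟩⟩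

end Image

end LocalMellin

end

theorem mainTheorem3 {k : Type u} [Field k] [IsAlgClosed k] [CharZero k] (x : k) (hx : x ≠ 0) :
    Nonempty (LocalMellin.Transform.{u, v} x) ∧
    (∀ M M' : LocalMellin.Transform.{u, v} x, ∃ α : M.functor ≅ M'.functor,
      ∀ E w, LocalMellin.Diff.Hom.map (α.hom.app E) (M.ident E w) = M'.ident E w) ∧
    ∀ M : LocalMellin.Transform.{u, v} x,
      ∃ h : ∀ E, LocalMellin.orderZero.{u, v} x (M.functor.obj E),
        ((LocalMellin.orderZero.{u, v} x).lift M.functor h).IsEquivalence :=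
  ⟨LocalMellin.nonempty_transform hx, fun M M' => M.exists_iso M',
    fun M => ⟨fun E => (M.isMellin E).orderZero hx, M.isEquivalence_lift hx _⟩⟩
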